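/- **Setting.** Let $\mathcal S,\mathcal A$ be finite non-empty sets, $P(\cdot\mid s,a)$ transition probabilities on $\mathcal S$, $r:\mathcal S\times\mathcal A\to[0,1]$ a reward, $\gamma\in[0,1)$ a discount factor, and let a policy be a map $\pi:\mathcal S\to\Delta(\mathcal A)$. Let $\Omega:\Delta(\mathcal A)\to[0,C_\Phi]$ be differentiable with gradient $\nabla\Omega$ and $1$-strongly convex, $\Omega(q)\ge\Omega(p)+\langle\nabla\Omega(p),q-p\rangle+\frac12\|q-p\|_2^2$, with $\|\nabla\Omega(p)\|_\infty\le C^{(1)}_\Phi$ and $\|\nabla\Omega(p)-\nabla\Omega(q)\|_\infty\le C^{(2)}_\Phi\|p-q\|_1$ (for twice differentiable $\Omega$: the entries of the Hessian are bounded by $C_\Phi^{(2)}$). Put $\widetilde C_\Phi=C_\Phi+C_\Phi^{(1)}+C_\Phi^{(2)}$. For $\lambda\ge0$ let $V_\lambda^\pi(s)=\mathbb E_\pi[\sum_{n\ge0}\gamma^n(r(s_n,a_n)-\lambda\Omega(\pi(\cdot|s_n)))\mid s_0=s]$, $J_\xi(\pi,\lambda)=\sum_s\xi(s)V^\pi_\lambda(s)$,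 $d_{\pi,\xi}(s)=(1-\gamma)\sum_{n\ge0}\gamma^n\Pr_{\pi,\,s_0\sim\xi}(s_n=s)$, and let $\pi_\lambda^*$ be an optimal policy for $V_\lambda$ (simultaneously for all starting states). Let $\mu,\nu$ be distributions on $\mathcal S$ with $\nu(s)>0$ for all $s$, let $\lambda_0>0$, and assume $\|\mu/\nu\|_\infty\le\rho$ and $\|d_{\pi^*_\lambda,\nu}/d_{\pi,\nu}\|_\infty\le\rho_\nu$ for all $0\le\lambda\le\lambda_0$ and all policies $\pi$. **Algorithm.** AdaptReduce starts from an arbitrary policy $\widehat\pi_0$ and runs epochs $t=0,\dots,T-1$ with $\lambda_t=\lambda_0/2^t$. Epoch $t$ sets $\pi_0=\widehat\pi_t$ and performs $T_t\ge 1$ steps of sampled projected gradient ascent, $\pi_{k+1}=\mathrm{Proj}_{\Delta(\mathcal A)^{\mathcal S}}(\pi_k+\eta_t\widetilde\nabla J_\nu(\pi_k,\lambda_t))$, with $\eta_t=1/L_{\lambda_t}$, $L_\lambda=\frac{4|\mathcal A|(1+\lambda\widetilde C_\Phi)}{(1-\gamma)^3}$. Here $\widetilde\nabla J_\nu(\pi,\lambda)$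 is the average over $N_t$ fresh independent trajectories $(s_0,a_0),\dots,(s_{K_t-1},a_{K_t-1})$ of $$\widehat X(s,a)=\tfrac{|\mathcal A|}{1-\gamma}\Big[r(s_0,a_0)+\sum_{n=1}^{K_t-1}\gamma^n\big(r(s_n,a_n)-\lambda\Omega(\pi(\cdot|s_n))\big)-\lambda\,\partial_a\Omega(\pi(\cdot|s_0))\Big]\mathbf 1\{s_0=s,a_0=a\},$$ where $s_0$ is obtained by drawing a state from $\nu$, repeatedly accepting the current state with probability $1-\gamma$ and otherwise making a transition under $\pi$ (after $K_t$ transitions the state is accepted in any case), $a_0$ is uniform on $\mathcal A$, and the rest of the trajectory follows $\pi$. The output $\widehat\pi_{t+1}$ of the epoch is assumed to be an iterate attaining $\min_{0\le k<T_t}\big(J_\nu(\pi^*_{\lambda_t},\lambda_t)-J_\nu(\pi_{k+1},\lambda_t)\big)$. The algorithm returns $\widehat\pi_T$. **Theorem.** For all $\varepsilon\in(0,1]$ and $\delta\in(0,1)$ one can choose $T$ and, for every $t$, $T_t,N_t,K_t\geq 1$, depending only on $|\mathcal S|,|\mathcal A|,\gamma,\rho,\rho_\nu,C_\Phi,C_\Phi^{(1)},C_\Phi^{(2)},\lambda_0,\varepsilon,\delta$,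 such that with probability at least $1-\delta$ the returned policy is $\varepsilon$-optimal with respect to $\mu$, that is, $\max_\pi V_0^\pi(\mu)-V_0^{\widehat\pi_T}(\mu)\le\varepsilon$ (where $V_0^\pi(\mu)=J_\mu(\pi,0)$), while the total iteration complexity is $$\sum_{t<T}T_t\le c_1\,\frac{|\mathcal S||\mathcal A|\rho\rho_\nu^2\widetilde C_\Phi}{\varepsilon(1-\gamma)^3},$$ the number of trajectories is $$\sum_{t<T}T_tN_t\le c_2\,\frac{|\mathcal S|^4|\mathcal A|^3\rho^5\rho_\nu^6(1+\lambda_0\widetilde C_\Phi)^3}{\varepsilon^5(1-\gamma)^7}\,\log\frac{2|\mathcal S||\mathcal A|\rho\rho_\nu(1+\lambda_0\widetilde C_\Phi)}{\varepsilon(1-\gamma)\delta},$$ and the truncation lengths satisfy $K_t\le 1+\log\Big(c_2\frac{|\mathcal S||\mathcal A|\rho^2\rho_\nu^2(1+\lambda_0\widetilde C_\Phi)}{\varepsilon^2(1-\gamma)^2}\Big)/\log\frac1\gamma$ (read as $K_t\le 1$ if $\gamma=0$). The constant $c_1$ depends only on $\lambda_0$, and $c_2$ only on a positive lower bound for $\lambda_0$.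 -/

import Mathlib

open scoped Matrix

noncomputable section

namespace RegMDP

/-- A policy: a probability vector over actions for every state. -/
abbrev Policy (S A : Type*) [Fintype A] := S → stdSimplex ℝ A

/-- A finite discounted MDP with rewards in `[0, 1]` and discount factor `γ ∈ [0, 1)`. -/
structure MDP (S A : Type*) [Fintype S] (γ : ℝ) where
  /-- transition probabilities -/
  P : S → A → stdSimplex ℝ S
  /-- reward function -/
  r : S → A → ℝ
  r_nonneg : ∀ s a, 0 ≤ r s a
  r_le_one : ∀ s a, r s a ≤ 1
  γ_nonneg : 0 ≤ γ
  γ_lt_one : γ < 1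

/-- `W` is a smooth, bounded, `1`-strongly convex regularizer on the probability simplex with
gradient `G`: `0 ≤ W ≤ B0`, `|∂ₐ W| ≤ B1`, and the gradient is Lipschitz with constant `B2`
(a bound `B2` on the entries of the Hessian, when `W` is twice differentiable). -/
structure IsRegularizer {A : Type*} [Fintype A] (W : (A → ℝ) → ℝ) (G : (A → ℝ) → A → ℝ)
    (B0 B1 B2 : ℝ) : Prop where
  nonneg : ∀ p ∈ stdSimplex ℝ A, 0 ≤ W p
  le_bound : ∀ p ∈ stdSimplex ℝ A, W p ≤ B0
  hasFDerivWithinAt : ∀ p ∈ stdSimplex ℝ A,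
    HasFDerivWithinAt W
      (∑ a, G p a • (ContinuousLinearMap.proj a : (A → ℝ) →L[ℝ] ℝ)) (stdSimplex ℝ A) p
  strong_convex : ∀ p ∈ stdSimplex ℝ A, ∀ q ∈ stdSimplex ℝ A,
    W p + ∑ a, G p a * (q a - p a) + 1 / 2 * ∑ a, (q a - p a) ^ 2 ≤ W q
  grad_bound : ∀ p ∈ stdSimplex ℝ A, ∀ a, |G p a| ≤ B1
  grad_lipschitz : ∀ p ∈ stdSimplex ℝ A, ∀ q ∈ stdSimplex ℝ A, ∀ a,
    |G p a - G q a| ≤ B2 * ∑ b, |p b - q b|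

section Values

variable {S A : Type*} [Fintype S] [DecidableEq S] [Fintype A] {γ : ℝ}

/-- State transition matrix of a policy. -/
def transMat (M : MDP S A γ) (π : Policy S A) : Matrix S S ℝ :=
  Matrix.of fun s s' => ∑ a, π s a * M.P s a s'

/-- Expected regularized one-step reward `∑ₐ π(a|s) r(s,a) - lam * W(π(·|s))`. -/
def regReward (M : MDP S A γ) (W : (A → ℝ) → ℝ) (lam : ℝ) (π : Policy S A) (s : S) : ℝ :=
  (∑ a, π s a * M.r s a) - lam * W (π s)

/-- Regularized value function `E[∑ₜ γᵗ (r(sₜ,aₜ) - lam * W(π(·|sₜ))) | s₀ = s]`; the law of `sₜ`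
is row `s` of the `t`-th power of the transition matrix. -/
def value (M : MDP S A γ) (W : (A → ℝ) → ℝ) (lam : ℝ) (π : Policy S A) (s : S) : ℝ :=
  ∑' n : ℕ, γ ^ n * ((transMat M π ^ n) *ᵥ regReward M W lam π) s

/-- The objective `J_ξ(π, lam)` with initial state distribution `ξ`. -/
def J (M : MDP S A γ) (W : (A → ℝ) → ℝ) (ξ : stdSimplex ℝ S) (π : Policy S A) (lam : ℝ) : ℝ :=
  ∑ s, ξ s * value M W lam π s

/-- `π` is an optimal policy of the MDP regularized with coefficient `lam`,
simultaneously for all starting states. -/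
def IsOptimal (M : MDP S A γ) (W : (A → ℝ) → ℝ) (lam : ℝ) (π : Policy S A) : Prop :=
  ∀ (π' : Policy S A) (s : S), value M W lam π' s ≤ value M W lam π s

/-- `π` is `ε`-optimal for the unregularized MDP started from `ξ`: `V*(ξ) - V^π(ξ) ≤ ε`. -/
def IsEpsOptimal (M : MDP S A γ) (W : (A → ℝ) → ℝ) (ξ : stdSimplex ℝ S) (ε : ℝ)
    (π : Policy S A) : Prop :=
  ∀ π' : Policy S A, J M W ξ π' 0 - J M W ξ π 0 ≤ ε

/-- Discounted state visitation distribution `d_{π,ξ}`. -/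
def visit (M : MDP S A γ) (ξ : stdSimplex ℝ S) (π : Policy S A) (s : S) : ℝ :=
  (1 - γ) * ∑' n : ℕ, γ ^ n * ((⇑ξ) ᵥ* (transMat M π ^ n)) s

end Values

section Sampling

/-- A probability vector as a probability mass function. -/
def draw {X : Type*} [Fintype X] (p : stdSimplex ℝ X) : PMF X :=
  PMF.ofFintype (fun x => ENNReal.ofReal (p x)) (by
    have h0 : ∀ x ∈ Finset.univ, 0 ≤ p x := fun x _ => p.2.1 x
    have h : ∑ x, p x = 1 := p.2.2
    rw [← ENNReal.ofReal_sum_of_nonneg h0, h, ENNReal.ofReal_one])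

/-- A biased coin which shows `true` with probability `q`. -/
def coin (q : ℝ) (h0 : 0 ≤ q) (h1 : q < 1) : PMF Bool :=
  PMF.ofFintype (fun b => if b then ENNReal.ofReal q else ENNReal.ofReal (1 - q)) (by
    have h2 : ENNReal.ofReal q + ENNReal.ofReal (1 - q) = 1 := by
      rw [← ENNReal.ofReal_add h0 (by linarith)]
      simp
    simpa using h2)

/-- `n` independent draws from `p`. -/
def iid {X : Type*} (p : PMF X) : (n : ℕ) → PMF (Fin n → X)
  | 0 => PMF.pure Fin.elim0
  | n + 1 => p.bind fun x => (iid p n).map fun xs => Fin.cons x xs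

variable {S A : Type*} [Fintype S] [Fintype A] {γ : ℝ}

/-- One transition under `π`. -/
def step (M : MDP S A γ) (π : Policy S A) (s : S) : PMF S :=
  (draw (π s)).bind fun a => draw (M.P s a)

/-- Accept the current state with probability `1 - γ`, otherwise make a transition and repeat;
after `n` transitions the state is accepted in any case. -/
def acceptFrom (M : MDP S A γ) (π : Policy S A) : ℕ → S → PMF S
  | 0, s => PMF.pure s
  | n + 1, s => (coin γ M.γ_nonneg M.γ_lt_one).bind fun go =>
      if go then (step M π s).bind (acceptFrom M π n) else PMF.pure s

/-- The first `n` state-action pairs of the trajectory of `π` started at a given state. -/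
def trajectory (M : MDP S A γ) (π : Policy S A) : ℕ → S → PMF (List (S × A))
  | 0, _ => PMF.pure []
  | n + 1, s => (draw (π s)).bind fun a => (draw (M.P s a)).bind fun s' =>
      (trajectory M π n s').map fun l => (s, a) :: l

/-- Discounted regularized return of a finite trajectory. -/
def pathReturn (M : MDP S A γ) (W : (A → ℝ) → ℝ) (lam : ℝ) (π : Policy S A) :
    List (S × A) → ℝ
  | [] => 0
  | (s, a) :: l => M.r s a - lam * W (π s) + γ * pathReturn M W lam π l

/-- A sampled trajectory `(s₀, a₀), …, (s_{K-1}, a_{K-1})` for gradient estimation: `s₀` is drawn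
from `ν` followed by the acceptance scheme, `a₀` uniformly, the rest according to `π`. The output
is `((s₀, a₀), [(s₁, a₁), …])`. -/
def gradTrajectory [Nonempty A] (M : MDP S A γ) (ν : stdSimplex ℝ S) (π : Policy S A) (K : ℕ) :
    PMF ((S × A) × List (S × A)) :=
  (draw ν).bind fun s => (acceptFrom M π K s).bind fun s₀ =>
    (PMF.uniformOfFintype A).bind fun a₀ => (draw (M.P s₀ a₀)).bind fun s₁ =>
      (trajectory M π (K - 1) s₁).map fun l => ((s₀, a₀), l)

open Classical in
/-- The gradient estimate from one trajectory: with `Q` the truncated estimate of the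
state-action value, it is `|A|/(1-γ) * (Q - lam * ∂_{a₀} W(π(·|s₀)))` at `(s₀, a₀)` and `0` at the
other coordinates. -/
def gradOfTrajectory (M : MDP S A γ) (W : (A → ℝ) → ℝ) (G : (A → ℝ) → A → ℝ) (lam : ℝ)
    (π : Policy S A) (τ : (S × A) × List (S × A)) (s : S) (a : A) : ℝ :=
  if s = τ.1.1 ∧ a = τ.1.2 then
    (Fintype.card A : ℝ) / (1 - γ) *
      ((M.r s a + γ * pathReturn M W lam π τ.2) - lam * G (π s) a)
  else 0

/-- The gradient estimator from `N` independent trajectories truncated at length `K`. -/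
def gradEstimate [Nonempty A] (M : MDP S A γ) (W : (A → ℝ) → ℝ) (G : (A → ℝ) → A → ℝ)
    (ν : stdSimplex ℝ S) (lam : ℝ) (N K : ℕ) (π : Policy S A) : PMF (S → A → ℝ) :=
  (iid (gradTrajectory M ν π K) N).map fun τ s a =>
    1 / (N : ℝ) * ∑ n, gradOfTrajectory M W G lam π (τ n) s a

end Sampling

section Algorithm

variable {S A : Type*} [Fintype S] [Fintype A]

/-- The objective minimized by a projected gradient ascent step. -/
def proxObjective (η : ℝ) (π : Policy S A) (g : S → A → ℝ) (π' : Policy S A) : ℝ :=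
  -(∑ s, ∑ a, g s a * (π' s a - π s a)) + 1 / (2 * η) * ∑ s, ∑ a, (π' s a - π s a) ^ 2

theorem exists_prox_min [Nonempty A] (η : ℝ) (π : Policy S A) (g : S → A → ℝ) :
    ∃ x : Policy S A, ∀ y : Policy S A, proxObjective η π g x ≤ proxObjective η π g y := by
  have hev : ∀ s a, Continuous fun x : Policy S A => (x s a : ℝ) := fun s a =>
    (continuous_apply a).comp (continuous_subtype_val.comp (continuous_apply s))
  have hc : Continuous (proxObjective η π g) := by
    unfold proxObjective
    refine Continuous.add (Continuous.neg ?_) (Continuous.mul continuous_const ?_)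
    · exact continuous_finsetSum _ fun s _ => continuous_finsetSum _ fun a _ =>
        continuous_const.mul ((hev s a).sub continuous_const)
    · exact continuous_finsetSum _ fun s _ => continuous_finsetSum _ fun a _ =>
        ((hev s a).sub continuous_const).pow 2
  obtain ⟨x, -, hx⟩ := isCompact_univ.exists_isMinOn (Set.univ_nonempty) hc.continuousOn
  exact ⟨x, fun y => hx (Set.mem_univ y)⟩

/-- Projected gradient ascent step: the minimizer over all policies of
`⟨-g, π' - π⟩ + ‖π' - π‖² / (2η)`, i.e. the projection of `π + η g`. -/
def pgaStep [Nonempty A] (η : ℝ) (π : Policy S A) (g : S → A → ℝ) : Policy S A :=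
  Classical.choose (exists_prox_min η π g)

/-- The smoothness constant `4|A| (1 + lam * Ct) / (1-γ)³` of `π ↦ J_ν(π, lam)`. -/
def smoothConst (A : Type*) [Fintype A] (γ Ct lam : ℝ) : ℝ :=
  4 * (Fintype.card A : ℝ) / (1 - γ) ^ 3 + lam * (4 * (Fintype.card A : ℝ) * Ct / (1 - γ) ^ 3)

variable {γ : ℝ}

/-- Law of the iterates `π₀, …, π_k` of sampled projected gradient ascent with step size `η`. -/
def pgaPath [Nonempty A] (M : MDP S A γ) (W : (A → ℝ) → ℝ) (G : (A → ℝ) → A → ℝ)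
    (ν : stdSimplex ℝ S) (lam η : ℝ) (N K : ℕ) (π₀ : Policy S A) :
    (k : ℕ) → PMF (Fin (k + 1) → Policy S A)
  | 0 => PMF.pure fun _ => π₀
  | k + 1 => (pgaPath M W G ν lam η N K π₀ k).bind fun path =>
      (gradEstimate M W G ν lam N K (path (Fin.last k))).map fun g =>
        Fin.snoc (α := fun _ => Policy S A) path (pgaStep η (path (Fin.last k)) g)

/-- `AdaptReduce` with sampled projected gradient ascent: law of the policy after `t` epochs.
Epoch `t` uses `lam_t = lam₀ / 2^t`, step size `1 / L_{lam_t}`, `I t` iterations, `N t`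
trajectories of truncation length `K t` per iteration; the rule `sel t` selects among
the iterates `π₁, …, π_{I t}` the output of the epoch. -/
def adaptReduce [Nonempty A] (M : MDP S A γ) (W : (A → ℝ) → ℝ) (G : (A → ℝ) → A → ℝ)
    (ν : stdSimplex ℝ S) (lam₀ Ct : ℝ) (I N K : ℕ → ℕ)
    (sel : (t : ℕ) → (Fin (I t + 1) → Policy S A) → Fin (I t)) (π₀ : Policy S A) :
    ℕ → PMF (Policy S A)
  | 0 => PMF.pure π₀
  | t + 1 => (adaptReduce M W G ν lam₀ Ct I N K sel π₀ t).bind fun π =>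
      (pgaPath M W G ν (lam₀ / 2 ^ t) (1 / smoothConst A γ Ct (lam₀ / 2 ^ t)) (N t) (K t) π
        (I t)).map fun path => path (sel t path).succ

end Algorithm

end RegMDP

end

/-! Put gap_t = λ_t C̃/(1-γ), which bounds the amount by which a regularizer of weight λ_t can shift
any value. The invariant is that epoch t ends at a policy whose J_ν(·, λ_t) is within gap_t of
optimal. Halving λ_t changes the objective by at most gap_{t+1}, so the next epoch starts within
gap_t + gap_{t+1} = 3 gap_{t+1} of its own optimum (`objective_sub_objective`). After the last
epoch, the optimality gap is moved from ν to μ at the price of a factor ρ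
(`gap_change_distribution`), and dropping the regularizer costs one more gap_m.

Inside an epoch the objective is not assumed concave. It has a quadratic lower bound
(`objective_smooth`) and is gradient dominated (`gap_le_dot_policyGrad`); both rest on
`performance_difference`, so J is never differentiated. Let each gradient estimate have squared
error at most (h/2)². A projected step longer than h/L gains more than h²/(4L)
(`IsAccurateStep.progress`). A shorter step makes its end point almost stationary, with gap at most
3 h ρν √(2|S|) (`IsAccurateStep.gap_le`). Since the gain is bounded by the initial gap, a short step
occurs within 4 L D gap_t / h² iterations, where D gap_t bounds the initial gap
(`exists_iterate_gap_le`). With h proportional to gap_t this number is of order L_t/gap_t instead of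
L_t/gap_t², thanks to the warm start, and its sum over the epochs is geometric, of order 1/ε.

The sampled gradient is sparse and bounded, so a Bernstein bound in each coordinate gives a
Euclidean error of order R² l/N (`iid_vector_concentration`), and truncation contributes a bias of
order γ^K (`abs_bias_le`). A union bound over all iterations of all epochs gives the confidence.
What remains is arithmetic (`exists_parameters`), plus the degenerate case C̃ < 1/2, in which strong
convexity leaves only one action. -/

noncomputable section

namespace RegMDP

/-! ### Expectations under probability mass functions -/

section Expectation

variable {X Y : Type*}

/-- Expectation of an extended nonnegative function. -/
def lexpect (p : PMF X) (f : X → ENNReal) : ENNReal := ∑' x, p x * f x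

/-- Expectation of a (bounded) real function. -/
def expect (p : PMF X) (f : X → ℝ) : ℝ := ∑' x, (p x).toReal * f x

theorem lexpect_pure (a : X) (f : X → ENNReal) : lexpect (PMF.pure a) f = f a := by
  classical
  unfold lexpect
  rw [tsum_eq_single a]
  · simp
  · intro b hb
    simp [PMF.pure_apply, hb]

theorem lexpect_bind (p : PMF X) (q : X → PMF Y) (f : Y → ENNReal) :
    lexpect (p.bind q) f = lexpect p fun x => lexpect (q x) f := by
  unfold lexpect
  simp_rw [PMF.bind_apply, ← ENNReal.tsum_mul_right, ← ENNReal.tsum_mul_left]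
  rw [ENNReal.tsum_comm]
  simp_rw [mul_assoc]

theorem lexpect_map (p : PMF X) (g : X → Y) (f : Y → ENNReal) :
    lexpect (p.map g) f = lexpect p fun x => f (g x) := by
  unfold PMF.map
  rw [lexpect_bind]
  simp [lexpect_pure]

theorem lexpect_mono (p : PMF X) {f g : X → ENNReal} (h : ∀ x, f x ≤ g x) :
    lexpect p f ≤ lexpect p g :=
  ENNReal.tsum_le_tsum fun x => mul_le_mul_right (h x) _

theorem lexpect_mul_const (p : PMF X) (f : X → ENNReal) (c : ENNReal) :
    lexpect p (fun x => f x * c) = lexpect p f * c := by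
  unfold lexpect
  simp_rw [← mul_assoc]
  rw [ENNReal.tsum_mul_right]

theorem lexpect_const_mul (p : PMF X) (f : X → ENNReal) (c : ENNReal) :
    lexpect p (fun x => c * f x) = c * lexpect p f := by
  simp_rw [mul_comm c]
  exact lexpect_mul_const p f c

theorem lexpect_const (p : PMF X) (c : ENNReal) : lexpect p (fun _ => c) = c := by
  unfold lexpect
  rw [ENNReal.tsum_mul_right, p.tsum_coe, one_mul]

theorem lexpect_add (p : PMF X) (f g : X → ENNReal) :
    lexpect p (fun x => f x + g x) = lexpect p f + lexpect p g := by
  unfold lexpect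
  simp_rw [mul_add]
  exact ENNReal.tsum_add

theorem toOuterMeasure_eq_lexpect (p : PMF X) (s : Set X) :
    p.toOuterMeasure s = lexpect p (s.indicator fun _ => 1) := by
  rw [PMF.toOuterMeasure_apply]
  unfold lexpect
  congr 1 with x
  by_cases h : x ∈ s <;> simp [h]

theorem toOuterMeasure_le_lexpect (p : PMF X) (s : Set X) (f : X → ENNReal)
    (h : ∀ x ∈ s, 1 ≤ f x) : p.toOuterMeasure s ≤ lexpect p f := by
  rw [toOuterMeasure_eq_lexpect]
  refine lexpect_mono p fun x => ?_
  by_cases hx : x ∈ s <;> simp [hx, h]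

/-- Union bound along a two-stage experiment. -/
theorem toOuterMeasure_bind_le (p : PMF X) (q : X → PMF Y) (s : Set X) (t : Set Y)
    (a b : ENNReal) (hp : p.toOuterMeasure s ≤ a)
    (hq : ∀ x, x ∉ s → (q x).toOuterMeasure t ≤ b) :
    (p.bind q).toOuterMeasure t ≤ a + b := by
  rw [toOuterMeasure_eq_lexpect, lexpect_bind]
  calc lexpect p (fun x => lexpect (q x) (t.indicator fun _ => 1))
      ≤ lexpect p (fun x => s.indicator (fun _ => 1) x + b) := by
        refine lexpect_mono p fun x => ?_
        by_cases hx : x ∈ s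
        · simp only [hx, Set.indicator_of_mem]
          refine le_add_right ?_
          refine (lexpect_mono (q x) (g := fun _ => 1) fun y => ?_).trans_eq (lexpect_const _ _)
          by_cases hy : y ∈ t <;> simp [hy]
        · simp only [hx, not_false_eq_true, Set.indicator_of_notMem, zero_add]
          rw [← toOuterMeasure_eq_lexpect]
          exact hq x hx
    _ = p.toOuterMeasure s + b := by
        rw [lexpect_add, lexpect_const, toOuterMeasure_eq_lexpect]
    _ ≤ a + b := by gcongr

theorem ofReal_le_toOuterMeasure_of_compl (p : PMF X) (s : Set X) (d : ℝ) (hd : 0 ≤ d)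
    (h : p.toOuterMeasure sᶜ ≤ ENNReal.ofReal d) :
    ENNReal.ofReal (1 - d) ≤ p.toOuterMeasure s := by
  have h1 : p.toOuterMeasure s + p.toOuterMeasure sᶜ = 1 := by
    rw [toOuterMeasure_eq_lexpect, toOuterMeasure_eq_lexpect, ← lexpect_add,
      ← lexpect_const p 1]
    refine congrArg (lexpect p) (funext fun x => ?_)
    by_cases hx : x ∈ s <;> simp [hx, lexpect_const]
  rw [ENNReal.ofReal_sub _ hd, ENNReal.ofReal_one, tsub_le_iff_right, ← h1]
  gcongr

theorem summable_expect (p : PMF X) (f : X → ℝ) (c : ℝ) (hf : ∀ x, |f x| ≤ c) :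
    Summable fun x => (p x).toReal * f x := by
  have h : Summable fun x => (p x).toReal :=
    ENNReal.summable_toReal (by rw [p.tsum_coe]; exact ENNReal.one_ne_top)
  refine Summable.of_norm_bounded (h.mul_right c) fun x => ?_
  rw [norm_mul, Real.norm_eq_abs, Real.norm_eq_abs, abs_of_nonneg ENNReal.toReal_nonneg]
  exact mul_le_mul_of_nonneg_left (hf x) ENNReal.toReal_nonneg

theorem expect_const (p : PMF X) (c : ℝ) : expect p (fun _ => c) = c := by
  unfold expect
  rw [tsum_mul_right, ← ENNReal.tsum_toReal_eq fun x => p.apply_ne_top x, p.tsum_coe]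
  simp

theorem expect_add (p : PMF X) (f g : X → ℝ) (c d : ℝ) (hf : ∀ x, |f x| ≤ c)
    (hg : ∀ x, |g x| ≤ d) :
    expect p (fun x => f x + g x) = expect p f + expect p g := by
  unfold expect
  simp_rw [mul_add]
  exact (summable_expect p f c hf).tsum_add (summable_expect p g d hg)

theorem expect_const_mul (p : PMF X) (f : X → ℝ) (c : ℝ) :
    expect p (fun x => c * f x) = c * expect p f := by
  unfold expect
  rw [← tsum_mul_left]
  congr 1 with x
  ring

theorem expect_mono (p : PMF X) (f g : X → ℝ) (c d : ℝ) (hf : ∀ x, |f x| ≤ c)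
    (hg : ∀ x, |g x| ≤ d) (h : ∀ x, f x ≤ g x) : expect p f ≤ expect p g :=
  (summable_expect p f c hf).tsum_le_tsum
    (fun x => mul_le_mul_of_nonneg_left (h x) ENNReal.toReal_nonneg) (summable_expect p g d hg)

theorem abs_expect_le (p : PMF X) (f : X → ℝ) (c : ℝ) (hf : ∀ x, |f x| ≤ c) :
    |expect p f| ≤ c := by
  have hc : ∀ _ : X, |c| ≤ |c| := fun _ => le_rfl
  have hc' : ∀ _ : X, |-c| ≤ |c| := fun _ => (abs_neg c).le
  refine abs_le.2 ⟨?_, ?_⟩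
  · have := expect_mono p (fun _ => -c) f _ c hc' hf fun x => (abs_le.1 (hf x)).1
    rwa [expect_const] at this
  · have := expect_mono p f (fun _ => c) c _ hf hc fun x => (abs_le.1 (hf x)).2
    rwa [expect_const] at this

theorem expect_sum {ι : Type*} (p : PMF X) (s : Finset ι) (f : ι → X → ℝ) (c : ℝ)
    (hf : ∀ i x, |f i x| ≤ c) :
    expect p (fun x => ∑ i ∈ s, f i x) = ∑ i ∈ s, expect p (f i) := by
  unfold expect
  simp_rw [Finset.mul_sum]
  exact Summable.tsum_finsetSum fun i _ => summable_expect p (f i) c (hf i)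

theorem lexpect_ofReal (p : PMF X) (f : X → ℝ) (c : ℝ) (hf : ∀ x, |f x| ≤ c)
    (h0 : ∀ x, 0 ≤ f x) :
    lexpect p (fun x => ENNReal.ofReal (f x)) = ENNReal.ofReal (expect p f) := by
  unfold lexpect expect
  rw [ENNReal.ofReal_tsum_of_nonneg
    (fun x => mul_nonneg ENNReal.toReal_nonneg (h0 x)) (summable_expect p f c hf)]
  congr 1 with x
  rw [ENNReal.ofReal_mul ENNReal.toReal_nonneg, ENNReal.ofReal_toReal (p.apply_ne_top x)]

theorem expect_nonneg (p : PMF X) (f : X → ℝ) (h0 : ∀ x, 0 ≤ f x) : 0 ≤ expect p f :=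
  tsum_nonneg fun x => mul_nonneg ENNReal.toReal_nonneg (h0 x)

/-- Adding the constant c makes f nonnegative, so the identity reduces to Tonelli for `lexpect`; the
constant is then removed on both sides. -/
theorem expect_bind (p : PMF X) (q : X → PMF Y) (f : Y → ℝ) (c : ℝ) (hf : ∀ x, |f x| ≤ c) :
    expect (p.bind q) f = expect p fun x => expect (q x) f := by
  have hfc : ∀ y, |f y + c| ≤ 2 * c := fun y => by
    have := abs_le.1 (hf y)
    exact abs_le.2 ⟨by linarith, by linarith⟩
  have hf0 : ∀ y, 0 ≤ f y + c := fun y => by linarith [(abs_le.1 (hf y)).1]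
  have hcc : ∀ _ : Y, |c| ≤ |c| := fun _ => le_rfl
  have shift : ∀ r : PMF Y, expect r (fun y => f y + c) = expect r f + c := fun r => by
    rw [expect_add r f (fun _ => c) c |c| hf hcc, expect_const]
  have key : expect (p.bind q) (fun y => f y + c)
      = expect p fun x => expect (q x) fun y => f y + c := by
    have h1 := lexpect_ofReal (p.bind q) _ _ hfc hf0
    rw [lexpect_bind] at h1
    simp_rw [lexpect_ofReal (q _) _ _ hfc hf0] at h1
    rw [lexpect_ofReal p _ (2 * c) (fun x => abs_expect_le _ _ _ hfc)
      (fun x => expect_nonneg _ _ hf0)] at h1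
    exact ((ENNReal.ofReal_eq_ofReal_iff (expect_nonneg _ _ fun x => expect_nonneg _ _ hf0)
      (expect_nonneg _ _ hf0)).1 h1).symm
  rw [shift] at key
  simp_rw [shift] at key
  rw [expect_add p _ (fun _ => c) c |c| (fun x => abs_expect_le _ _ _ hf) (fun _ => le_rfl),
    expect_const] at key
  linarith

theorem expect_pure (a : X) (f : X → ℝ) : expect (PMF.pure a) f = f a := by
  classical
  unfold expect
  rw [tsum_eq_single a]
  · simp
  · intro b hb
    simp [PMF.pure_apply, hb]

theorem expect_map (p : PMF X) (g : X → Y) (f : Y → ℝ) (c : ℝ) (hf : ∀ x, |f x| ≤ c) :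
    expect (p.map g) f = expect p fun x => f (g x) := by
  unfold PMF.map
  rw [expect_bind _ _ _ c hf]
  simp [expect_pure]

theorem expect_draw [Fintype X] (p : stdSimplex ℝ X) (f : X → ℝ) :
    expect (draw p) f = ∑ x, p x * f x := by
  unfold expect draw
  rw [tsum_fintype]
  refine Finset.sum_congr rfl fun x _ => ?_
  have h0 : 0 ≤ p x := p.2.1 x
  rw [PMF.ofFintype_apply, ENNReal.toReal_ofReal h0]

theorem expect_uniform [Fintype X] [Nonempty X] (f : X → ℝ) :
    expect (PMF.uniformOfFintype X) f = (∑ x, f x) / Fintype.card X := by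
  unfold expect
  rw [tsum_fintype, Finset.sum_div]
  refine Finset.sum_congr rfl fun x _ => ?_
  rw [PMF.uniformOfFintype_apply]
  simp [div_eq_inv_mul]

theorem expect_coin (q : ℝ) (h0 : 0 ≤ q) (h1 : q < 1) (f : Bool → ℝ) :
    expect (coin q h0 h1) f = q * f true + (1 - q) * f false := by
  unfold expect coin
  rw [tsum_fintype]
  simp [ENNReal.toReal_ofReal h0, ENNReal.toReal_ofReal (sub_nonneg.2 h1.le)]

end Expectation

/-! ### Bernstein bounds for empirical means -/

section Concentration

variable {X : Type*}

theorem lexpect_iid_prod (p : PMF X) (f : X → ENNReal) (N : ℕ) :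
    lexpect (iid p N) (fun τ => ∏ n, f (τ n)) = lexpect p f ^ N := by
  induction N with
  | zero => simp [iid, lexpect_pure]
  | succ N ih =>
    rw [iid, lexpect_bind]
    simp_rw [lexpect_map, Fin.prod_univ_succ, Fin.cons_zero, Fin.cons_succ, lexpect_const_mul, ih]
    rw [lexpect_mul_const, pow_succ, mul_comm]

theorem exp_le_one_add_add_sq {x : ℝ} (hx : |x| ≤ 1) : Real.exp x ≤ 1 + x + x ^ 2 := by
  have h := (abs_le.1 (Real.abs_exp_sub_one_sub_id_le hx)).2
  linarith

/-- Integrate exp y ≤ 1 + y + y², valid since |t f| ≤ 1, and return to the exponential by 1 + y ≤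
exp y. The second moment need not be centred. -/
theorem lexpect_exp_le (p : PMF X) (f : X → ℝ) (R t v : ℝ) (hf : ∀ x, |f x| ≤ R)
    (ht : |t| * R ≤ 1) (hv : expect p (fun x => f x ^ 2) ≤ v) :
    lexpect p (fun x => ENNReal.ofReal (Real.exp (t * f x))) ≤
      ENNReal.ofReal (Real.exp (t * expect p f + t ^ 2 * v)) := by
  have htf : ∀ x, |t * f x| ≤ 1 := fun x => by
    rw [abs_mul]
    exact (mul_le_mul_of_nonneg_left (hf x) (abs_nonneg t)).trans ht
  have hsq : ∀ x, |t ^ 2 * f x ^ 2| ≤ 1 := fun x => by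
    rw [← mul_pow, abs_pow]
    exact pow_le_one₀ (abs_nonneg _) (htf x)
  have h1 : ∀ _ : X, |(1 : ℝ)| ≤ 1 := fun _ => by simp
  have h2 : ∀ x, |1 + t * f x| ≤ 2 := fun x => by
    have := abs_le.1 (htf x)
    exact abs_le.2 ⟨by linarith, by linarith⟩
  have h3 : ∀ x, |1 + t * f x + t ^ 2 * f x ^ 2| ≤ 3 := fun x => by
    have := abs_le.1 (hsq x)
    have := abs_le.1 (h2 x)
    exact abs_le.2 ⟨by linarith, by linarith⟩
  have hpt : ∀ x, Real.exp (t * f x) ≤ 1 + t * f x + t ^ 2 * f x ^ 2 := fun x => by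
    have := exp_le_one_add_add_sq (htf x)
    rwa [mul_pow] at this
  have h0 : ∀ x, 0 ≤ 1 + t * f x + t ^ 2 * f x ^ 2 := fun x =>
    (Real.exp_pos _).le.trans (hpt x)
  calc lexpect p (fun x => ENNReal.ofReal (Real.exp (t * f x)))
      ≤ lexpect p (fun x => ENNReal.ofReal (1 + t * f x + t ^ 2 * f x ^ 2)) :=
        lexpect_mono p fun x => ENNReal.ofReal_le_ofReal (hpt x)
    _ = ENNReal.ofReal (1 + t * expect p f + t ^ 2 * expect p (fun x => f x ^ 2)) := by
        rw [lexpect_ofReal p _ 3 h3 h0, expect_add p _ _ 2 1 h2 hsq,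
          expect_add p _ _ 1 1 h1 htf, expect_const, expect_const_mul, expect_const_mul]
    _ ≤ ENNReal.ofReal (Real.exp (t * expect p f + t ^ 2 * v)) := by
        refine ENNReal.ofReal_le_ofReal ?_
        have h5 := Real.add_one_le_exp (t * expect p f + t ^ 2 * v)
        have h6 := mul_le_mul_of_nonneg_left hv (sq_nonneg t)
        linarith

/-- Chernoff's method: Markov's inequality for the exponential of the sum, which factorizes by
independence. The parameter t is left free, to be optimized later. -/
theorem iid_upper_tail (p : PMF X) (f : X → ℝ) (R t v u : ℝ) (N : ℕ) (hf : ∀ x, |f x| ≤ R)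
    (ht0 : 0 ≤ t) (ht : t * R ≤ 1) (hv : expect p (fun x => f x ^ 2) ≤ v) :
    (iid p N).toOuterMeasure {τ | N * (expect p f + u) ≤ ∑ n, f (τ n)} ≤
      ENNReal.ofReal (Real.exp (N * (t ^ 2 * v - t * u))) := by
  set m := expect p f with hm
  calc (iid p N).toOuterMeasure {τ | N * (m + u) ≤ ∑ n, f (τ n)}
      ≤ lexpect (iid p N) (fun τ => (∏ n, ENNReal.ofReal (Real.exp (t * f (τ n)))) *
          ENNReal.ofReal (Real.exp (-(t * (N * (m + u)))))) := by
        refine toOuterMeasure_le_lexpect _ _ _ fun τ hτ => ?_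
        rw [← ENNReal.ofReal_prod_of_nonneg fun _ _ => (Real.exp_pos _).le, ← Real.exp_sum,
          ← ENNReal.ofReal_mul (Real.exp_pos _).le, ← Real.exp_add, ENNReal.one_le_ofReal,
          Real.one_le_exp_iff, ← Finset.mul_sum]
        have := mul_le_mul_of_nonneg_left hτ ht0
        linarith
    _ ≤ ENNReal.ofReal (Real.exp (t * m + t ^ 2 * v)) ^ N *
          ENNReal.ofReal (Real.exp (-(t * (N * (m + u))))) := by
        rw [lexpect_mul_const, lexpect_iid_prod p fun x => ENNReal.ofReal (Real.exp (t * f x))]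
        gcongr
        exact lexpect_exp_le p f R t v hf (by rwa [abs_of_nonneg ht0]) hv
    _ = ENNReal.ofReal (Real.exp (N * (t ^ 2 * v - t * u))) := by
        rw [← ENNReal.ofReal_pow (Real.exp_pos _).le, ← Real.exp_nat_mul,
          ← ENNReal.ofReal_mul (Real.exp_pos _).le, ← Real.exp_add]
        congr 2
        ring

/-- Bernstein's inequality for the empirical mean of bounded variables. -/
theorem iid_bernstein (p : PMF X) (f : X → ℝ) (R v l : ℝ) (N : ℕ) (hf : ∀ x, |f x| ≤ R)
    (hR : 0 < R) (hl : 0 < l) (hN : 0 < N) (hv : expect p (fun x => f x ^ 2) ≤ v) :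
    (iid p N).toOuterMeasure
      {τ | 4 * (v + R ^ 2 * l / N) * l / N < (1 / (N : ℝ) * ∑ n, f (τ n) - expect p f) ^ 2} ≤
      ENNReal.ofReal (2 * Real.exp (-l)) := by
  have hN' : (0 : ℝ) < N := Nat.cast_pos.2 hN
  have hv0 : 0 ≤ v := (expect_nonneg p _ fun x => sq_nonneg (f x)).trans hv
  -- The choice N t² w = l optimizes the Chernoff exponent with w in place of v. The extra term R² l
  -- / N in w is what guarantees t R ≤ 1.
  set w := v + R ^ 2 * l / N with hw
  have hwpos : 0 < w := by positivity
  set t := Real.sqrt (l / (N * w)) with ht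
  set u := 2 * Real.sqrt (w * l / N) with hu
  have ht0 : 0 ≤ t := Real.sqrt_nonneg _
  have ht2 : t ^ 2 = l / (N * w) := Real.sq_sqrt (by positivity)
  have htu : t * u = 2 * (l / N) := by
    rw [hu, ht, mul_left_comm, ← Real.sqrt_mul (by positivity)]
    rw [show l / (N * w) * (w * l / N) = (l / N) ^ 2 by field_simp,
      Real.sqrt_sq (by positivity)]
  have hu2 : u ^ 2 = 4 * w * l / N := by
    rw [hu, mul_pow, Real.sq_sqrt (by positivity)]
    ring
  have hu0 : 0 ≤ u := by positivity
  have htR : t * R ≤ 1 := by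
    have : (t * R) ^ 2 ≤ 1 := by
      rw [mul_pow, ht2, div_mul_eq_mul_div, div_le_one (by positivity), hw, mul_add,
        mul_div_cancel₀ _ hN'.ne']
      nlinarith [mul_nonneg hN'.le hv0]
    exact (sq_le_one_iff₀ (by positivity)).1 this
  have hexp : (N : ℝ) * (t ^ 2 * v - t * u) ≤ -l := by
    have h1 : t ^ 2 * v ≤ l / N := by
      rw [ht2, div_mul_eq_mul_div, div_le_div_iff₀ (by positivity) hN']
      have : v ≤ w := by rw [hw]; linarith [show 0 ≤ R ^ 2 * l / N by positivity]
      nlinarith [mul_le_mul_of_nonneg_left this (mul_pos hl hN').le]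
    have h2 : (N : ℝ) * (l / N) = l := mul_div_cancel₀ _ hN'.ne'
    rw [htu]
    nlinarith
  have hup := iid_upper_tail p f R t v u N hf ht0 htR hv
  have hlow := iid_upper_tail p (fun x => -f x) R t v u N (fun x => by rw [abs_neg]; exact hf x)
    ht0 htR (by simpa using hv)
  have hneg : expect p (fun x => -f x) = -expect p f := by
    have := expect_const_mul p f (-1)
    simpa using this
  rw [hneg] at hlow
  have hle := ENNReal.ofReal_le_ofReal (Real.exp_le_exp.2 hexp)
  calc _ ≤ (iid p N).toOuterMeasure ({τ | N * (expect p f + u) ≤ ∑ n, f (τ n)} ∪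
        {τ | N * (-expect p f + u) ≤ ∑ n, -f (τ n)}) := by
        refine (iid p N).toOuterMeasure.mono fun τ hτ => ?_
        simp only [Set.mem_ofPred_eq] at hτ
        rw [← hu2] at hτ
        rcases le_or_gt u (1 / (N : ℝ) * ∑ n, f (τ n) - expect p f) with h | h
        · left
          have := mul_le_mul_of_nonneg_left h hN'.le
          rw [mul_sub, ← mul_assoc (N : ℝ) (1 / N), mul_one_div_cancel hN'.ne'] at this
          simp only [Set.mem_ofPred_eq]
          linarith
        · right
          have h3 : 1 / (N : ℝ) * ∑ n, f (τ n) - expect p f ≤ -u := by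
            by_contra! h4
            nlinarith
          have := mul_le_mul_of_nonneg_left h3 hN'.le
          rw [mul_sub, ← mul_assoc (N : ℝ) (1 / N), mul_one_div_cancel hN'.ne'] at this
          simp only [Set.mem_ofPred_eq, Finset.sum_neg_distrib]
          linarith
    _ ≤ _ := (MeasureTheory.measure_union_le _ _).trans
      (add_le_add (hup.trans hle) (hlow.trans hle))
    _ = _ := by
        rw [← ENNReal.ofReal_add (Real.exp_pos _).le (Real.exp_pos _).le]
        congr 1
        ring

/-- Concentration of the empirical mean of random vectors in the Euclidean norm. -/
theorem iid_vector_concentration {ι : Type*} [Fintype ι] (p : PMF X) (Z : X → ι → ℝ)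
    (R l : ℝ) (N : ℕ) (hZ : ∀ x, ∑ i, Z x i ^ 2 ≤ R ^ 2) (hR : 0 < R) (hl : 0 < l) (hN : 0 < N)
    (hlN : Fintype.card ι * l ≤ N) :
    (iid p N).toOuterMeasure
      {τ | 8 * R ^ 2 * l / N <
        ∑ i, (1 / (N : ℝ) * ∑ n, Z (τ n) i - expect p (fun x => Z x i)) ^ 2} ≤
      ENNReal.ofReal (Fintype.card ι * (2 * Real.exp (-l))) := by
  have hN' : (0 : ℝ) < N := Nat.cast_pos.2 hN
  have hsq : ∀ i x, |Z x i ^ 2| ≤ R ^ 2 := fun i x => by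
    rw [abs_of_nonneg (sq_nonneg _)]
    exact (Finset.single_le_sum (f := fun i => Z x i ^ 2) (fun j _ => sq_nonneg _)
      (Finset.mem_univ i)).trans (hZ x)
  have hb : ∀ i x, |Z x i| ≤ R := fun i x => by
    have := hsq i x
    rw [abs_of_nonneg (sq_nonneg _)] at this
    exact abs_le_of_sq_le_sq this hR.le
  set v : ι → ℝ := fun i => expect p fun x => Z x i ^ 2 with hv
  -- The second moments of all coordinates together are at most R², so the main term has no
  -- dimension factor. The dimension multiplies only the term R² l / N, which `hlN` absorbs by
  -- raising 4 to 8.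
  have hvsum : ∑ i, v i ≤ R ^ 2 := by
    rw [hv, ← expect_sum p Finset.univ (fun i x => Z x i ^ 2) (R ^ 2) hsq]
    refine (abs_le.1 (abs_expect_le p _ (R ^ 2) fun x => ?_)).2
    rw [abs_of_nonneg (Finset.sum_nonneg fun i _ => sq_nonneg _)]
    exact hZ x
  calc _ ≤ (iid p N).toOuterMeasure (⋃ i, {τ | 4 * (v i + R ^ 2 * l / N) * l / N <
        (1 / (N : ℝ) * ∑ n, Z (τ n) i - expect p (fun x => Z x i)) ^ 2}) := by
        refine (iid p N).toOuterMeasure.mono fun τ hτ => ?_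
        simp only [Set.mem_ofPred_eq, Set.mem_iUnion] at hτ ⊢
        by_contra! hcon
        have h1 := Finset.sum_le_sum fun i (_ : i ∈ Finset.univ) => hcon i
        have h2 : ∑ i, 4 * (v i + R ^ 2 * l / N) * l / N =
            4 * (∑ i, v i + Fintype.card ι * (R ^ 2 * l / N)) * l / N := by
          rw [← Finset.sum_div, ← Finset.sum_mul, ← Finset.mul_sum, Finset.sum_add_distrib]
          simp
        have h3 : Fintype.card ι * (R ^ 2 * l / N) ≤ R ^ 2 := by
          rw [← mul_div_assoc, div_le_iff₀ hN']
          nlinarith [sq_nonneg R]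
        have h4 : 4 * (∑ i, v i + Fintype.card ι * (R ^ 2 * l / N)) * l / N ≤
            8 * R ^ 2 * l / N := by
          refine div_le_div_of_nonneg_right (mul_le_mul_of_nonneg_right ?_ hl.le) hN'.le
          linarith
        linarith
    _ ≤ ∑ i, (iid p N).toOuterMeasure {τ | 4 * (v i + R ^ 2 * l / N) * l / N <
        (1 / (N : ℝ) * ∑ n, Z (τ n) i - expect p (fun x => Z x i)) ^ 2} :=
        MeasureTheory.measure_iUnion_fintype_le _ _
    _ ≤ ∑ _i : ι, ENNReal.ofReal (2 * Real.exp (-l)) :=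
        Finset.sum_le_sum fun i _ => iid_bernstein p (fun x => Z x i) R (v i) l N (hb i) hR hl hN
          le_rfl
    _ = _ := by
        rw [Finset.sum_const, Finset.card_univ, nsmul_eq_mul,
          ENNReal.ofReal_mul (Nat.cast_nonneg _), ENNReal.ofReal_natCast]

end Concentration

/-! ### Elementary estimates on the simplex -/

section Simplex

variable {X : Type*} [Fintype X]

theorem simplex_nonneg (p : stdSimplex ℝ X) (x : X) : 0 ≤ p x := p.2.1 x

theorem simplex_sum (p : stdSimplex ℝ X) : ∑ x, p x = 1 := p.2.2

theorem simplex_le_one (p : stdSimplex ℝ X) (x : X) : p x ≤ 1 := by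
  rw [← simplex_sum p]
  exact Finset.single_le_sum (f := fun x => p x) (fun y _ => simplex_nonneg p y)
    (Finset.mem_univ x)

theorem abs_simplex_average_le (p : stdSimplex ℝ X) (f : X → ℝ) (c : ℝ) (hf : ∀ x, |f x| ≤ c) :
    |∑ x, p x * f x| ≤ c := by
  calc |∑ x, p x * f x| ≤ ∑ x, p x * c := by
        refine (Finset.abs_sum_le_sum_abs _ _).trans (Finset.sum_le_sum fun x _ => ?_)
        rw [abs_mul, abs_of_nonneg (simplex_nonneg p x)]
        exact mul_le_mul_of_nonneg_left (hf x) (simplex_nonneg p x)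
    _ = c := by rw [← Finset.sum_mul, simplex_sum, one_mul]

theorem simplex_sq_dist_le (p q : stdSimplex ℝ X) : ∑ x, (p x - q x) ^ 2 ≤ 2 := by
  calc ∑ x, (p x - q x) ^ 2 ≤ ∑ x, (p x + q x) := by
        refine Finset.sum_le_sum fun x _ => ?_
        have h1 := simplex_nonneg p x
        have h2 := simplex_nonneg q x
        have h3 := simplex_le_one p x
        have h4 := simplex_le_one q x
        nlinarith [mul_nonneg h1 h2, mul_nonneg h1 (sub_nonneg.2 h3),
          mul_nonneg h2 (sub_nonneg.2 h4)]
    _ = 2 := by rw [Finset.sum_add_distrib, simplex_sum, simplex_sum]; norm_num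

theorem abs_sum_mul_le_of_bounds (f g : X → ℝ) (c D : ℝ) (hf : ∀ x, |f x| ≤ c) (hc : 0 ≤ c)
    (hg : ∑ x, |g x| ≤ D) : |∑ x, f x * g x| ≤ c * D := by
  calc |∑ x, f x * g x| ≤ ∑ x, c * |g x| := by
        refine (Finset.abs_sum_le_sum_abs _ _).trans (Finset.sum_le_sum fun x _ => ?_)
        rw [abs_mul]
        exact mul_le_mul_of_nonneg_right (hf x) (abs_nonneg _)
    _ ≤ c * D := by
        rw [← Finset.mul_sum]
        exact mul_le_mul_of_nonneg_left hg hc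

end Simplex

/-- The difference of two policies as a state-action vector. -/
def policyDiff {S A : Type*} [Fintype A] (π' π : Policy S A) (s : S) (a : A) : ℝ :=
  π' s a - π s a

/-! ### Consequences of convexity and of the Lipschitz gradient -/

section Regularizer

variable {A : Type*} [Fintype A] {W : (A → ℝ) → ℝ} {G : (A → ℝ) → A → ℝ} {B0 B1 B2 : ℝ}

theorem IsRegularizer.apply_nonneg (hW : IsRegularizer W G B0 B1 B2) (p : stdSimplex ℝ A) :
    0 ≤ W p := hW.nonneg _ p.2

theorem IsRegularizer.apply_le (hW : IsRegularizer W G B0 B1 B2) (p : stdSimplex ℝ A) :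
    W p ≤ B0 := hW.le_bound _ p.2

theorem IsRegularizer.abs_grad_le (hW : IsRegularizer W G B0 B1 B2) (p : stdSimplex ℝ A) (a : A) :
    |G p a| ≤ B1 := hW.grad_bound _ p.2 a

theorem IsRegularizer.sum_grad_le (hW : IsRegularizer W G B0 B1 B2) (p q : stdSimplex ℝ A) :
    ∑ a, G p a * (q a - p a) ≤ W q - W p := by
  have h1 : W p + ∑ a, G p a * (q a - p a) + 1 / 2 * ∑ a, (q a - p a) ^ 2 ≤ W q :=
    hW.strong_convex _ p.2 _ q.2
  have h2 : 0 ≤ ∑ a, (q a - p a) ^ 2 := Finset.sum_nonneg fun _ _ => sq_nonneg _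
  linarith

/-- Convexity at the end point π' bounds the increment by the gradient there, and moving the
gradient back to π costs `B2 * D` against a displacement of size D. No integration along the segment
is needed; the price is the factor 1 instead of 1/2. -/
theorem regularizer_le {S : Type*} (hW : IsRegularizer W G B0 B1 B2) (π' π : Policy S A)
    (s : S) (D : ℝ) (hD : ∑ a, |policyDiff π' π s a| ≤ D) (hD0 : 0 ≤ D) (hB2 : 0 ≤ B2) :
    W (π' s) - W (π s) ≤ ∑ a, G (π s) a * policyDiff π' π s a + B2 * D ^ 2 := by
  have h1 := hW.sum_grad_le (π' s) (π s)
  have h3 := abs_sum_mul_le_of_bounds (fun a => G (π' s) a - G (π s) a) (policyDiff π' π s)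
    (B2 * D) D (fun a => (hW.grad_lipschitz _ (π' s).2 _ (π s).2 a).trans
      (mul_le_mul_of_nonneg_left hD hB2)) (mul_nonneg hB2 hD0) hD
  have h4 : ∑ a, (G (π' s) a - G (π s) a) * policyDiff π' π s a =
      -(∑ a, G (π' s) a * (π s a - π' s a)) - ∑ a, G (π s) a * policyDiff π' π s a := by
    rw [← Finset.sum_neg_distrib, ← Finset.sum_sub_distrib]
    refine Finset.sum_congr rfl fun a _ => ?_
    unfold policyDiff
    ring
  rw [h4] at h3
  have h5 := (abs_le.1 h3).2
  linarith

end Regularizer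

/-! ### Euclidean geometry of state-action vectors -/

section StateAction

variable {S A : Type*} [Fintype S] [Fintype A]

/-- Euclidean inner product of state-action vectors. -/
def dot (x y : S → A → ℝ) : ℝ := ∑ s, ∑ a, x s a * y s a

/-- Squared Euclidean norm of a state-action vector. -/
def normSq (x : S → A → ℝ) : ℝ := ∑ s, ∑ a, x s a ^ 2

theorem normSq_nonneg (x : S → A → ℝ) : 0 ≤ normSq x :=
  Finset.sum_nonneg fun _ _ => Finset.sum_nonneg fun _ _ => sq_nonneg _

theorem dot_self (x : S → A → ℝ) : dot x x = normSq x := by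
  simp [dot, normSq, sq]

theorem dot_sq_le (x y : S → A → ℝ) : dot x y ^ 2 ≤ normSq x * normSq y := by
  have := Finset.sum_mul_sq_le_sq_mul_sq (Finset.univ : Finset (S × A))
    (fun i => x i.1 i.2) fun i => y i.1 i.2
  simpa only [Fintype.sum_prod_type, dot, normSq] using this

theorem abs_dot_le (x y : S → A → ℝ) (a b : ℝ) (ha : 0 ≤ a) (hb : 0 ≤ b)
    (hx : normSq x ≤ a ^ 2) (hy : normSq y ≤ b ^ 2) : |dot x y| ≤ a * b := by
  refine abs_le_of_sq_le_sq ?_ (mul_nonneg ha hb)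
  rw [mul_pow]
  exact (dot_sq_le x y).trans (mul_le_mul hx hy (normSq_nonneg y) (sq_nonneg a))

theorem dot_sub_left (x y z : S → A → ℝ) : dot (x - y) z = dot x z - dot y z := by
  simp [dot, sub_mul, Finset.sum_sub_distrib]

theorem dot_add_right (x y z : S → A → ℝ) : dot x (y + z) = dot x y + dot x z := by
  simp [dot, mul_add, Finset.sum_add_distrib]

theorem normSq_add_le (x y : S → A → ℝ) : normSq (x + y) ≤ 2 * normSq x + 2 * normSq y := by
  unfold normSq
  simp_rw [Finset.mul_sum, ← Finset.sum_add_distrib]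
  refine Finset.sum_le_sum fun s _ => Finset.sum_le_sum fun a _ => ?_
  simp only [Pi.add_apply]
  nlinarith [sq_nonneg (x s a - y s a)]

theorem normSq_policyDiff_le (π' π : Policy S A) :
    normSq (policyDiff π' π) ≤ 2 * Fintype.card S := by
  calc normSq (policyDiff π' π) ≤ ∑ _s : S, (2 : ℝ) :=
        Finset.sum_le_sum fun s _ => simplex_sq_dist_le (π' s) (π s)
    _ = 2 * Fintype.card S := by simp [mul_comm]

/-- Cauchy–Schwarz in a single state. It links the Euclidean norm of the ascent steps with the
per-state ℓ¹ distances in which the Markov chain estimates are stated. -/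
theorem sum_abs_le_of_card_mul_normSq_le (x : S → A → ℝ) (D : ℝ) (hD : 0 ≤ D)
    (h : Fintype.card A * normSq x ≤ D ^ 2) (s : S) : ∑ a, |x s a| ≤ D := by
  refine abs_le_of_sq_le_sq ?_ hD |>.trans' (le_abs_self _)
  refine le_trans ?_ h
  calc (∑ a, |x s a|) ^ 2 ≤ Fintype.card A * ∑ a, |x s a| ^ 2 := by
        simpa using sq_sum_le_card_mul_sum_sq (s := Finset.univ) (f := fun a => |x s a|)
    _ ≤ Fintype.card A * normSq x := by
        refine mul_le_mul_of_nonneg_left ?_ (Nat.cast_nonneg _)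
        simp_rw [sq_abs]
        exact Finset.single_le_sum (f := fun s => ∑ a, x s a ^ 2)
          (fun _ _ => Finset.sum_nonneg fun _ _ => sq_nonneg _) (Finset.mem_univ s)

end StateAction

/-! ### Discounted sums along a Markov chain -/

section Discounted

variable {S : Type*} [Fintype S] {P : Matrix S S ℝ} {γ : ℝ}

theorem abs_mulVec_le (h0 : ∀ s s', 0 ≤ P s s') (h1 : ∀ s, ∑ s', P s s' = 1) (f : S → ℝ) (c : ℝ)
    (hf : ∀ s, |f s| ≤ c) (s : S) : |(P *ᵥ f) s| ≤ c :=
  abs_simplex_average_le ⟨P s, h0 s, h1 s⟩ f c hf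

/-- Maximum principle: at a state m where |V| is largest, the equation gives |V m| ≤ c + γ |V m|. -/
theorem abs_le_of_bellman {P : Matrix S S ℝ} (h0 : ∀ s s', 0 ≤ P s s')
    (h1 : ∀ s, ∑ s', P s s' = 1) (hγ0 : 0 ≤ γ) (hγ1 : γ < 1) (V f : S → ℝ) (c : ℝ)
    (hV : ∀ s, V s = f s + γ * ∑ s', P s s' * V s') (hf : ∀ s, |f s| ≤ c) (s : S) :
    |V s| ≤ c / (1 - γ) := by
  obtain ⟨m, -, hm⟩ := Finset.exists_max_image Finset.univ (fun s => |V s|) ⟨s, Finset.mem_univ s⟩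
  have h2 : |V m| ≤ c + γ * |V m| := by
    conv_lhs => rw [hV m]
    refine (abs_add_le _ _).trans (add_le_add (hf m) ?_)
    rw [abs_mul, abs_of_nonneg hγ0]
    exact mul_le_mul_of_nonneg_left
      (abs_mulVec_le h0 h1 V _ (fun s => hm s (Finset.mem_univ s)) m) hγ0
  refine (hm s (Finset.mem_univ s)).trans ?_
  rw [le_div_iff₀ (sub_pos.2 hγ1)]
  linarith

variable [DecidableEq S]

theorem abs_pow_mulVec_le (h0 : ∀ s s', 0 ≤ P s s') (h1 : ∀ s, ∑ s', P s s' = 1) (f : S → ℝ)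
    (c : ℝ) (hf : ∀ s, |f s| ≤ c) (n : ℕ) (s : S) : |(P ^ n *ᵥ f) s| ≤ c := by
  induction n generalizing s with
  | zero => simpa using hf s
  | succ n ih =>
    rw [pow_succ', ← Matrix.mulVec_mulVec]
    exact abs_mulVec_le h0 h1 _ c ih s

/-- The discounted sum of `f` along the Markov chain satisfies the Bellman equation. -/
theorem discounted_bellman (h0 : ∀ s s', 0 ≤ P s s') (h1 : ∀ s, ∑ s', P s s' = 1)
    (hγ0 : 0 ≤ γ) (hγ1 : γ < 1) (f : S → ℝ) (s : S) :
    ∑' n : ℕ, γ ^ n * ((P ^ n) *ᵥ f) s =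
      f s + γ * ∑ s', P s s' * ∑' n : ℕ, γ ^ n * ((P ^ n) *ᵥ f) s' := by
  have hsum : ∀ s, Summable fun n : ℕ => γ ^ n * ((P ^ n) *ᵥ f) s := fun s => by
    have hc : ∀ s, |f s| ≤ ∑ s, |f s| := fun s =>
      Finset.single_le_sum (f := fun s => |f s|) (fun _ _ => abs_nonneg _) (Finset.mem_univ s)
    refine Summable.of_norm_bounded
      ((summable_geometric_of_lt_one hγ0 hγ1).mul_right (∑ s, |f s|)) fun n => ?_
    rw [norm_mul, Real.norm_eq_abs, Real.norm_eq_abs, abs_of_nonneg (pow_nonneg hγ0 n)]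
    exact mul_le_mul_of_nonneg_left (abs_pow_mulVec_le h0 h1 f _ hc n s) (pow_nonneg hγ0 n)
  rw [(hsum s).tsum_eq_zero_add]
  congr 1
  · simp
  · simp_rw [← tsum_mul_left]
    rw [← Summable.tsum_finsetSum fun s' _ => (hsum s').mul_left _, ← tsum_mul_left]
    congr 1 with n
    rw [pow_succ', pow_succ', ← Matrix.mulVec_mulVec, Matrix.mulVec, dotProduct, Finset.mul_sum,
      Finset.mul_sum]
    refine Finset.sum_congr rfl fun s' _ => ?_
    ring

theorem vecMul_pow_nonneg (h0 : ∀ s s', 0 ≤ P s s') (ξ : S → ℝ) (hξ : ∀ s, 0 ≤ ξ s) (n : ℕ)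
    (s : S) : 0 ≤ (ξ ᵥ* P ^ n) s := by
  induction n generalizing s with
  | zero => simpa using hξ s
  | succ n ih =>
    rw [pow_succ, ← Matrix.vecMul_vecMul]
    exact Finset.sum_nonneg fun s' _ => mul_nonneg (ih s') (h0 s' s)

theorem sum_vecMul_pow (h1 : ∀ s, ∑ s', P s s' = 1) (ξ : S → ℝ) (n : ℕ) :
    ∑ s, (ξ ᵥ* P ^ n) s = ∑ s, ξ s := by
  induction n with
  | zero => simp
  | succ n ih =>
    rw [pow_succ, ← Matrix.vecMul_vecMul, ← ih]
    simp_rw [Matrix.vecMul, dotProduct]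
    rw [Finset.sum_comm]
    simp_rw [← Finset.mul_sum, h1, mul_one]
    rfl

theorem discounted_flow (h0 : ∀ s s', 0 ≤ P s s') (h1 : ∀ s, ∑ s', P s s' = 1)
    (hγ0 : 0 ≤ γ) (hγ1 : γ < 1) (ξ : S → ℝ) (hξ : ∀ s, 0 ≤ ξ s) (s : S) :
    ∑' n : ℕ, γ ^ n * (ξ ᵥ* P ^ n) s =
      ξ s + γ * ∑ s', (∑' n : ℕ, γ ^ n * (ξ ᵥ* P ^ n) s') * P s' s := by
  have hsum : ∀ s, Summable fun n : ℕ => γ ^ n * (ξ ᵥ* P ^ n) s := fun s => by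
    refine Summable.of_norm_bounded
      ((summable_geometric_of_lt_one hγ0 hγ1).mul_right (∑ s, ξ s)) fun n => ?_
    rw [norm_mul, Real.norm_eq_abs, Real.norm_eq_abs, abs_of_nonneg (pow_nonneg hγ0 n),
      abs_of_nonneg (vecMul_pow_nonneg h0 ξ hξ n s), ← sum_vecMul_pow h1 ξ n]
    exact mul_le_mul_of_nonneg_left (Finset.single_le_sum (f := fun s => (ξ ᵥ* P ^ n) s)
      (fun s _ => vecMul_pow_nonneg h0 ξ hξ n s) (Finset.mem_univ s)) (pow_nonneg hγ0 n)
  rw [(hsum s).tsum_eq_zero_add]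
  congr 1
  · simp
  · simp_rw [← tsum_mul_right]
    rw [← Summable.tsum_finsetSum fun s' _ => (hsum s').mul_right _, ← tsum_mul_left]
    congr 1 with n
    rw [pow_succ, pow_succ, ← Matrix.vecMul_vecMul, Matrix.vecMul, dotProduct, Finset.mul_sum,
      Finset.mul_sum]
    refine Finset.sum_congr rfl fun s' _ => ?_
    ring

end Discounted

/-! ### Transition matrices and bounds on rewards -/

section Values

variable {S A : Type*} [Fintype S] [Fintype A] {γ : ℝ} (M : MDP S A γ)

theorem transMat_nonneg (π : Policy S A) (s s' : S) : 0 ≤ transMat M π s s' :=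
  Finset.sum_nonneg fun a _ => mul_nonneg (simplex_nonneg _ a) (simplex_nonneg _ s')

theorem sum_transMat_mul (π : Policy S A) (f : S → ℝ) (s : S) :
    ∑ s', transMat M π s s' * f s' = ∑ a, π s a * ∑ s', M.P s a s' * f s' := by
  simp_rw [transMat, Matrix.of_apply, Finset.sum_mul, Finset.mul_sum]
  rw [Finset.sum_comm]
  simp_rw [mul_assoc]

theorem transMat_sum (π : Policy S A) (s : S) : ∑ s', transMat M π s s' = 1 := by
  have := sum_transMat_mul M π (fun _ => 1) s
  simpa [simplex_sum] using this

variable {M} {W : (A → ℝ) → ℝ} {G : (A → ℝ) → A → ℝ} {lam B0 B1 B2 : ℝ}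

theorem abs_reward_le (hW : IsRegularizer W G B0 B1 B2) (hlam : 0 ≤ lam) (π : Policy S A) (s : S)
    (a : A) : |M.r s a - lam * W (π s)| ≤ 1 + lam * B0 := by
  have h1 := M.r_nonneg s a
  have h2 := M.r_le_one s a
  have h3 := mul_nonneg hlam (hW.apply_nonneg (π s))
  have h4 := mul_le_mul_of_nonneg_left (hW.apply_le (π s)) hlam
  exact abs_le.2 ⟨by linarith, by linarith⟩

theorem abs_regReward_le (hW : IsRegularizer W G B0 B1 B2) (hlam : 0 ≤ lam) (π : Policy S A)
    (s : S) : |regReward M W lam π s| ≤ 1 + lam * B0 := by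
  have h : regReward M W lam π s = ∑ a, π s a * (M.r s a - lam * W (π s)) := by
    simp_rw [mul_sub, Finset.sum_sub_distrib, ← Finset.sum_mul, simplex_sum, one_mul]
    rfl
  rw [h]
  exact abs_simplex_average_le _ _ _ fun a => abs_reward_le hW hlam π s a

/-- A reward plus a discounted future value minus a regularizer gradient is bounded. -/
theorem abs_regAdvantage_aux (hW : IsRegularizer W G B0 B1 B2) (hlam : 0 ≤ lam) (hB0 : 0 ≤ B0)
    (hB1 : 0 ≤ B1) (hB2 : 0 ≤ B2) (π : Policy S A) (s : S) (a : A) (x : ℝ)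
    (hx : |x| ≤ (1 + lam * B0) / (1 - γ)) :
    |M.r s a + γ * x - lam * G (π s) a| ≤ (1 + lam * (B0 + B1 + B2)) / (1 - γ) := by
  have hγ0 := M.γ_nonneg
  have hg := sub_pos.2 M.γ_lt_one
  have h1 := abs_le.2 ⟨by linarith [M.r_nonneg s a], M.r_le_one s a⟩
  have h2 : |γ * x| ≤ γ * ((1 + lam * B0) / (1 - γ)) := by
    rw [abs_mul, abs_of_nonneg hγ0]
    exact mul_le_mul_of_nonneg_left hx hγ0
  have h3 : |lam * G (π s) a| ≤ lam * B1 := by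
    rw [abs_mul, abs_of_nonneg hlam]
    exact mul_le_mul_of_nonneg_left (hW.abs_grad_le (π s) a) hlam
  have h4 : |M.r s a + γ * x - lam * G (π s) a| ≤ 1 + γ * ((1 + lam * B0) / (1 - γ)) + lam * B1 :=
    (abs_sub _ _).trans (add_le_add ((abs_add_le _ _).trans (add_le_add h1 h2)) h3)
  refine h4.trans ?_
  rw [le_div_iff₀ hg]
  have h5 : γ * ((1 + lam * B0) / (1 - γ)) * (1 - γ) = γ * (1 + lam * B0) := by
    field_simp
  have h6 : 0 ≤ lam * B0 := mul_nonneg hlam hB0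
  have h7 : 0 ≤ lam * B1 := mul_nonneg hlam hB1
  have h8 : 0 ≤ lam * B2 := mul_nonneg hlam hB2
  nlinarith [mul_nonneg h6 hg.le, mul_nonneg h7 hγ0]

end Values

/-! ### Occupation measures, performance difference, smoothness and gradient domination -/

section PolicyGradient

variable {S A : Type*} [Fintype S] [DecidableEq S] [Fintype A] {γ : ℝ}
  (M : MDP S A γ) (W : (A → ℝ) → ℝ) (G : (A → ℝ) → A → ℝ) (lam : ℝ)

theorem value_bellman (π : Policy S A) (s : S) :
    value M W lam π s = regReward M W lam π s + γ * ∑ s', transMat M π s s' * value M W lam π s' :=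
  discounted_bellman (transMat_nonneg M π) (transMat_sum M π) M.γ_nonneg M.γ_lt_one _ s

theorem visit_nonneg (ξ : stdSimplex ℝ S) (π : Policy S A) (s : S) : 0 ≤ visit M ξ π s :=
  mul_nonneg (sub_nonneg.2 M.γ_lt_one.le) (tsum_nonneg fun n => mul_nonneg
    (pow_nonneg M.γ_nonneg n)
    (vecMul_pow_nonneg (transMat_nonneg M π) _ (simplex_nonneg ξ) n s))

theorem visit_flow (ξ : stdSimplex ℝ S) (π : Policy S A) (s : S) :
    visit M ξ π s = (1 - γ) * ξ s + γ * ∑ s', visit M ξ π s' * transMat M π s' s := by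
  unfold visit
  rw [discounted_flow (transMat_nonneg M π) (transMat_sum M π) M.γ_nonneg M.γ_lt_one _
    (simplex_nonneg ξ) s]
  simp_rw [mul_assoc (1 - γ), ← Finset.mul_sum]
  ring

theorem le_visit (ξ : stdSimplex ℝ S) (π : Policy S A) (s : S) :
    (1 - γ) * ξ s ≤ visit M ξ π s := by
  rw [visit_flow]
  have := mul_nonneg M.γ_nonneg (Finset.sum_nonneg fun s' (_ : s' ∈ Finset.univ) =>
    mul_nonneg (visit_nonneg M ξ π s') (transMat_nonneg M π s' s))
  linarith

/-- The occupation identity `d_{π,ξ} (f - γ P_π f) = (1 - γ) ξ f`. -/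
theorem sum_visit_mul (ξ : stdSimplex ℝ S) (π : Policy S A) (f : S → ℝ) :
    ∑ s, visit M ξ π s * (f s - γ * ∑ s', transMat M π s s' * f s') =
      (1 - γ) * ∑ s, ξ s * f s := by
  have h : ∑ s, visit M ξ π s * f s = (1 - γ) * ∑ s, ξ s * f s +
      γ * ∑ s, visit M ξ π s * ∑ s', transMat M π s s' * f s' := by
    calc ∑ s, visit M ξ π s * f s
        = ∑ s, ((1 - γ) * ξ s + γ * ∑ s', visit M ξ π s' * transMat M π s' s) * f s :=
          Finset.sum_congr rfl fun s _ => by rw [← visit_flow]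
      _ = (1 - γ) * ∑ s, ξ s * f s +
          γ * ∑ s, ∑ s', visit M ξ π s' * transMat M π s' s * f s := by
          simp_rw [add_mul, Finset.sum_add_distrib, Finset.mul_sum, Finset.sum_mul,
            mul_assoc]
      _ = _ := by
          rw [Finset.sum_comm]
          simp_rw [Finset.mul_sum, mul_assoc]
  have h' : ∑ s, visit M ξ π s * (f s - γ * ∑ s', transMat M π s s' * f s') =
      ∑ s, visit M ξ π s * f s - γ * ∑ s, visit M ξ π s * ∑ s', transMat M π s s' * f s' := by
    rw [Finset.mul_sum, ← Finset.sum_sub_distrib]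
    refine Finset.sum_congr rfl fun s _ => ?_
    ring
  rw [h', h]
  ring

theorem visit_sum (ξ : stdSimplex ℝ S) (π : Policy S A) : ∑ s, visit M ξ π s = 1 := by
  have h2 : ∀ s, ∑ s', transMat M π s s' * (1 : ℝ) = 1 := fun s => by
    simpa using transMat_sum M π s
  have h := sum_visit_mul M ξ π fun _ => 1
  simp only [h2] at h
  simp only [mul_one, ← Finset.sum_mul, simplex_sum] at h
  have h1 := M.γ_lt_one
  exact mul_right_cancel₀ (sub_pos.2 h1).ne' (by linarith)

theorem abs_sum_visit_mul_le (ξ : stdSimplex ℝ S) (π : Policy S A) (f : S → ℝ) (c : ℝ)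
    (hf : ∀ s, |f s| ≤ c) : |∑ s, visit M ξ π s * f s| ≤ c :=
  abs_simplex_average_le ⟨visit M ξ π, visit_nonneg M ξ π, visit_sum M ξ π⟩ f c hf

theorem visit_le_one (ξ : stdSimplex ℝ S) (π : Policy S A) (s : S) : visit M ξ π s ≤ 1 :=
  simplex_le_one ⟨visit M ξ π, visit_nonneg M ξ π, visit_sum M ξ π⟩ s

/-- The state-action value function. -/
def qValue (π : Policy S A) (s : S) (a : A) : ℝ :=
  M.r s a + γ * ∑ s', M.P s a s' * value M W lam π s'

/-- The state-action value function corrected by the gradient of the regularizer. -/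
def regAdvantage (π : Policy S A) (s : S) (a : A) : ℝ :=
  qValue M W lam π s a - lam * G (π s) a

/-- The policy gradient of the regularized objective. -/
def policyGrad (ξ : stdSimplex ℝ S) (π : Policy S A) (s : S) (a : A) : ℝ :=
  1 / (1 - γ) * (visit M ξ π s * regAdvantage M W G lam π s a)

theorem value_eq_qValue (π' π : Policy S A) (s : S) :
    regReward M W lam π' s + γ * ∑ s', transMat M π' s s' * value M W lam π s' =
      ∑ a, π' s a * qValue M W lam π s a - lam * W (π' s) := by
  rw [sum_transMat_mul]
  unfold regReward qValue
  simp_rw [mul_add, Finset.sum_add_distrib, mul_left_comm _ γ, ← Finset.mul_sum]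
  ring

/-- Apply `sum_visit_mul` for π' to the difference of the two value functions. The Bellman equation
of π' eliminates its own values, leaving the one-step gain of π' measured with the values of π. -/
theorem performance_difference (ξ : stdSimplex ℝ S) (π' π : Policy S A) :
    J M W ξ π' lam - J M W ξ π lam = 1 / (1 - γ) * ∑ s, visit M ξ π' s *
      (∑ a, qValue M W lam π s a * policyDiff π' π s a - lam * (W (π' s) - W (π s))) := by
  have hg : 1 - γ ≠ 0 := (sub_pos.2 M.γ_lt_one).ne'
  have h := sum_visit_mul M ξ π' fun s => value M W lam π' s - value M W lam π s
  have h2 : J M W ξ π' lam - J M W ξ π lam =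
      ∑ s, ξ s * (value M W lam π' s - value M W lam π s) := by
    simp [J, mul_sub]
  rw [h2, one_div, eq_inv_mul_iff_mul_eq₀ hg, ← h]
  refine Finset.sum_congr rfl fun s _ => congrArg _ ?_
  have h3 := value_bellman M W lam π' s
  have h4 := value_bellman M W lam π s
  rw [value_eq_qValue] at h4
  have h5 := value_eq_qValue M W lam π' π s
  simp_rw [mul_sub, Finset.sum_sub_distrib]
  have h6 : ∑ a, qValue M W lam π s a * policyDiff π' π s a =
      ∑ a, π' s a * qValue M W lam π s a - ∑ a, π s a * qValue M W lam π s a := by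
    rw [← Finset.sum_sub_distrib]
    refine Finset.sum_congr rfl fun a _ => ?_
    unfold policyDiff
    ring
  rw [h6]
  linarith

variable {M W G lam} {B0 B1 B2 : ℝ}

theorem abs_value_le (hW : IsRegularizer W G B0 B1 B2) (hlam : 0 ≤ lam) (π : Policy S A) (s : S) :
    |value M W lam π s| ≤ (1 + lam * B0) / (1 - γ) :=
  abs_le_of_bellman (transMat_nonneg M π) (transMat_sum M π) M.γ_nonneg M.γ_lt_one _ _ _
    (value_bellman M W lam π) (abs_regReward_le hW hlam π) s

theorem abs_regAdvantage_le (hW : IsRegularizer W G B0 B1 B2) (hlam : 0 ≤ lam) (hB0 : 0 ≤ B0)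
    (hB1 : 0 ≤ B1) (hB2 : 0 ≤ B2) (π : Policy S A) (s : S) (a : A) :
    |regAdvantage M W G lam π s a| ≤ (1 + lam * (B0 + B1 + B2)) / (1 - γ) :=
  abs_regAdvantage_aux hW hlam hB0 hB1 hB2 π s a _
    (abs_simplex_average_le _ _ _ fun s' => abs_value_le hW hlam π s')

/-- Subtract the two flow equations: the change of the occupation measure solves an ℓ¹ contractive
equation with factor γ, whose source is the change of the action probabilities, of mass at most γ D.
-/
theorem sum_abs_visit_sub_le (ξ : stdSimplex ℝ S) (π' π : Policy S A) (D : ℝ)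
    (hD : ∀ s, ∑ a, |policyDiff π' π s a| ≤ D) :
    ∑ s, |visit M ξ π' s - visit M ξ π s| ≤ D / (1 - γ) := by
  have hγ0 := M.γ_nonneg
  have hg := sub_pos.2 M.γ_lt_one
  have h1 : ∀ s, |visit M ξ π' s - visit M ξ π s| ≤
      γ * ∑ s', visit M ξ π' s' * (∑ a, |policyDiff π' π s' a| * M.P s' a s) +
      γ * ∑ s', |visit M ξ π' s' - visit M ξ π s'| * transMat M π s' s := fun s => by
    have h2 : visit M ξ π' s - visit M ξ π s =
        γ * ∑ s', visit M ξ π' s' * (∑ a, policyDiff π' π s' a * M.P s' a s) +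
        γ * ∑ s', (visit M ξ π' s' - visit M ξ π s') * transMat M π s' s := by
      rw [visit_flow M ξ π' s, visit_flow M ξ π s, add_sub_add_left_eq_sub, ← mul_sub, ← mul_add,
        ← Finset.sum_sub_distrib, ← Finset.sum_add_distrib]
      congr 1
      refine Finset.sum_congr rfl fun s' _ => ?_
      have h3 : ∑ a, policyDiff π' π s' a * M.P s' a s =
          transMat M π' s' s - transMat M π s' s := by
        simp [policyDiff, transMat, sub_mul]
      rw [h3]
      ring
    rw [h2]
    refine (abs_add_le _ _).trans (add_le_add ?_ ?_)
    · rw [abs_mul, abs_of_nonneg hγ0]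
      refine mul_le_mul_of_nonneg_left ?_ hγ0
      refine (Finset.abs_sum_le_sum_abs _ _).trans (Finset.sum_le_sum fun s' _ => ?_)
      rw [abs_mul, abs_of_nonneg (visit_nonneg M ξ π' s')]
      refine mul_le_mul_of_nonneg_left ?_ (visit_nonneg M ξ π' s')
      refine (Finset.abs_sum_le_sum_abs _ _).trans (Finset.sum_le_sum fun a _ => ?_)
      rw [abs_mul, abs_of_nonneg (simplex_nonneg _ s)]
    · rw [abs_mul, abs_of_nonneg hγ0]
      refine mul_le_mul_of_nonneg_left ?_ hγ0
      refine (Finset.abs_sum_le_sum_abs _ _).trans (Finset.sum_le_sum fun s' _ => ?_)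
      rw [abs_mul, abs_of_nonneg (transMat_nonneg M π s' s)]
  have h4 := Finset.sum_le_sum fun s (_ : s ∈ Finset.univ) => h1 s
  rw [Finset.sum_add_distrib, ← Finset.mul_sum, ← Finset.mul_sum, Finset.sum_comm,
    Finset.sum_comm (f := fun s s' => |visit M ξ π' s' - visit M ξ π s'| * transMat M π s' s)] at h4
  simp_rw [← Finset.mul_sum, transMat_sum, mul_one] at h4
  have h5 : ∀ s, ∑ s', ∑ a, |policyDiff π' π s a| * M.P s a s' = ∑ a, |policyDiff π' π s a| :=
    fun s => by
      rw [Finset.sum_comm]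
      simp_rw [← Finset.mul_sum, simplex_sum, mul_one]
  simp_rw [h5] at h4
  have h6 : ∑ s, visit M ξ π' s * ∑ a, |policyDiff π' π s a| ≤ D :=
    (le_abs_self _).trans (abs_sum_visit_mul_le M ξ π' _ D fun s => by
      rw [abs_of_nonneg (Finset.sum_nonneg fun _ _ => abs_nonneg _)]
      exact hD s)
  have h7 : γ * ∑ s, visit M ξ π' s * ∑ a, |policyDiff π' π s a| ≤ 1 * D :=
    mul_le_mul M.γ_lt_one.le h6 (Finset.sum_nonneg fun s _ => mul_nonneg (visit_nonneg M ξ π' s)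
      (Finset.sum_nonneg fun _ _ => abs_nonneg _)) zero_le_one
  rw [le_div_iff₀ hg]
  linarith

theorem dot_policyGrad (ξ : stdSimplex ℝ S) (π : Policy S A) (x : S → A → ℝ) :
    dot (policyGrad M W G lam ξ π) x =
      1 / (1 - γ) * ∑ s, visit M ξ π s * ∑ a, regAdvantage M W G lam π s a * x s a := by
  simp_rw [dot, policyGrad, Finset.mul_sum, mul_assoc]

/-- Quadratic lower bound for the objective: smoothness in the Euclidean norm. -/
theorem objective_smooth (hW : IsRegularizer W G B0 B1 B2) (hlam : 0 ≤ lam) (hB0 : 0 ≤ B0)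
    (hB1 : 0 ≤ B1) (hB2 : 0 ≤ B2) (ξ : stdSimplex ℝ S) (π' π : Policy S A) :
    J M W ξ π lam + dot (policyGrad M W G lam ξ π) (policyDiff π' π) -
      Fintype.card A * (1 + lam * (B0 + B1 + B2)) / (1 - γ) ^ 3 * normSq (policyDiff π' π) ≤
      J M W ξ π' lam := by
  have hγ0 := M.γ_nonneg
  have hg := sub_pos.2 M.γ_lt_one
  set c := 1 + lam * (B0 + B1 + B2) with hc
  set Δ := policyDiff π' π with hΔ
  set D := Real.sqrt (Fintype.card A * normSq Δ) with hDdef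
  have hD0 : 0 ≤ D := Real.sqrt_nonneg _
  have hD2 : D ^ 2 = Fintype.card A * normSq Δ :=
    Real.sq_sqrt (mul_nonneg (Nat.cast_nonneg _) (normSq_nonneg _))
  have hD : ∀ s, ∑ a, |Δ s a| ≤ D := sum_abs_le_of_card_mul_normSq_le Δ D hD0 hD2.ge
  -- a slightly sharper bound on the advantage, which leaves room for the curvature of `W`
  have hH : ∀ s, |∑ a, regAdvantage M W G lam π s a * Δ s a| ≤
      (1 + lam * (B0 + B1)) / (1 - γ) * D := fun s => by
    refine abs_sum_mul_le_of_bounds _ _ _ _ (fun a => ?_) ?_ (hD s)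
    · have h1 : |qValue M W lam π s a| ≤ 1 + γ * ((1 + lam * B0) / (1 - γ)) := by
        refine (abs_add_le _ _).trans (add_le_add
          (abs_le.2 ⟨by linarith [M.r_nonneg s a], M.r_le_one s a⟩) ?_)
        rw [abs_mul, abs_of_nonneg hγ0]
        exact mul_le_mul_of_nonneg_left
          (abs_simplex_average_le _ _ _ fun s' => abs_value_le hW hlam π s') hγ0
      have h3 : |lam * G (π s) a| ≤ lam * B1 := by
        rw [abs_mul, abs_of_nonneg hlam]
        exact mul_le_mul_of_nonneg_left (hW.abs_grad_le (π s) a) hlam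
      refine (abs_sub _ _).trans ((add_le_add h1 h3).trans ?_)
      rw [le_div_iff₀ hg]
      have h5 : γ * ((1 + lam * B0) / (1 - γ)) * (1 - γ) = γ * (1 + lam * B0) := by
        field_simp
      nlinarith [mul_nonneg (mul_nonneg hlam hB0) hg.le, mul_nonneg (mul_nonneg hlam hB1) hγ0]
    · positivity
  have hd := sum_abs_visit_sub_le (M := M) ξ π' π D hD
  -- Replacing the occupation measure of π' by that of π costs a product of two factors, each linear
  -- in D, so the error is quadratic.
  have hcross := abs_sum_mul_le_of_bounds
    (fun s => ∑ a, regAdvantage M W G lam π s a * Δ s a)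
    (fun s => visit M ξ π' s - visit M ξ π s) _ _ hH (by positivity) hd
  have hpd := performance_difference M W lam ξ π' π
  have hlow : ∑ s, visit M ξ π' s * (∑ a, regAdvantage M W G lam π s a * Δ s a - lam * (B2 * D ^ 2))
      ≤ ∑ s, visit M ξ π' s *
        (∑ a, qValue M W lam π s a * Δ s a - lam * (W (π' s) - W (π s))) := by
    refine Finset.sum_le_sum fun s _ => mul_le_mul_of_nonneg_left ?_ (visit_nonneg M ξ π' s)
    have h1 := mul_le_mul_of_nonneg_left (regularizer_le hW π' π s D (hD s) hD0 hB2) hlam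
    have h2 : ∑ a, regAdvantage M W G lam π s a * Δ s a =
        ∑ a, qValue M W lam π s a * Δ s a - lam * ∑ a, G (π s) a * Δ s a := by
      simp_rw [regAdvantage, sub_mul, Finset.sum_sub_distrib, Finset.mul_sum, mul_assoc]
    rw [h2]
    linarith
  have hsplit : ∑ s, visit M ξ π' s *
      (∑ a, regAdvantage M W G lam π s a * Δ s a - lam * (B2 * D ^ 2)) =
      ∑ s, visit M ξ π s * ∑ a, regAdvantage M W G lam π s a * Δ s a +
      ∑ s, (∑ a, regAdvantage M W G lam π s a * Δ s a) * (visit M ξ π' s - visit M ξ π s) -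
      lam * (B2 * D ^ 2) := by
    simp_rw [mul_sub, Finset.sum_sub_distrib, ← Finset.sum_mul, visit_sum, one_mul,
      mul_comm (∑ a, regAdvantage M W G lam π _ a * Δ _ a)]
    ring
  have hmain : 1 / (1 - γ) * (∑ s, visit M ξ π s * ∑ a, regAdvantage M W G lam π s a * Δ s a -
      (1 + lam * (B0 + B1)) / (1 - γ) * D * (D / (1 - γ)) - lam * (B2 * D ^ 2)) ≤
      J M W ξ π' lam - J M W ξ π lam := by
    rw [hpd]
    refine mul_le_mul_of_nonneg_left ?_ (by positivity)
    have := (abs_le.1 hcross).1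
    linarith
  have hquad : 1 / (1 - γ) * ((1 + lam * (B0 + B1)) / (1 - γ) * D * (D / (1 - γ)) +
      lam * (B2 * D ^ 2)) ≤ Fintype.card A * c / (1 - γ) ^ 3 * normSq Δ := by
    have h1 : 1 / (1 - γ) * ((1 + lam * (B0 + B1)) / (1 - γ) * D * (D / (1 - γ)) +
      lam * (B2 * D ^ 2)) =
        (1 + lam * (B0 + B1) + lam * B2 * (1 - γ) ^ 2) * D ^ 2 / (1 - γ) ^ 3 := by
      field_simp
    have h2 : Fintype.card A * c / (1 - γ) ^ 3 * normSq Δ = c * D ^ 2 / (1 - γ) ^ 3 := by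
      rw [hD2]
      ring
    rw [h1, h2]
    have h3 : (1 - γ) ^ 2 ≤ 1 := pow_le_one₀ hg.le (by linarith)
    have h4 := mul_le_mul_of_nonneg_left h3 (mul_nonneg hlam hB2)
    refine div_le_div_of_nonneg_right (mul_le_mul_of_nonneg_right ?_ (sq_nonneg D)) (by positivity)
    rw [hc]
    linarith
  rw [dot_policyGrad]
  linarith

/-- The policy gradient is bounded along feasible directions. -/
theorem abs_dot_policyGrad_le (hW : IsRegularizer W G B0 B1 B2) (hlam : 0 ≤ lam) (hB0 : 0 ≤ B0)
    (hB1 : 0 ≤ B1) (hB2 : 0 ≤ B2) (ξ : stdSimplex ℝ S) (π : Policy S A) (x : S → A → ℝ) (D : ℝ)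
    (hD : ∀ s, ∑ a, |x s a| ≤ D) :
    |dot (policyGrad M W G lam ξ π) x| ≤ (1 + lam * (B0 + B1 + B2)) / (1 - γ) ^ 2 * D := by
  have hg := sub_pos.2 M.γ_lt_one
  rw [dot_policyGrad, abs_mul, abs_of_nonneg (by positivity)]
  have h := abs_sum_visit_mul_le M ξ π
    (fun s => ∑ a, regAdvantage M W G lam π s a * x s a) _ fun s =>
      abs_sum_mul_le_of_bounds _ _ _ _ (abs_regAdvantage_le hW hlam hB0 hB1 hB2 π s)
        (by positivity) (hD s)
  refine (mul_le_mul_of_nonneg_left h (by positivity)).trans_eq ?_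
  field_simp

/-- Gradient domination: the optimality gap is controlled by the best linear improvement. -/
theorem gap_le_dot_policyGrad [Nonempty A] (hW : IsRegularizer W G B0 B1 B2) (hlam : 0 ≤ lam)
    (ν : stdSimplex ℝ S) (hν : ∀ s, 0 < ν s) (πs π : Policy S A) (ρν : ℝ)
    (hρ : ∀ s, visit M ν πs s / visit M ν π s ≤ ρν) :
    ∃ p : Policy S A, J M W ν πs lam - J M W ν π lam ≤
      ρν * dot (policyGrad M W G lam ν π) (policyDiff p π) := by
  classical
  have hg := sub_pos.2 M.γ_lt_one
  -- The comparison policy is greedy for the corrected advantage. Its improvement is nonnegative in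
  -- every state, which is what permits exchanging occupation measures at the price of `ρν`; for
  -- `πs` itself the sign may vary.
  choose b hb using fun s => Finite.exists_max (regAdvantage M W G lam π s)
  let p : Policy S A := fun s => ⟨Pi.single (b s) 1, single_mem_stdSimplex ℝ (b s)⟩
  have hp : ∀ s, ∑ a, regAdvantage M W G lam π s a * p s a = regAdvantage M W G lam π s (b s) :=
    fun s => by
      change ∑ a, regAdvantage M W G lam π s a * (Pi.single (b s) 1 : A → ℝ) a = _
      simp [Pi.single_apply]
  have hq : ∀ (q : Policy S A) (s : S),
      ∑ a, regAdvantage M W G lam π s a * q s a ≤ regAdvantage M W G lam π s (b s) := fun q s => by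
    calc ∑ a, regAdvantage M W G lam π s a * q s a
        ≤ ∑ a, regAdvantage M W G lam π s (b s) * q s a :=
          Finset.sum_le_sum fun a _ => mul_le_mul_of_nonneg_right (hb s a) (simplex_nonneg _ a)
      _ = _ := by rw [← Finset.mul_sum, simplex_sum, mul_one]
  have hsub : ∀ (q : Policy S A) (s : S), ∑ a, regAdvantage M W G lam π s a * policyDiff q π s a =
      ∑ a, regAdvantage M W G lam π s a * q s a - ∑ a, regAdvantage M W G lam π s a * π s a :=
    fun q s => by simp [policyDiff, mul_sub]
  refine ⟨p, ?_⟩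
  rw [performance_difference, dot_policyGrad, mul_left_comm, Finset.mul_sum _ _ ρν]
  refine mul_le_mul_of_nonneg_left (Finset.sum_le_sum fun s _ => ?_) (by positivity)
  have hd : 0 < visit M ν π s := (mul_pos hg (hν s)).trans_le (le_visit M ν π s)
  have hd' := (div_le_iff₀ hd).1 (hρ s)
  -- By convexity, linearizing the regularizer only overestimates the gain of `πs`.
  have hG : ∑ a, G (π s) a * policyDiff πs π s a ≤ W (πs s) - W (π s) :=
    hW.sum_grad_le (π s) (πs s)
  have hG' := mul_le_mul_of_nonneg_left hG hlam
  have h2 : ∑ a, regAdvantage M W G lam π s a * policyDiff πs π s a =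
      ∑ a, qValue M W lam π s a * policyDiff πs π s a -
        lam * ∑ a, G (π s) a * policyDiff πs π s a := by
    simp_rw [regAdvantage, sub_mul, Finset.sum_sub_distrib, Finset.mul_sum, mul_assoc]
  have h3 : ∑ a, regAdvantage M W G lam π s a * policyDiff πs π s a ≤
      ∑ a, regAdvantage M W G lam π s a * policyDiff p π s a := by
    rw [hsub, hsub, hp]
    linarith [hq πs s]
  have h4 : 0 ≤ ∑ a, regAdvantage M W G lam π s a * policyDiff p π s a := by
    rw [hsub, hp]
    linarith [hq π s]
  calc visit M ν πs s * (∑ a, qValue M W lam π s a * policyDiff πs π s a -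
        lam * (W (πs s) - W (π s)))
      ≤ visit M ν πs s * ∑ a, regAdvantage M W G lam π s a * policyDiff p π s a :=
        mul_le_mul_of_nonneg_left (by linarith) (visit_nonneg M ν πs s)
    _ ≤ ρν * visit M ν π s * ∑ a, regAdvantage M W G lam π s a * policyDiff p π s a :=
        mul_le_mul_of_nonneg_right hd' h4
    _ = _ := by ring

/-- Changing the regularization coefficient changes values by at most `|lam' - lam| B0 / (1-γ)`. -/
theorem value_sub_value (hW : IsRegularizer W G B0 B1 B2) (π : Policy S A) (lam' : ℝ)
    (h : lam' ≤ lam) (s : S) :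
    0 ≤ value M W lam' π s - value M W lam π s ∧
      value M W lam' π s - value M W lam π s ≤ (lam - lam') * B0 / (1 - γ) := by
  have hg := sub_pos.2 M.γ_lt_one
  -- For a point mass, the occupation identity turns the value difference at s into 1/(1-γ) times an
  -- average of (lam - lam') W.
  let ξ : stdSimplex ℝ S := ⟨Pi.single s 1, single_mem_stdSimplex ℝ s⟩
  have hid := sum_visit_mul M ξ π fun s => value M W lam' π s - value M W lam π s
  have hval : ∑ t, ξ t * (value M W lam' π t - value M W lam π t) =
      value M W lam' π s - value M W lam π s := by
    change ∑ t, (Pi.single s 1 : S → ℝ) t * _ = _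
    simp [Pi.single_apply]
  have hrew : ∀ t, (value M W lam' π t - value M W lam π t) -
      γ * ∑ s', transMat M π t s' * (value M W lam' π s' - value M W lam π s') =
      (lam - lam') * W (π t) := fun t => by
    have h1 := value_bellman M W lam' π t
    have h2 := value_bellman M W lam π t
    unfold regReward at h1 h2
    simp_rw [mul_sub, Finset.sum_sub_distrib]
    linarith
  simp_rw [hrew, hval] at hid
  have hW0 : ∀ t, 0 ≤ W (π t) := fun t => hW.apply_nonneg (π t)
  have hlow : 0 ≤ ∑ t, visit M ξ π t * ((lam - lam') * W (π t)) :=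
    Finset.sum_nonneg fun t _ => mul_nonneg (visit_nonneg M ξ π t)
      (mul_nonneg (sub_nonneg.2 h) (hW0 t))
  have hup := (le_abs_self _).trans (abs_sum_visit_mul_le M ξ π
    (fun t => (lam - lam') * W (π t)) ((lam - lam') * B0) fun t => by
      rw [abs_of_nonneg (mul_nonneg (sub_nonneg.2 h) (hW0 t))]
      exact mul_le_mul_of_nonneg_left (hW.apply_le (π t)) (sub_nonneg.2 h))
  rw [hid] at hlow hup
  refine ⟨nonneg_of_mul_nonneg_right hlow hg, ?_⟩
  rw [le_div_iff₀ hg]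
  linarith

end PolicyGradient

/-! ### Bias and accuracy of the sampled gradient -/

section Estimator

variable {S A : Type*} [Fintype S] [Fintype A] {γ : ℝ}
  {M : MDP S A γ} {W : (A → ℝ) → ℝ} {G : (A → ℝ) → A → ℝ} {lam B0 B1 B2 : ℝ}

theorem abs_pathReturn_le (hW : IsRegularizer W G B0 B1 B2) (hlam : 0 ≤ lam) (hB0 : 0 ≤ B0)
    (π : Policy S A) (l : List (S × A)) :
    |pathReturn M W lam π l| ≤ (1 + lam * B0) / (1 - γ) := by
  have hγ0 := M.γ_nonneg
  have hg := sub_pos.2 M.γ_lt_one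
  induction l with
  | nil =>
    simp only [pathReturn, abs_zero]
    positivity
  | cons x l ih =>
    obtain ⟨s, a⟩ := x
    rw [pathReturn]
    have h1 : |γ * pathReturn M W lam π l| ≤ γ * ((1 + lam * B0) / (1 - γ)) := by
      rw [abs_mul, abs_of_nonneg hγ0]
      exact mul_le_mul_of_nonneg_left ih hγ0
    refine (abs_add_le _ _).trans ((add_le_add (abs_reward_le hW hlam π s a) h1).trans_eq ?_)
    field_simp
    ring

theorem exists_abs_bound (f : S → ℝ) : ∃ c, ∀ s, |f s| ≤ c :=
  ⟨∑ s, |f s|, fun s => Finset.single_le_sum (f := fun s => |f s|) (fun _ _ => abs_nonneg _)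
    (Finset.mem_univ s)⟩

theorem expect_step (π : Policy S A) (s : S) (f : S → ℝ) :
    expect (step M π s) f = ∑ s', transMat M π s s' * f s' := by
  obtain ⟨c, hc⟩ := exists_abs_bound f
  rw [step, expect_bind _ _ _ c hc, sum_transMat_mul]
  simp_rw [expect_draw]

/-- Expected return of a trajectory of length `n`. -/
def truncValue (M : MDP S A γ) (W : (A → ℝ) → ℝ) (lam : ℝ) (π : Policy S A) (n : ℕ) (s : S) : ℝ :=
  expect (trajectory M π n s) (pathReturn M W lam π)

theorem truncValue_zero (π : Policy S A) (s : S) : truncValue M W lam π 0 s = 0 := by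
  simp [truncValue, trajectory, expect_pure, pathReturn]

theorem truncValue_succ (hW : IsRegularizer W G B0 B1 B2) (hlam : 0 ≤ lam) (hB0 : 0 ≤ B0)
    (π : Policy S A) (n : ℕ) (s : S) :
    truncValue M W lam π (n + 1) s =
      regReward M W lam π s + γ * ∑ s', transMat M π s s' * truncValue M W lam π n s' := by
  have hb := abs_pathReturn_le (M := M) hW hlam hB0 π
  rw [truncValue, trajectory, expect_bind _ _ _ _ hb, expect_draw, sum_transMat_mul]
  have h : ∀ a, expect ((draw (M.P s a)).bind fun s' =>
      (trajectory M π n s').map fun l => (s, a) :: l) (pathReturn M W lam π) =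
      M.r s a - lam * W (π s) + γ * ∑ s', M.P s a s' * truncValue M W lam π n s' := fun a => by
    rw [expect_bind _ _ _ _ hb, expect_draw]
    have h1 : ∀ s', expect ((trajectory M π n s').map fun l => (s, a) :: l)
        (pathReturn M W lam π) =
        M.r s a - lam * W (π s) + γ * truncValue M W lam π n s' := fun s' => by
      rw [expect_map _ _ _ _ hb]
      simp_rw [pathReturn]
      rw [expect_add _ _ _ _ (|γ| * ((1 + lam * B0) / (1 - γ))) (fun _ => le_rfl)
        (fun l => by rw [abs_mul]; exact mul_le_mul_of_nonneg_left (hb l) (abs_nonneg _)),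
        expect_const, expect_const_mul, truncValue]
    simp_rw [h1, mul_add, Finset.sum_add_distrib, ← Finset.sum_mul, simplex_sum, one_mul,
      mul_left_comm _ γ, ← Finset.mul_sum]
  simp_rw [h, mul_add, mul_sub, Finset.sum_add_distrib, Finset.sum_sub_distrib, ← Finset.sum_mul,
    simplex_sum, one_mul, mul_left_comm _ γ, ← Finset.mul_sum]
  rfl

/-- Law of the accepted state, integrated against a function. -/
def acceptMean (M : MDP S A γ) (π : Policy S A) (f : S → ℝ) (n : ℕ) (s : S) : ℝ :=
  expect (acceptFrom M π n s) f

theorem acceptMean_zero (π : Policy S A) (f : S → ℝ) (s : S) : acceptMean M π f 0 s = f s := by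
  simp [acceptMean, acceptFrom, expect_pure]

theorem acceptMean_succ (π : Policy S A) (f : S → ℝ) (n : ℕ) (s : S) :
    acceptMean M π f (n + 1) s =
      (1 - γ) * f s + γ * ∑ s', transMat M π s s' * acceptMean M π f n s' := by
  obtain ⟨c, hc⟩ := exists_abs_bound f
  rw [acceptMean, acceptFrom, expect_bind _ _ _ c hc, expect_coin]
  simp only [if_true, Bool.false_eq_true, if_false]
  rw [expect_bind _ _ _ c hc, expect_pure, expect_step]
  unfold acceptMean
  ring

theorem expect_gradTrajectory [Nonempty A] (ν : stdSimplex ℝ S) (π : Policy S A) (K : ℕ)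
    (f : (S × A) × List (S × A) → ℝ) (c : ℝ) (hf : ∀ τ, |f τ| ≤ c) :
    expect (gradTrajectory M ν π K) f = ∑ s, ν s * expect (acceptFrom M π K s) fun s₀ =>
      (∑ a, ∑ s₁, M.P s₀ a s₁ * expect (trajectory M π (K - 1) s₁) fun l => f ((s₀, a), l)) /
        Fintype.card A := by
  rw [gradTrajectory, expect_bind _ _ _ c hf, expect_draw]
  refine Finset.sum_congr rfl fun s _ => ?_
  rw [expect_bind _ _ _ c hf]
  congr 2 with s₀
  rw [expect_bind _ _ _ c hf, expect_uniform]
  congr 1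
  refine Finset.sum_congr rfl fun a _ => ?_
  rw [expect_bind _ _ _ c hf, expect_draw]
  refine Finset.sum_congr rfl fun s₁ _ => ?_
  rw [expect_map _ _ _ c hf]

theorem abs_gradOfTrajectory_le (hW : IsRegularizer W G B0 B1 B2) (hlam : 0 ≤ lam) (hB0 : 0 ≤ B0)
    (hB1 : 0 ≤ B1) (hB2 : 0 ≤ B2) (π : Policy S A) (τ : (S × A) × List (S × A)) (s : S) (a : A) :
    |gradOfTrajectory M W G lam π τ s a| ≤
      Fintype.card A * (1 + lam * (B0 + B1 + B2)) / (1 - γ) ^ 2 := by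
  have hg := sub_pos.2 M.γ_lt_one
  unfold gradOfTrajectory
  split_ifs
  · rw [abs_mul, abs_of_nonneg (by positivity)]
    refine (mul_le_mul_of_nonneg_left (abs_regAdvantage_aux hW hlam hB0 hB1 hB2 π s a _
      (abs_pathReturn_le hW hlam hB0 π τ.2)) (by positivity)).trans_eq ?_
    field_simp
  · rw [abs_zero]
    positivity

theorem sum_gradOfTrajectory_sq_le (hW : IsRegularizer W G B0 B1 B2) (hlam : 0 ≤ lam)
    (hB0 : 0 ≤ B0) (hB1 : 0 ≤ B1) (hB2 : 0 ≤ B2) (π : Policy S A) (τ : (S × A) × List (S × A)) :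
    ∑ i : S × A, gradOfTrajectory M W G lam π τ i.1 i.2 ^ 2 ≤
      (Fintype.card A * (1 + lam * (B0 + B1 + B2)) / (1 - γ) ^ 2) ^ 2 := by
  rw [Finset.sum_eq_single τ.1]
  · have h := abs_gradOfTrajectory_le (M := M) hW hlam hB0 hB1 hB2 π τ τ.1.1 τ.1.2
    exact sq_le_sq.2 (h.trans (le_abs_self _))
  · intro i _ hi
    have : ¬(i.1 = τ.1.1 ∧ i.2 = τ.1.2) := fun h => hi (Prod.ext h.1 h.2)
    simp [gradOfTrajectory, this]
  · simp

variable [DecidableEq S]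

/-- The probability 1/|A| of the uniform action cancels the factor |A| of the estimator. What is
left is the law of the accepted state times a truncated action value, so the two truncations can be
compared with `policyGrad` separately. -/
theorem expect_gradOfTrajectory [Nonempty A] (hW : IsRegularizer W G B0 B1 B2) (hlam : 0 ≤ lam)
    (hB0 : 0 ≤ B0) (hB1 : 0 ≤ B1) (hB2 : 0 ≤ B2) (ν : stdSimplex ℝ S) (π : Policy S A) (K : ℕ)
    (s : S) (a : A) :
    expect (gradTrajectory M ν π K) (fun τ => gradOfTrajectory M W G lam π τ s a) =
      1 / (1 - γ) * ((∑ s', ν s' * acceptMean M π (Pi.single s 1) K s') *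
        (M.r s a + γ * ∑ s', M.P s a s' * truncValue M W lam π (K - 1) s' - lam * G (π s) a)) := by
  classical
  have hg := sub_pos.2 M.γ_lt_one
  have hA : (Fintype.card A : ℝ) ≠ 0 := Nat.cast_ne_zero.2 Fintype.card_ne_zero
  set Q := M.r s a + γ * ∑ s', M.P s a s' * truncValue M W lam π (K - 1) s' - lam * G (π s) a
    with hQ
  rw [expect_gradTrajectory ν π K _ _ fun τ => abs_gradOfTrajectory_le hW hlam hB0 hB1 hB2 π τ s a]
  have hinner : ∀ s₀, (∑ a', ∑ s₁, M.P s₀ a' s₁ * expect (trajectory M π (K - 1) s₁) fun l =>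
      gradOfTrajectory M W G lam π ((s₀, a'), l) s a) / (Fintype.card A : ℝ) =
      1 / (1 - γ) * Q * (Pi.single s 1 : S → ℝ) s₀ := fun s₀ => by
    by_cases hs : s₀ = s
    · subst hs
      rw [Finset.sum_eq_single a]
      · have h1 : ∀ s₁, expect (trajectory M π (K - 1) s₁) (fun l =>
            gradOfTrajectory M W G lam π ((s₀, a), l) s₀ a) =
            Fintype.card A / (1 - γ) *
              ((M.r s₀ a - lam * G (π s₀) a) + γ * truncValue M W lam π (K - 1) s₁) := fun s₁ => by
          simp only [gradOfTrajectory, and_self, if_true]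
          rw [expect_const_mul]
          congr 1
          simp_rw [add_sub_right_comm]
          rw [expect_add _ _ _ _ (|γ| * ((1 + lam * B0) / (1 - γ))) (fun _ => le_rfl)
            (fun l => by
              rw [abs_mul]
              exact mul_le_mul_of_nonneg_left (abs_pathReturn_le hW hlam hB0 π l) (abs_nonneg _)),
            expect_const, expect_const_mul, truncValue]
        have h2 : ∑ s₁, M.P s₀ a s₁ * (Fintype.card A / (1 - γ) *
              ((M.r s₀ a - lam * G (π s₀) a) + γ * truncValue M W lam π (K - 1) s₁)) =
            Fintype.card A / (1 - γ) * Q := by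
          rw [hQ]
          simp_rw [mul_left_comm _ (Fintype.card A / (1 - γ) : ℝ), ← Finset.mul_sum, mul_add,
            Finset.sum_add_distrib, ← Finset.sum_mul, simplex_sum, one_mul, mul_left_comm _ γ,
            ← Finset.mul_sum]
          ring
        simp_rw [h1]
        rw [h2, Pi.single_eq_same]
        field_simp
      · intro a' _ ha'
        refine Finset.sum_eq_zero fun s₁ _ => ?_
        have : ∀ l, gradOfTrajectory M W G lam π ((s₀, a'), l) s₀ a = 0 := fun l => by
          simp [gradOfTrajectory, ha'.symm]
        simp_rw [this]
        rw [expect_const, mul_zero]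
      · simp
    · have : ∀ a' l, gradOfTrajectory M W G lam π ((s₀, a'), l) s a = 0 := fun a' l => by
        simp [gradOfTrajectory, Ne.symm hs]
      simp_rw [this, expect_const]
      simp [hs]
  simp_rw [hinner, expect_const_mul]
  rw [Finset.sum_mul, Finset.mul_sum]
  refine Finset.sum_congr rfl fun s' _ => ?_
  rw [acceptMean]
  ring

/-- The truncated and the full value obey the same affine recursion, so each step contracts their
difference by γ, starting from the bound on the full value. -/
theorem abs_value_sub_truncValue_le (hW : IsRegularizer W G B0 B1 B2) (hlam : 0 ≤ lam)
    (hB0 : 0 ≤ B0) (π : Policy S A) (n : ℕ) (s : S) :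
    |truncValue M W lam π n s - value M W lam π s| ≤ γ ^ n * ((1 + lam * B0) / (1 - γ)) := by
  induction n generalizing s with
  | zero =>
    rw [truncValue_zero, zero_sub, abs_neg, pow_zero, one_mul]
    exact abs_value_le hW hlam π s
  | succ n ih =>
    rw [truncValue_succ hW hlam hB0, value_bellman, add_sub_add_left_eq_sub, ← mul_sub,
      ← Finset.sum_sub_distrib, abs_mul, abs_of_nonneg M.γ_nonneg, pow_succ', mul_assoc]
    refine mul_le_mul_of_nonneg_left ?_ M.γ_nonneg
    simp_rw [← mul_sub]
    exact abs_mulVec_le (transMat_nonneg M π) (transMat_sum M π) _ _ ih s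

/-- The normalized discounted sum F of f is the fixed point of the recursion of `acceptMean`, so the
distance to it contracts by γ; averaging F over ν gives the integral of f against `visit`. -/
theorem abs_acceptMean_sub_visit_le (ν : stdSimplex ℝ S) (π : Policy S A) (f : S → ℝ)
    (h0 : ∀ s, 0 ≤ f s) (h1 : ∀ s, f s ≤ 1) (n : ℕ) :
    |∑ s, ν s * acceptMean M π f n s - ∑ s, visit M ν π s * f s| ≤ γ ^ n := by
  have hγ0 := M.γ_nonneg
  have hg := sub_pos.2 M.γ_lt_one
  have hP0 := transMat_nonneg M π
  have hP1 := transMat_sum M π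
  set F : S → ℝ := fun s => (1 - γ) * ∑' n : ℕ, γ ^ n * ((transMat M π ^ n) *ᵥ f) s with hF
  have hFb : ∀ s, F s = (1 - γ) * f s + γ * ∑ s', transMat M π s s' * F s' := fun s => by
    simp only [hF]
    rw [discounted_bellman hP0 hP1 hγ0 M.γ_lt_one f s]
    simp_rw [mul_left_comm _ (1 - γ), ← Finset.mul_sum]
    ring
  -- Centring at 1/2 makes the maximum principle yield 0 ≤ F ≤ 1, hence an initial error |f - F| of
  -- at most 1.
  have hhalf : ∀ s, |F s - 1 / 2| ≤ ((1 - γ) / 2) / (1 - γ) := fun s => by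
    refine abs_le_of_bellman hP0 hP1 hγ0 M.γ_lt_one (fun s => F s - 1 / 2)
      (fun s => (1 - γ) * (f s - 1 / 2)) _ (fun s => ?_) (fun s => ?_) s
    · simp_rw [mul_sub, Finset.sum_sub_distrib, ← Finset.sum_mul]
      have := hFb s
      have h2 : ∑ s', transMat M π s s' = 1 := hP1 s
      rw [h2]
      linarith
    · rw [abs_mul, abs_of_pos hg, mul_comm, div_eq_mul_inv, mul_comm]
      refine mul_le_mul_of_nonneg_left (abs_le.2 ⟨?_, ?_⟩) hg.le
      · linarith [h0 s]
      · linarith [h1 s]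
  have hdiff : ∀ n s, |acceptMean M π f n s - F s| ≤ γ ^ n := fun n => by
    induction n with
    | zero =>
      intro s
      have h2 := abs_le.1 (hhalf s)
      have h3 : ((1 - γ) / 2) / (1 - γ) = 1 / 2 := by field_simp
      rw [h3] at h2
      rw [acceptMean_zero, pow_zero]
      exact abs_le.2 ⟨by linarith [h0 s], by linarith [h1 s]⟩
    | succ n ih =>
      intro s
      rw [acceptMean_succ, hFb, add_sub_add_left_eq_sub, ← mul_sub, ← Finset.sum_sub_distrib,
        abs_mul, abs_of_nonneg hγ0, pow_succ']
      refine mul_le_mul_of_nonneg_left ?_ hγ0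
      simp_rw [← mul_sub]
      exact abs_mulVec_le hP0 hP1 _ _ ih s
  have hocc : ∑ s, visit M ν π s * f s = ∑ s, ν s * F s := by
    have h2 := sum_visit_mul M ν π F
    have h3 : ∀ s, F s - γ * ∑ s', transMat M π s s' * F s' = (1 - γ) * f s := fun s => by
      linarith [hFb s]
    simp_rw [h3, mul_left_comm _ (1 - γ), ← Finset.mul_sum] at h2
    exact mul_left_cancel₀ hg.ne' h2
  rw [hocc, ← Finset.sum_sub_distrib]
  simp_rw [← mul_sub]
  exact abs_simplex_average_le ν _ _ (hdiff n)

/-- Truncation bias of the gradient estimator. -/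
theorem abs_bias_le [Nonempty A] (hW : IsRegularizer W G B0 B1 B2) (hlam : 0 ≤ lam)
    (hB0 : 0 ≤ B0) (hB1 : 0 ≤ B1) (hB2 : 0 ≤ B2) (ν : stdSimplex ℝ S) (π : Policy S A) (K : ℕ)
    (hK : 0 < K) (s : S) (a : A) :
    |expect (gradTrajectory M ν π K) (fun τ => gradOfTrajectory M W G lam π τ s a) -
      policyGrad M W G lam ν π s a| ≤
      2 * γ ^ K * (1 + lam * (B0 + B1 + B2)) / (1 - γ) ^ 2 := by
  have hγ0 := M.γ_nonneg
  have hg := sub_pos.2 M.γ_lt_one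
  set c := 1 + lam * (B0 + B1 + B2) with hc
  have hc0 : 0 ≤ c := by positivity
  -- Only k = K - 1 pairs follow the first one, but the discount in front of their return restores
  -- the exponent K, the same as for the accepted state.
  obtain ⟨k, rfl⟩ := Nat.exists_eq_succ_of_ne_zero hK.ne'
  rw [expect_gradOfTrajectory hW hlam hB0 hB1 hB2, policyGrad, ← mul_sub, abs_mul,
    abs_of_nonneg (by positivity : 0 ≤ 1 / (1 - γ)), Nat.succ_eq_add_one, Nat.add_sub_cancel]
  set d := ∑ s', ν s' * acceptMean M π (Pi.single s 1) (k + 1) s' with hd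
  have hsingle0 : ∀ t, 0 ≤ (Pi.single s 1 : S → ℝ) t := fun t => by
    by_cases h : t = s
    · subst h; simp
    · simp [h]
  have hsingle1 : ∀ t, (Pi.single s 1 : S → ℝ) t ≤ 1 := fun t => by
    by_cases h : t = s
    · subst h; simp
    · simp [h]
  have hdv : |d - visit M ν π s| ≤ γ ^ (k + 1) := by
    have := abs_acceptMean_sub_visit_le (M := M) ν π (Pi.single s 1) hsingle0 hsingle1 (k + 1)
    simpa [Pi.single_apply] using this
  have hQ : |M.r s a + γ * ∑ s', M.P s a s' * truncValue M W lam π k s' - lam * G (π s) a -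
      regAdvantage M W G lam π s a| ≤ γ ^ (k + 1) * (c / (1 - γ)) := by
    have h1 : M.r s a + γ * ∑ s', M.P s a s' * truncValue M W lam π k s' - lam * G (π s) a -
        regAdvantage M W G lam π s a =
        γ * ∑ s', M.P s a s' * (truncValue M W lam π k s' - value M W lam π s') := by
      unfold regAdvantage qValue
      simp_rw [mul_sub, Finset.sum_sub_distrib]
      ring
    rw [h1, abs_mul, abs_of_nonneg hγ0, pow_succ', mul_assoc]
    refine mul_le_mul_of_nonneg_left ?_ hγ0
    refine (abs_simplex_average_le _ _ _ fun s' =>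
      abs_value_sub_truncValue_le hW hlam hB0 π k s').trans ?_
    have : 1 + lam * B0 ≤ c := by
      rw [hc]
      nlinarith [mul_nonneg hlam hB1, mul_nonneg hlam hB2]
    gcongr
  have hQt : |M.r s a + γ * ∑ s', M.P s a s' * truncValue M W lam π k s' - lam * G (π s) a| ≤
      c / (1 - γ) :=
    abs_regAdvantage_aux hW hlam hB0 hB1 hB2 π s a _ (abs_simplex_average_le _ _ _ fun s' =>
      abs_expect_le _ _ _ fun l => abs_pathReturn_le hW hlam hB0 π l)
  set Q := M.r s a + γ * ∑ s', M.P s a s' * truncValue M W lam π k s' - lam * G (π s) a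
  have hmain : |d * Q - visit M ν π s * regAdvantage M W G lam π s a| ≤
      2 * γ ^ (k + 1) * (c / (1 - γ)) := by
    have h1 : d * Q - visit M ν π s * regAdvantage M W G lam π s a =
      (d - visit M ν π s) * Q + visit M ν π s * (Q - regAdvantage M W G lam π s a) := by ring
    rw [h1]
    refine (abs_add_le _ _).trans ?_
    rw [abs_mul, abs_mul, abs_of_nonneg (visit_nonneg M ν π s)]
    have h2 := mul_le_mul hdv hQt (abs_nonneg _) (by positivity)
    have h3 := mul_le_mul (visit_le_one M ν π s) hQ (abs_nonneg _) zero_le_one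
    linarith
  refine (mul_le_mul_of_nonneg_left hmain (by positivity)).trans_eq ?_
  field_simp

/-- High-probability accuracy of the sampled policy gradient. -/
theorem gradEstimate_accuracy [Nonempty A] (hW : IsRegularizer W G B0 B1 B2) (hlam : 0 ≤ lam)
    (hB0 : 0 ≤ B0) (hB1 : 0 ≤ B1) (hB2 : 0 ≤ B2) (ν : stdSimplex ℝ S) (π : Policy S A) (N K : ℕ)
    (hN : 0 < N) (hK : 0 < K) (l : ℝ) (hl : 0 < l)
    (hlN : (Fintype.card S : ℝ) * Fintype.card A * l ≤ N) :
    (gradEstimate M W G ν lam N K π).toOuterMeasure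
      {g | 16 * (Fintype.card A * (1 + lam * (B0 + B1 + B2)) / (1 - γ) ^ 2) ^ 2 * l / N +
        2 * (Fintype.card S * Fintype.card A *
          (2 * γ ^ K * (1 + lam * (B0 + B1 + B2)) / (1 - γ) ^ 2) ^ 2) <
        normSq (g - policyGrad M W G lam ν π)} ≤
      ENNReal.ofReal (Fintype.card S * Fintype.card A * (2 * Real.exp (-l))) := by
  have hg := sub_pos.2 M.γ_lt_one
  have hA : (0 : ℝ) < Fintype.card A := Nat.cast_pos.2 Fintype.card_pos
  have hconc := iid_vector_concentration (gradTrajectory M ν π K)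
    (fun τ (i : S × A) => gradOfTrajectory M W G lam π τ i.1 i.2)
    (Fintype.card A * (1 + lam * (B0 + B1 + B2)) / (1 - γ) ^ 2) l N
    (sum_gradOfTrajectory_sq_le hW hlam hB0 hB1 hB2 π) (by positivity) hl hN
    (by rwa [Fintype.card_prod, Nat.cast_mul])
  rw [Fintype.card_prod, Nat.cast_mul] at hconc
  refine le_trans ?_ hconc
  rw [gradEstimate, PMF.toOuterMeasure_map_apply]
  refine (iid _ N).toOuterMeasure.mono fun τ hτ => ?_
  simp only [Set.mem_preimage, Set.mem_ofPred_eq] at hτ ⊢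
  by_contra! hcon
  set m : S → A → ℝ := fun s a =>
    expect (gradTrajectory M ν π K) fun τ => gradOfTrajectory M W G lam π τ s a with hm
  set g : S → A → ℝ := fun s a => 1 / (N : ℝ) * ∑ n, gradOfTrajectory M W G lam π (τ n) s a
    with hgdef
  have h1 : normSq (g - m) ≤
      8 * (Fintype.card A * (1 + lam * (B0 + B1 + B2)) / (1 - γ) ^ 2) ^ 2 * l / N := by
    rw [Fintype.sum_prod_type] at hcon
    exact hcon
  have h2 : normSq (m - policyGrad M W G lam ν π) ≤ Fintype.card S * Fintype.card A *
      (2 * γ ^ K * (1 + lam * (B0 + B1 + B2)) / (1 - γ) ^ 2) ^ 2 := by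
    calc normSq (m - policyGrad M W G lam ν π) ≤ ∑ _s : S, ∑ _a : A,
        (2 * γ ^ K * (1 + lam * (B0 + B1 + B2)) / (1 - γ) ^ 2) ^ 2 :=
          Finset.sum_le_sum fun s _ => Finset.sum_le_sum fun a _ =>
            sq_le_sq.2 ((abs_bias_le hW hlam hB0 hB1 hB2 ν π K hK s a).trans (le_abs_self _))
      _ = _ := by
          simp
          ring
  have h3 := normSq_add_le (g - m) (m - policyGrad M W G lam ν π)
  rw [sub_add_sub_cancel] at h3
  have h4 : 16 * (Fintype.card A * (1 + lam * (B0 + B1 + B2)) / (1 - γ) ^ 2) ^ 2 * l / N =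
    2 * (8 * (Fintype.card A * (1 + lam * (B0 + B1 + B2)) / (1 - γ) ^ 2) ^ 2 * l / N) := by ring
  linarith

end Estimator

/-! ### The variational inequality of the projected step -/

section ProximalStep

variable {S A : Type*} [Fintype S] [Fintype A]

theorem normSq_add (x y : S → A → ℝ) :
    normSq (x + y) = normSq x + 2 * dot x y + normSq y := by
  unfold normSq dot
  simp_rw [Finset.mul_sum, ← Finset.sum_add_distrib]
  refine Finset.sum_congr rfl fun s _ => Finset.sum_congr rfl fun a _ => ?_
  simp only [Pi.add_apply]
  ring

theorem normSq_smul (c : ℝ) (x : S → A → ℝ) : normSq (c • x) = c ^ 2 * normSq x := by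
  simp [normSq, mul_pow, Finset.mul_sum]

theorem dot_smul_right (c : ℝ) (x y : S → A → ℝ) : dot x (c • y) = c * dot x y := by
  simp [dot, Finset.mul_sum, mul_left_comm]

theorem dot_young (x y : S → A → ℝ) (L : ℝ) (hL : 0 < L) :
    dot x y ≤ L / 4 * normSq y + normSq x / L := by
  unfold dot normSq
  simp_rw [Finset.mul_sum, Finset.sum_div, ← Finset.sum_add_distrib]
  refine Finset.sum_le_sum fun s _ => Finset.sum_le_sum fun a _ => ?_
  have h : L / 4 * y s a ^ 2 + x s a ^ 2 / L - x s a * y s a =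
      (L * y s a / 2 - x s a) ^ 2 / L := by
    field_simp
    ring
  have : 0 ≤ (L * y s a / 2 - x s a) ^ 2 / L := by positivity
  linarith

theorem proxObjective_eq (η : ℝ) (π : Policy S A) (g : S → A → ℝ) (π' : Policy S A) :
    proxObjective η π g π' =
      -dot g (policyDiff π' π) + 1 / (2 * η) * normSq (policyDiff π' π) := rfl

variable [Nonempty A]

/-- First-order optimality of the projected gradient step. -/
theorem pgaStep_variational (L : ℝ) (hL : 0 < L) (π : Policy S A) (g : S → A → ℝ)
    (p : Policy S A) :
    dot g (policyDiff p (pgaStep (1 / L) π g)) ≤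
      L * dot (policyDiff (pgaStep (1 / L) π g) π) (policyDiff p (pgaStep (1 / L) π g)) := by
  set π' := pgaStep (1 / L) π g with hπ'
  set Δ := policyDiff π' π with hΔ
  set D := policyDiff p π' with hD
  have hmin : ∀ y, proxObjective (1 / L) π g π' ≤ proxObjective (1 / L) π g y :=
    Classical.choose_spec (exists_prox_min (1 / L) π g)
  have hkey : ∀ θ : ℝ, 0 < θ → θ ≤ 1 → dot g D - L * dot Δ D ≤ θ * (L / 2 * normSq D) := by
    intro θ h0 h1
    -- The minimizer is compared with points on the segment towards p: the first-order term in θ is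
    -- the claim, and the rest is quadratic.
    let q : Policy S A := fun s => ⟨(1 - θ) • (π' s : A → ℝ) + θ • (p s : A → ℝ),
      convex_stdSimplex ℝ A (π' s).2 (p s).2 (by linarith) h0.le (by ring)⟩
    have hq : policyDiff q π = Δ + θ • D := by
      funext s a
      change ((1 - θ) * π' s a + θ * p s a) - π s a = (π' s a - π s a) + θ * (p s a - π' s a)
      ring
    have h := hmin q
    rw [proxObjective_eq, proxObjective_eq, hq, dot_add_right, normSq_add, normSq_smul,
      dot_smul_right, dot_smul_right] at h
    have h2 : 1 / (2 * (1 / L)) = L / 2 := by field_simp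
    rw [h2] at h
    have h3 : θ * (dot g D - L * dot Δ D) ≤ θ * (θ * (L / 2 * normSq D)) := by linarith
    exact le_of_mul_le_mul_left h3 h0
  by_contra! hcon
  set X := dot g D - L * dot Δ D with hX
  set C := L / 2 * normSq D with hC
  have hXpos : 0 < X := by linarith
  have h1 := hkey 1 one_pos le_rfl
  have hCpos : 0 < C := by linarith
  -- The case θ = 1 gave X ≤ C, so this θ is admissible; it would force X ≤ X/2.
  have h2 := hkey (X / (2 * C)) (by positivity) ((div_le_one (by positivity)).2 (by linarith))
  have h3 : X / (2 * C) * C = X / 2 := by field_simp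
  linarith

end ProximalStep

/-! ### Analysis of one epoch of projected gradient ascent -/

section Epoch

theorem smoothConst_eq {A : Type*} [Fintype A] (γ lam Ct : ℝ) :
    smoothConst A γ Ct lam = 4 * (Fintype.card A * (1 + lam * Ct) / (1 - γ) ^ 3) := by
  unfold smoothConst
  ring

variable {S A : Type*} [Fintype S] [DecidableEq S] [Fintype A] [Nonempty A] {γ : ℝ}
  {M : MDP S A γ} {W : (A → ℝ) → ℝ} {G : (A → ℝ) → A → ℝ} {lam B0 B1 B2 : ℝ}

/-- `π'` is obtained from `π` by a projected step along a gradient estimate of squared error at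
most `E2`. -/
def IsAccurateStep (M : MDP S A γ) (W : (A → ℝ) → ℝ) (G : (A → ℝ) → A → ℝ) (ν : stdSimplex ℝ S)
    (lam η E2 : ℝ) (π π' : Policy S A) : Prop :=
  ∃ g, normSq (g - policyGrad M W G lam ν π) ≤ E2 ∧ π' = pgaStep η π g

theorem smoothConst_pos (hγ : γ < 1) {Ct : ℝ} (hC : 0 ≤ Ct) (hlam : 0 ≤ lam) :
    0 < smoothConst A γ Ct lam := by
  have hg := sub_pos.2 hγ
  have hA : (0 : ℝ) < Fintype.card A := Nat.cast_pos.2 Fintype.card_pos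
  rw [smoothConst_eq]
  positivity

/-- Progress of one accurate step. -/
theorem IsAccurateStep.progress (hW : IsRegularizer W G B0 B1 B2) (hlam : 0 ≤ lam) (hB0 : 0 ≤ B0)
    (hB1 : 0 ≤ B1) (hB2 : 0 ≤ B2) {ν : stdSimplex ℝ S} {L E2 : ℝ} {π π' : Policy S A}
    (hL : L = smoothConst A γ (B0 + B1 + B2) lam)
    (h : IsAccurateStep M W G ν lam (1 / L) E2 π π') :
    J M W ν π lam + L / 2 * normSq (policyDiff π' π) - E2 / L ≤ J M W ν π' lam := by
  obtain ⟨g, he, rfl⟩ := h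
  have hLpos : 0 < L := hL ▸ smoothConst_pos M.γ_lt_one (by positivity) hlam
  set π' := pgaStep (1 / L) π g
  set e := g - policyGrad M W G lam ν π with hedef
  have hs := objective_smooth (M := M) hW hlam hB0 hB1 hB2 ν π' π
  rw [smoothConst_eq] at hL
  have hv := pgaStep_variational L hLpos π g π
  have hneg : policyDiff π π' = (-1 : ℝ) • policyDiff π' π := by
    funext s a
    simp [policyDiff]
  change dot g (policyDiff π π') ≤ L * dot (policyDiff π' π) (policyDiff π π') at hv
  rw [hneg, dot_smul_right, dot_smul_right, dot_self] at hv
  have hy := dot_young e (policyDiff π' π) L hLpos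
  have h1 : dot e (policyDiff π' π) =
      dot g (policyDiff π' π) - dot (policyGrad M W G lam ν π) (policyDiff π' π) :=
    dot_sub_left _ _ _
  have h2 := div_le_div_of_nonneg_right he hLpos.le
  -- The variational inequality supplies a gain L‖Δ‖²; curvature takes L/4 of it and the gradient
  -- error, through `dot_young`, another L/4. This leaves L/2.
  have h3 : Fintype.card A * (1 + lam * (B0 + B1 + B2)) / (1 - γ) ^ 3 = L / 4 := by
    rw [hL]
    ring
  rw [h3] at hs
  linarith

/-- A short accurate step certifies that its end point is nearly optimal. -/
theorem IsAccurateStep.gap_le (hW : IsRegularizer W G B0 B1 B2) (hlam : 0 ≤ lam) (hB0 : 0 ≤ B0)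
    (hB1 : 0 ≤ B1) (hB2 : 0 ≤ B2) {ν : stdSimplex ℝ S} (hν : ∀ s, 0 < ν s) {L h ρν : ℝ}
    {π π' πs : Policy S A} (hρν : 1 ≤ ρν) (hS : Nonempty S)
    (hρ : ∀ s, visit M ν πs s / visit M ν π s ≤ ρν)
    (hL : L = smoothConst A γ (B0 + B1 + B2) lam) (hh : 0 ≤ h) (hhL : h ≤ L)
    (hstep : IsAccurateStep M W G ν lam (1 / L) ((h / 2) ^ 2) π π')
    (hshort : normSq (policyDiff π' π) ≤ (h / L) ^ 2) :
    J M W ν πs lam - J M W ν π' lam ≤ 3 * h * ρν * Real.sqrt (2 * Fintype.card S) := by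
  have hg := sub_pos.2 M.γ_lt_one
  have hA : (1 : ℝ) ≤ Fintype.card A := Nat.one_le_cast.2 Fintype.card_pos
  have hS1 : (1 : ℝ) ≤ Fintype.card S := Nat.one_le_cast.2 Fintype.card_pos
  have hLpos : 0 < L := hL ▸ smoothConst_pos M.γ_lt_one (by positivity) hlam
  have hprog := hstep.progress hW hlam hB0 hB1 hB2 hL
  obtain ⟨g, he, rfl⟩ := hstep
  obtain ⟨p, hp⟩ := gap_le_dot_policyGrad hW hlam ν hν πs π ρν hρ
  have hv := pgaStep_variational L hLpos π g p
  set π' := pgaStep (1 / L) π g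
  set e := g - policyGrad M W G lam ν π with hedef
  set s0 := Real.sqrt (2 * Fintype.card S) with hs0
  have hs0sq : s0 ^ 2 = 2 * Fintype.card S := Real.sq_sqrt (by positivity)
  have hs01 : 1 ≤ s0 := Real.one_le_sqrt.2 (by linarith)
  have hdiam : normSq (policyDiff p π') ≤ s0 ^ 2 := hs0sq ▸ normSq_policyDiff_le p π'
  have h1 := (abs_le.1 (abs_dot_le _ _ (h / L) s0 (by positivity) (by positivity) hshort hdiam)).2
  have h2 := (abs_le.1 (abs_dot_le _ _ (h / 2) s0 (by positivity) (by positivity) he hdiam)).1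
  have h3 : dot (policyGrad M W G lam ν π) (policyDiff π' π) ≤ h := by
    have hD : ∀ s, ∑ a, |policyDiff π' π s a| ≤ Fintype.card A * (h / L) :=
      sum_abs_le_of_card_mul_normSq_le _ _ (by positivity) (by
        rw [mul_pow]
        refine mul_le_mul ?_ hshort (normSq_nonneg _) (by positivity)
        nlinarith)
    refine (abs_le.1 (abs_dot_policyGrad_le (M := M) hW hlam hB0 hB1 hB2 ν π _ _ hD)).2.trans ?_
    rw [smoothConst_eq] at hL
    have hc : 0 ≤ Fintype.card A * (1 + lam * (B0 + B1 + B2)) := by positivity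
    have h4 : Fintype.card A * (1 + lam * (B0 + B1 + B2)) / (1 - γ) ^ 2 ≤ L := by
      rw [hL, ← mul_div_assoc, div_le_div_iff₀ (by positivity) (by positivity)]
      have h5 : (1 - γ) ^ 3 ≤ 1 * (1 - γ) ^ 2 := by
        rw [pow_succ, mul_comm]
        exact mul_le_mul_of_nonneg_right (by linarith [M.γ_nonneg]) (by positivity)
      nlinarith [mul_le_mul_of_nonneg_left h5 hc, mul_nonneg hc (pow_pos hg 2).le]
    calc (1 + lam * (B0 + B1 + B2)) / (1 - γ) ^ 2 * (Fintype.card A * (h / L))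
        = Fintype.card A * (1 + lam * (B0 + B1 + B2)) / (1 - γ) ^ 2 * (h / L) := by ring
      _ ≤ L * (h / L) := mul_le_mul_of_nonneg_right h4 (by positivity)
      _ = h := mul_div_cancel₀ _ hLpos.ne'
  have hsplit : policyDiff p π = policyDiff p π' + policyDiff π' π := by
    funext s a
    simp [policyDiff]
  -- The direction towards p is split at π'. From π' onwards, the short step contributes h s0 and
  -- the gradient error h s0 / 2; the piece from π to π' contributes h ≤ h s0.
  have h5 : dot (policyGrad M W G lam ν π) (policyDiff p π) ≤ 5 / 2 * h * s0 := by
    have h6 : dot e (policyDiff p π') =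
        dot g (policyDiff p π') - dot (policyGrad M W G lam ν π) (policyDiff p π') :=
      dot_sub_left _ _ _
    rw [hsplit, dot_add_right]
    have h7 := mul_le_mul_of_nonneg_left h1 hLpos.le
    have h8 : L * (h / L * s0) = h * s0 := by field_simp
    have h9 : h ≤ h * s0 := le_mul_of_one_le_right hh hs01
    linarith
  have h10 : J M W ν πs lam - J M W ν π lam ≤ ρν * (5 / 2 * h * s0) :=
    hp.trans (mul_le_mul_of_nonneg_left h5 (by linarith))
  -- The step itself may lower the objective by at most h/4, so the bound passes from π to π' with
  -- 5/2 + 1/4 ≤ 3.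
  have h11 : (h / 2) ^ 2 / L ≤ h / 4 := by
    rw [div_le_iff₀ hLpos]
    nlinarith
  have h12 : 0 ≤ L / 2 * normSq (policyDiff π' π) :=
    mul_nonneg (by positivity) (normSq_nonneg _)
  have h13 : h ≤ ρν * (h * s0) := by
    have : 1 ≤ ρν * s0 := one_le_mul_of_one_le_of_one_le hρν hs01
    nlinarith
  linarith

theorem sum_fin_telescope (n : ℕ) (f : Fin (n + 1) → ℝ) :
    ∑ k : Fin n, (f k.succ - f k.castSucc) = f (Fin.last n) - f 0 := by
  rw [Finset.sum_sub_distrib]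
  have h1 := Fin.sum_univ_succ f
  have h2 := Fin.sum_univ_castSucc f
  linarith

/-- If all steps of an epoch are accurate, some iterate is nearly optimal. -/
theorem exists_iterate_gap_le (hW : IsRegularizer W G B0 B1 B2) (hlam : 0 ≤ lam) (hB0 : 0 ≤ B0)
    (hB1 : 0 ≤ B1) (hB2 : 0 ≤ B2) {ν : stdSimplex ℝ S} (hν : ∀ s, 0 < ν s) {L h ρν Δ0 : ℝ}
    {πs : Policy S A} (hρν : 1 ≤ ρν) (hS : Nonempty S) (hopt : IsOptimal M W lam πs)
    (hρ : ∀ (π : Policy S A) (s : S), visit M ν πs s / visit M ν π s ≤ ρν)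
    (hL : L = smoothConst A γ (B0 + B1 + B2) lam) (hh : 0 ≤ h) (hhL : h ≤ L)
    {n : ℕ} (hn : 0 < n) (hΔ : 4 * L * Δ0 ≤ n * h ^ 2) (path : Fin (n + 1) → Policy S A)
    (hstart : J M W ν πs lam - J M W ν (path 0) lam ≤ Δ0)
    (hsteps : ∀ k : Fin n,
      IsAccurateStep M W G ν lam (1 / L) ((h / 2) ^ 2) (path k.castSucc) (path k.succ)) :
    ∃ k : Fin n, J M W ν πs lam - J M W ν (path k.succ) lam ≤
      3 * h * ρν * Real.sqrt (2 * Fintype.card S) := by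
  have hLpos : 0 < L := hL ▸ smoothConst_pos M.γ_lt_one (by positivity) hlam
  have hex : ∃ k : Fin n, normSq (policyDiff (path k.succ) (path k.castSucc)) ≤ (h / L) ^ 2 := by
    by_contra! hcon
    -- If every step were long, each would gain more than L/2 · (h/L)² - (h/2)²/L = h²/(4L), and n
    -- of them would exceed the initial gap, past the optimum.
    have hprog : ∀ k : Fin n, h ^ 2 / (4 * L) <
        J M W ν (path k.succ) lam - J M W ν (path k.castSucc) lam := fun k => by
      have h1 := (hsteps k).progress hW hlam hB0 hB1 hB2 hL
      have h2 := mul_lt_mul_of_pos_left (hcon k) (half_pos hLpos)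
      have h3 : L / 2 * (h / L) ^ 2 - (h / 2) ^ 2 / L = h ^ 2 / (4 * L) := by
        field_simp
        ring
      linarith
    have hne : (Finset.univ : Finset (Fin n)).Nonempty := ⟨⟨0, hn⟩, Finset.mem_univ _⟩
    have hsum := Finset.sum_lt_sum_of_nonempty hne fun k _ => hprog k
    rw [sum_fin_telescope n fun k => J M W ν (path k) lam, Finset.sum_const, Finset.card_univ,
      Fintype.card_fin, nsmul_eq_mul] at hsum
    have hJ : J M W ν (path (Fin.last n)) lam ≤ J M W ν πs lam :=
      Finset.sum_le_sum fun s _ =>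
        mul_le_mul_of_nonneg_left (hopt _ s) (simplex_nonneg ν s)
    have h4 : (n : ℝ) * (h ^ 2 / (4 * L)) = n * h ^ 2 / (4 * L) := by ring
    rw [h4, div_lt_iff₀ (by positivity)] at hsum
    nlinarith
  obtain ⟨k, hk⟩ := hex
  exact ⟨k, (hsteps k).gap_le hW hlam hB0 hB1 hB2 hν hρν hS (hρ _) hL hh hhL hk⟩

/-- Since `hβ` is uniform over policies, it applies to the random current iterate conditionally on
the past, and each step adds one β. The condition on `path 0` is carried along to anchor the initial
gap. -/
theorem pgaPath_failure_le (ν : stdSimplex ℝ S) (lam η E2 : ℝ) (N K : ℕ) (π₀ : Policy S A)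
    (β : ENNReal)
    (hβ : ∀ π, (gradEstimate M W G ν lam N K π).toOuterMeasure
      {g | E2 < normSq (g - policyGrad M W G lam ν π)} ≤ β) (n : ℕ) :
    (pgaPath M W G ν lam η N K π₀ n).toOuterMeasure {path | ¬(path 0 = π₀ ∧ ∀ k : Fin n,
      IsAccurateStep M W G ν lam η E2 (path k.castSucc) (path k.succ))} ≤ n * β := by
  induction n with
  | zero =>
    rw [pgaPath, PMF.toOuterMeasure_pure_apply]
    simp
  | succ n ih =>
    rw [pgaPath, Nat.cast_succ, add_mul, one_mul]
    refine toOuterMeasure_bind_le _ _ _ _ _ _ ih fun path hpath => ?_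
    simp only [Set.mem_ofPred_eq, not_not] at hpath
    rw [PMF.toOuterMeasure_map_apply]
    refine le_trans ((gradEstimate M W G ν lam N K (path (Fin.last n))).toOuterMeasure.mono
      fun g hg => ?_) (hβ (path (Fin.last n)))
    simp only [Set.mem_preimage, Set.mem_ofPred_eq] at hg ⊢
    by_contra! hcon
    refine hg ⟨?_, fun k => ?_⟩
    · rw [← hpath.1]
      exact Fin.snoc_castSucc (α := fun _ => Policy S A) _ _ (0 : Fin (n + 1))
    · rw [Fin.snoc_castSucc (α := fun _ => Policy S A)]
      refine Fin.lastCases ?_ (fun j => ?_) k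
      · rw [Fin.succ_last, Fin.snoc_last]
        exact ⟨g, hcon, rfl⟩
      · rw [← Fin.castSucc_succ, Fin.snoc_castSucc (α := fun _ => Policy S A)]
        exact hpath.2 j

end Epoch

/-! ### Union bound over the epochs -/

section Algorithm

variable {S A : Type*} [Fintype S] [Fintype A] [Nonempty A] {γ : ℝ}
  {M : MDP S A γ} {W : (A → ℝ) → ℝ} {G : (A → ℝ) → A → ℝ}

/-- Epochs communicate only through the current policy. A failure bound uniform over all policies
satisfying the invariant therefore adds up. -/
theorem adaptReduce_failure_le (ν : stdSimplex ℝ S) (lam₀ Ct : ℝ) (I N K : ℕ → ℕ)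
    (sel : (t : ℕ) → (Fin (I t + 1) → Policy S A) → Fin (I t)) (π₀ : Policy S A)
    (Inv : ℕ → Policy S A → Prop) (b : ℕ → ENNReal) (h0 : Inv 0 π₀) (T : ℕ)
    (hepoch : ∀ t < T, ∀ π, Inv t π →
      (pgaPath M W G ν (lam₀ / 2 ^ t) (1 / smoothConst A γ Ct (lam₀ / 2 ^ t)) (N t) (K t) π
        (I t)).toOuterMeasure {path | ¬Inv (t + 1) (path (sel t path).succ)} ≤ b t) :
    (adaptReduce M W G ν lam₀ Ct I N K sel π₀ T).toOuterMeasure {π | ¬Inv T π} ≤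
      ∑ t ∈ Finset.range T, b t := by
  induction T with
  | zero =>
    rw [adaptReduce, PMF.toOuterMeasure_pure_apply]
    simp [h0]
  | succ T ih =>
    rw [adaptReduce, Finset.sum_range_succ]
    refine toOuterMeasure_bind_le _ _ _ _ _ _ (ih fun t ht => hepoch t (ht.trans T.lt_succ_self))
      fun π hπ => ?_
    rw [PMF.toOuterMeasure_map_apply]
    exact hepoch T T.lt_succ_self π (not_not.1 hπ)

end Algorithm

/-! ### The accuracy guarantee under explicit parameter conditions -/

section Guarantee

variable {S A : Type*} [Fintype S] [DecidableEq S] [Fintype A] {γ : ℝ}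
  {M : MDP S A γ} {W : (A → ℝ) → ℝ} {G : (A → ℝ) → A → ℝ} {lam B0 B1 B2 : ℝ}

theorem objective_sub_objective (hW : IsRegularizer W G B0 B1 B2) (ξ : stdSimplex ℝ S)
    (π : Policy S A) (lam' : ℝ) (h : lam' ≤ lam) :
    J M W ξ π lam ≤ J M W ξ π lam' ∧
      J M W ξ π lam' ≤ J M W ξ π lam + (lam - lam') * B0 / (1 - γ) := by
  constructor
  · refine Finset.sum_le_sum fun s _ => mul_le_mul_of_nonneg_left ?_ (simplex_nonneg ξ s)
    linarith [(value_sub_value (M := M) hW π lam' h s).1]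
  · have h1 : J M W ξ π lam + (lam - lam') * B0 / (1 - γ) =
        ∑ s, ξ s * (value M W lam π s + (lam - lam') * B0 / (1 - γ)) := by
      simp_rw [mul_add, Finset.sum_add_distrib, ← Finset.sum_mul, simplex_sum, one_mul]
      rfl
    rw [h1]
    refine Finset.sum_le_sum fun s _ => mul_le_mul_of_nonneg_left ?_ (simplex_nonneg ξ s)
    linarith [(value_sub_value (M := M) hW π lam' h s).2]

theorem IsOptimal.objective_le {πs : Policy S A} (h : IsOptimal M W lam πs) (ξ : stdSimplex ℝ S)
    (π : Policy S A) : J M W ξ π lam ≤ J M W ξ πs lam :=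
  Finset.sum_le_sum fun s _ => mul_le_mul_of_nonneg_left (h π s) (simplex_nonneg ξ s)

theorem abs_objective_le (hW : IsRegularizer W G B0 B1 B2) (hlam : 0 ≤ lam) (ξ : stdSimplex ℝ S)
    (π : Policy S A) : |J M W ξ π lam| ≤ (1 + lam * B0) / (1 - γ) :=
  abs_simplex_average_le ξ _ _ (abs_value_le hW hlam π)

/-- Change of the initial distribution for the optimality gap. -/
theorem gap_change_distribution {πs : Policy S A} (h : IsOptimal M W lam πs)
    (μ ν : stdSimplex ℝ S) (ρ : ℝ) (hν : ∀ s, 0 < ν s) (hμ : ∀ s, μ s / ν s ≤ ρ)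
    (π : Policy S A) :
    J M W μ πs lam - J M W μ π lam ≤ ρ * (J M W ν πs lam - J M W ν π lam) := by
  unfold J
  rw [← Finset.sum_sub_distrib, ← Finset.sum_sub_distrib, Finset.mul_sum]
  refine Finset.sum_le_sum fun s _ => ?_
  have h1 := (div_le_iff₀ (hν s)).1 (hμ s)
  have h2 := mul_le_mul_of_nonneg_right h1 (sub_nonneg.2 (h π s))
  linarith

/-- Each numerical hypothesis has one task. `hD` and `hD'` make D gap_t a valid initial gap in later
epochs and in epoch 0. `hI` is 4 L_t (D gap_t) ≤ I_t h_t² with h_t² = gap_t² / (18 ρν² |S|). `herr`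
makes the squared gradient error at most (h_m/2)² in the last epoch, the most demanding one. `hlN`
serves the concentration bound, `hfail` the union bound, and `hm` the final accuracy. -/
theorem adaptReduce_guarantee [Nonempty S] [Nonempty A] (hW : IsRegularizer W G B0 B1 B2)
    (hB0 : 0 ≤ B0) (hB1 : 0 ≤ B1) (hB2 : 0 ≤ B2) {lam₀ Ct ρ ρν ε δ D l : ℝ}
    (hCt : Ct = B0 + B1 + B2) (hCtpos : 0 < Ct) (hlam₀ : 0 < lam₀) (hρ : 1 ≤ ρ) (hρν : 1 ≤ ρν)
    (hδ : 0 ≤ δ) (hD : 3 ≤ D) (hD' : 2 * (1 + lam₀ * Ct) / (1 - γ) ≤ D * (lam₀ * Ct / (1 - γ)))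
    (hl : 0 < l) {m N K : ℕ} {I : ℕ → ℕ} (hI0 : ∀ t, 0 < I t) (hN : 0 < N) (hK : 0 < K)
    (hm : 2 * ρ * (lam₀ * Ct / (1 - γ)) ≤ ε * 2 ^ m)
    (hI : ∀ t, 72 * (4 * (Fintype.card A * (1 + lam₀ / 2 ^ t * Ct) / (1 - γ) ^ 3)) * D * ρν ^ 2 *
      Fintype.card S ≤ I t * (lam₀ / 2 ^ t * Ct / (1 - γ)))
    (herr : 16 * (Fintype.card A * (1 + lam₀ * Ct) / (1 - γ) ^ 2) ^ 2 * l / N +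
        2 * (Fintype.card S * Fintype.card A * (2 * γ ^ K * (1 + lam₀ * Ct) / (1 - γ) ^ 2) ^ 2) ≤
      (lam₀ / 2 ^ m * Ct / (1 - γ)) ^ 2 / (72 * ρν ^ 2 * Fintype.card S))
    (hlN : (Fintype.card S : ℝ) * Fintype.card A * l ≤ N)
    (hfail : (∑ t ∈ Finset.range (m + 1), (I t : ℝ)) *
      (Fintype.card S * Fintype.card A * (2 * Real.exp (-l))) ≤ δ)
    (μ ν : stdSimplex ℝ S) (π₀ : Policy S A)
    (sel : (t : ℕ) → (Fin (I t + 1) → Policy S A) → Fin (I t))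
    (hν : ∀ s, 0 < ν s) (hμ : ∀ s, μ s / ν s ≤ ρ)
    (hopt : ∀ lam : ℝ, 0 ≤ lam → lam ≤ lam₀ → ∃ πs : Policy S A, IsOptimal M W lam πs ∧
      ∀ (π : Policy S A) (s : S), visit M ν πs s / visit M ν π s ≤ ρν)
    (hsel : ∀ (t : ℕ) (path : Fin (I t + 1) → Policy S A) (k : Fin (I t)),
      J M W ν (path k.succ) (lam₀ / 2 ^ t) ≤ J M W ν (path (sel t path).succ) (lam₀ / 2 ^ t)) :
    ENNReal.ofReal (1 - δ) ≤
      (adaptReduce M W G ν lam₀ Ct I (fun _ => N) (fun _ => K) sel π₀ (m + 1)).toOuterMeasure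
        {π | IsEpsOptimal M W μ ε π} := by
  have hγ0 := M.γ_nonneg
  have hg := sub_pos.2 M.γ_lt_one
  have hS1 : (1 : ℝ) ≤ Fintype.card S := Nat.one_le_cast.2 Fintype.card_pos
  have hA1 : (1 : ℝ) ≤ Fintype.card A := Nat.one_le_cast.2 Fintype.card_pos
  set lm : ℕ → ℝ := fun t => lam₀ / 2 ^ t with hlm
  have hlmpos : ∀ t, 0 < lm t := fun t => by positivity
  have hlmle : ∀ t, lm t ≤ lam₀ := fun t =>
    div_le_self hlam₀.le (one_le_pow₀ one_le_two)
  have hlmsucc : ∀ t, lm t = 2 * lm (t + 1) := fun t => by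
    simp only [hlm, pow_succ]
    field_simp
  have hlmanti : ∀ t, t ≤ m → lm m ≤ lm t := fun t ht =>
    div_le_div_of_nonneg_left hlam₀.le (by positivity) (pow_le_pow_right₀ one_le_two ht)
  set gap : ℕ → ℝ := fun t => lm t * Ct / (1 - γ) with hgap
  have hgappos : ∀ t, 0 < gap t := fun t => by
    have := hlmpos t
    simp only [hgap]
    positivity
  have hB0Ct : B0 ≤ Ct := by rw [hCt]; linarith
  set s0 := Real.sqrt (2 * Fintype.card S) with hs0
  have hs0sq : s0 ^ 2 = 2 * Fintype.card S := Real.sq_sqrt (by positivity)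
  have hs01 : 1 ≤ s0 := Real.one_le_sqrt.2 (by linarith)
  -- Chosen so that the certificate 3 h ρν √(2|S|) of a short step equals the target gap exactly.
  set h : ℕ → ℝ := fun t => gap t / (3 * ρν * s0) with hh
  have hhpos : ∀ t, 0 < h t := fun t => by
    have := hgappos t
    simp only [hh]
    positivity
  have hhsq : ∀ t, h t ^ 2 = gap t ^ 2 / (18 * ρν ^ 2 * Fintype.card S) := fun t => by
    simp only [hh]
    rw [div_pow, mul_pow, hs0sq]
    congr 1
    ring
  have hhgap : ∀ t, 3 * h t * ρν * s0 = gap t := fun t => by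
    simp only [hh]
    field_simp
  have hhle : ∀ t, h t ≤ gap t := fun t => by
    rw [← hhgap t]
    have h1 : 1 ≤ ρν * s0 := one_le_mul_of_one_le_of_one_le hρν hs01
    nlinarith [hhpos t]
  set L : ℕ → ℝ := fun t => smoothConst A γ (B0 + B1 + B2) (lm t) with hL
  have hLeq : ∀ t, L t = 4 * (Fintype.card A * (1 + lm t * Ct) / (1 - γ) ^ 3) := fun t => by
    simp only [hL]
    rw [smoothConst_eq, hCt]
  have hgapL : ∀ t, gap t ≤ L t := fun t => by
    have h1 := hlmpos t
    have h2 : 0 ≤ lm t * Ct := by positivity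
    rw [hLeq, ← mul_div_assoc]
    simp only [hgap]
    rw [div_le_div_iff₀ hg (by positivity)]
    have h3 : (1 - γ) ^ 3 ≤ 1 * (1 - γ) := by
      rw [pow_succ]
      exact mul_le_mul_of_nonneg_right (pow_le_one₀ hg.le (by linarith)) hg.le
    have h4 : lm t * Ct ≤ 4 * (Fintype.card A * (1 + lm t * Ct)) := by nlinarith
    calc lm t * Ct * (1 - γ) ^ 3 ≤ lm t * Ct * (1 - γ) := by
          refine mul_le_mul_of_nonneg_left (by linarith) h2
      _ ≤ _ := mul_le_mul_of_nonneg_right h4 hg.le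
  -- the squared gradient error tolerated in epoch `t`
  have herr' : ∀ t ≤ m,
      16 * (Fintype.card A * (1 + lm t * (B0 + B1 + B2)) / (1 - γ) ^ 2) ^ 2 * l / N +
        2 * (Fintype.card S * Fintype.card A *
          (2 * γ ^ K * (1 + lm t * (B0 + B1 + B2)) / (1 - γ) ^ 2) ^ 2) ≤ (h t / 2) ^ 2 := by
    intro t ht
    rw [← hCt]
    have h1 : 1 + lm t * Ct ≤ 1 + lam₀ * Ct := by
      have := mul_le_mul_of_nonneg_right (hlmle t) hCtpos.le
      linarith
    have h2 : 0 ≤ 1 + lm t * Ct := by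
      have := hlmpos t
      positivity
    have h3 : gap m ≤ gap t :=
      div_le_div_of_nonneg_right (mul_le_mul_of_nonneg_right (hlmanti t ht) hCtpos.le) hg.le
    calc _ ≤ 16 * (Fintype.card A * (1 + lam₀ * Ct) / (1 - γ) ^ 2) ^ 2 * l / N +
          2 * (Fintype.card S * Fintype.card A *
            (2 * γ ^ K * (1 + lam₀ * Ct) / (1 - γ) ^ 2) ^ 2) := by gcongr
      _ ≤ gap m ^ 2 / (72 * ρν ^ 2 * Fintype.card S) := herr
      _ ≤ gap t ^ 2 / (72 * ρν ^ 2 * Fintype.card S) := by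
          have := hgappos m
          gcongr
      _ = (h t / 2) ^ 2 := by
          rw [show (h t / 2) ^ 2 = h t ^ 2 / 4 by ring, hhsq, div_div]
          congr 1
          ring
  -- The index is shifted: after epoch t the invariant concerns λ_t. Nothing is known about the
  -- initial policy, so epoch 0 relies on the crude bound for J.
  let Inv : ℕ → Policy S A → Prop := fun t π => match t with
    | 0 => True
    | t + 1 => ∀ πs, IsOptimal M W (lm t) πs → J M W ν πs (lm t) - J M W ν π (lm t) ≤ gap t
  have hstart : ∀ t π, Inv t π → ∀ πs, IsOptimal M W (lm t) πs →
      J M W ν πs (lm t) - J M W ν π (lm t) ≤ D * gap t := by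
    intro t π hInv πs hs
    cases t with
    | zero =>
      have h1 : lm 0 = lam₀ := by simp [hlm]
      have h2 := (abs_le.1 (abs_objective_le (M := M) hW (hlmpos 0).le ν πs)).2
      have h3 := (abs_le.1 (abs_objective_le (M := M) hW (hlmpos 0).le ν π)).1
      have h4 : (1 + lm 0 * B0) / (1 - γ) ≤ (1 + lm 0 * Ct) / (1 - γ) := by
        have := hlmpos 0
        gcongr
      have h5 : D * gap 0 = D * (lam₀ * Ct / (1 - γ)) := by
        simp only [hgap]
        rw [h1]
      rw [h5]
      rw [h1] at *
      have h6 : 2 * (1 + lam₀ * Ct) / (1 - γ) = 2 * ((1 + lam₀ * Ct) / (1 - γ)) := by ring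
      linarith
    | succ t =>
      obtain ⟨πt, hπt, -⟩ := hopt (lm t) (hlmpos t).le (hlmle t)
      have h1 : J M W ν πt (lm t) - J M W ν π (lm t) ≤ gap t := hInv πt hπt
      have h2 : lm (t + 1) ≤ lm t := by linarith [hlmsucc t, hlmpos (t + 1)]
      have h3 := (objective_sub_objective (M := M) hW ν πs _ h2).2
      have h4 := (objective_sub_objective (M := M) hW ν π _ h2).1
      have h5 := hπt.objective_le ν πs
      have h6 : (lm t - lm (t + 1)) * B0 / (1 - γ) ≤ gap (t + 1) := by
        simp only [hgap]
        have : lm t - lm (t + 1) = lm (t + 1) := by linarith [hlmsucc t]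
        rw [this]
        have := hlmpos (t + 1)
        gcongr
      -- The inherited gap is two units of the new one, and changing λ costs a third; this is why D
      -- ≥ 3 is needed.
      have h7 : gap t = 2 * gap (t + 1) := by
        simp only [hgap]
        rw [hlmsucc t]
        ring
      have h8 := mul_le_mul_of_nonneg_right hD (hgappos (t + 1)).le
      linarith
  set β : ENNReal := ENNReal.ofReal (Fintype.card S * Fintype.card A * (2 * Real.exp (-l))) with hβ
  have hepoch : ∀ t < m + 1, ∀ π, Inv t π →
      (pgaPath M W G ν (lam₀ / 2 ^ t) (1 / smoothConst A γ Ct (lam₀ / 2 ^ t)) N K π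
        (I t)).toOuterMeasure {path | ¬Inv (t + 1) (path (sel t path).succ)} ≤ I t * β := by
    intro t ht π hInv
    have hβt : ∀ π, (gradEstimate M W G ν (lm t) N K π).toOuterMeasure
        {g | (h t / 2) ^ 2 < normSq (g - policyGrad M W G (lm t) ν π)} ≤ β := fun π => by
      refine le_trans ?_
        (gradEstimate_accuracy (M := M) hW (hlmpos t).le hB0 hB1 hB2 ν π N K hN hK l hl hlN)
      exact (gradEstimate M W G ν (lm t) N K π).toOuterMeasure.mono fun g hgm =>
        (herr' t (Nat.lt_succ_iff.1 ht)).trans_lt hgm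
    refine le_trans ?_ (pgaPath_failure_le ν (lm t) (1 / smoothConst A γ Ct (lm t)) ((h t / 2) ^ 2)
      N K π β hβt (I t))
    refine (pgaPath M W G ν _ _ N K π (I t)).toOuterMeasure.mono fun path hpath => ?_
    simp only [Set.mem_ofPred_eq] at hpath ⊢
    refine fun hgood => hpath ?_
    intro πs hs
    obtain ⟨πo, hπo, hvisit⟩ := hopt (lm t) (hlmpos t).le (hlmle t)
    have hsmooth : smoothConst A γ Ct (lm t) = L t := by rw [hCt]
    rw [hsmooth] at hgood
    have hI' : 4 * L t * (D * gap t) ≤ I t * h t ^ 2 := by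
      have h1 := mul_le_mul_of_nonneg_right (hI t) (hgappos t).le
      have h2 : (0 : ℝ) < 18 * ρν ^ 2 * Fintype.card S := by positivity
      rw [hhsq, ← mul_div_assoc (I t : ℝ), le_div_iff₀ h2, hLeq]
      change 72 * (4 * (Fintype.card A * (1 + lm t * Ct) / (1 - γ) ^ 3)) * D * ρν ^ 2 *
        Fintype.card S * gap t ≤ I t * gap t * gap t at h1
      linarith
    obtain ⟨k, hk⟩ := exists_iterate_gap_le (M := M) hW (hlmpos t).le hB0 hB1 hB2 hν hρν
      inferInstance hπo hvisit (rfl : L t = _) (hhpos t).le ((hhle t).trans (hgapL t)) (hI0 t) hI'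
      path (by rw [hgood.1]; exact hstart t π hInv πo hπo) hgood.2
    rw [hhgap] at hk
    have h3 := hsel t path k
    have h4 := hπo.objective_le ν πs
    change J M W ν πs (lm t) - J M W ν (path (sel t path).succ) (lm t) ≤ gap t
    linarith
  have hfailure := adaptReduce_failure_le (M := M) (W := W) (G := G) ν lam₀ Ct I
    (fun _ => N) (fun _ => K) sel π₀ Inv
    (fun t => I t * β) trivial (m + 1) hepoch
  refine ofReal_le_toOuterMeasure_of_compl _ _ δ hδ (le_trans ?_ (hfailure.trans ?_))
  · refine (adaptReduce M W G ν lam₀ Ct I (fun _ => N) (fun _ => K) sel π₀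
      (m + 1)).toOuterMeasure.mono fun π hπ hInv => hπ ?_
    intro π'
    obtain ⟨πo, hπo, -⟩ := hopt (lm m) (hlmpos m).le (hlmle m)
    have h1 : J M W ν πo (lm m) - J M W ν π (lm m) ≤ gap m := hInv πo hπo
    have h2 := gap_change_distribution hπo μ ν ρ hν hμ π
    have h3 := (objective_sub_objective (M := M) hW μ π' 0 (hlmpos m).le).2
    have h4 := (objective_sub_objective (M := M) hW μ π 0 (hlmpos m).le).1
    have h5 := hπo.objective_le μ π'
    have h6 : (lm m - 0) * B0 / (1 - γ) ≤ gap m := by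
      simp only [hgap]
      rw [sub_zero]
      have := hlmpos m
      gcongr
    have h7 : gap m = lam₀ * Ct / (1 - γ) / 2 ^ m := by
      simp only [hgap, hlm]
      field_simp
    -- Passing to μ gives ρ gap_m, and removing the regularizer adds gap_m ≤ ρ gap_m.
    have h8 : 2 * ρ * gap m ≤ ε := by
      rw [h7, mul_div_assoc', div_le_iff₀ (by positivity)]
      exact hm
    have h9 := mul_le_mul_of_nonneg_left h1 (by linarith : 0 ≤ ρ)
    have h10 := mul_le_mul_of_nonneg_right hρ (hgappos m).le
    linarith
  · rw [← Finset.sum_mul, hβ, ← Nat.cast_sum, ← ENNReal.ofReal_natCast,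
      ← ENNReal.ofReal_mul (Nat.cast_nonneg _), Nat.cast_sum]
    exact ENNReal.ofReal_le_ofReal hfail

/-- A regularizer with a nearly constant gradient forces a single action. -/
theorem IsRegularizer.subsingleton (hW : IsRegularizer W G B0 B1 B2) (hB : B2 < 1 / 2) :
    Subsingleton A := by
  classical
  refine ⟨fun a b => ?_⟩
  by_contra hab
  set p : A → ℝ := Pi.single a 1 with hp
  set q : A → ℝ := Pi.single b 1 with hq
  have hpm : p ∈ stdSimplex ℝ A := single_mem_stdSimplex ℝ a
  have hqm : q ∈ stdSimplex ℝ A := single_mem_stdSimplex ℝ b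
  have hsum : ∀ f : A → ℝ, ∑ x, f x * (q x - p x) = f b - f a := fun f => by
    simp [hp, hq, mul_sub, Pi.single_apply]
  have hsum' : ∀ f : A → ℝ, ∑ x, f x * (p x - q x) = f a - f b := fun f => by
    simp [hp, hq, mul_sub, Pi.single_apply]
  have hba : b ≠ a := fun h => hab h.symm
  have hsq : ∑ x, (q x - p x) ^ 2 = 2 := by
    have h1 : ∀ x, (q x - p x) ^ 2 = (q x - p x) * (q x - p x) := fun x => sq _
    simp_rw [h1]
    rw [hsum fun x => q x - p x]
    simp [hp, hq, hab, hba]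
    norm_num
  have hsq' : ∑ x, (p x - q x) ^ 2 = 2 := by
    rw [← hsq]
    refine Finset.sum_congr rfl fun x _ => ?_
    ring
  have habs : ∑ x, |p x - q x| ≤ 2 := by
    calc ∑ x, |p x - q x| ≤ ∑ x, (p x + q x) := Finset.sum_le_sum fun x _ => by
          refine (abs_sub _ _).trans ?_
          rw [abs_of_nonneg (hpm.1 x), abs_of_nonneg (hqm.1 x)]
      _ = 2 := by rw [Finset.sum_add_distrib, hpm.2, hqm.2]; norm_num
  -- Strong convexity between two vertices, used in both directions and added, forces a gradient
  -- variation of at least 2 over two coordinates, while the Lipschitz bound allows at most 4 `B2`.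
  have h1 := hW.strong_convex p hpm q hqm
  have h2 := hW.strong_convex q hqm p hpm
  rw [hsum, hsq] at h1
  rw [hsum', hsq'] at h2
  have h3 := (abs_le.1 (hW.grad_lipschitz p hpm q hqm a)).2
  have h4 := (abs_le.1 (hW.grad_lipschitz p hpm q hqm b)).1
  have h0 : 0 ≤ ∑ x, |p x - q x| := Finset.sum_nonneg fun _ _ => abs_nonneg _
  have h5 : 1 ≤ B2 * ∑ x, |p x - q x| := by linarith
  rcases le_or_gt B2 0 with hB2 | hB2
  · nlinarith
  · nlinarith

end Guarantee

/-! ### Choice of the parameters and of the constants -/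

section Parameters

theorem exists_two_pow_between (y : ℝ) : ∃ m : ℕ, y ≤ 2 ^ m ∧ (2 : ℝ) ^ m ≤ 1 + 2 * max y 0 := by
  rcases le_or_gt 1 y with h | h
  · obtain ⟨n, h1, h2⟩ := exists_nat_pow_near h one_lt_two
    refine ⟨n + 1, h2.le, ?_⟩
    rw [pow_succ]
    linarith [le_max_left y 0]
  · exact ⟨0, by simpa using h.le, by simp⟩

theorem exists_truncation_length (γ Z : ℝ) (h0 : 0 ≤ γ) (h1 : γ < 1) (hZ : 1 ≤ Z) :
    ∃ K : ℕ, 0 < K ∧ (K : ℝ) ≤ 1 + Real.log Z / Real.log (1 / γ) ∧ γ ^ K ≤ 1 / Z := by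
  rcases h0.eq_or_lt with rfl | hpos
  -- For γ = 0 the conventions 1/0 = 0 and log 0 = 0 make the quotient vanish, so the bound reads K
  -- ≤ 1.
  · exact ⟨1, one_pos, by simp, by simp; linarith⟩
  · have ha : 0 < Real.log (1 / γ) := Real.log_pos ((one_lt_div hpos).2 h1)
    have hq : 0 ≤ Real.log Z / Real.log (1 / γ) := div_nonneg (Real.log_nonneg hZ) ha.le
    refine ⟨⌊Real.log Z / Real.log (1 / γ)⌋₊ + 1, Nat.succ_pos _, ?_, ?_⟩
    · push_cast
      linarith [Nat.floor_le hq]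
    · set K := ⌊Real.log Z / Real.log (1 / γ)⌋₊ + 1 with hK
      have h2 : Real.log Z / Real.log (1 / γ) ≤ K := by
        rw [hK]
        push_cast
        exact (Nat.lt_floor_add_one _).le
      rw [div_le_iff₀ ha] at h2
      have h3 : 0 < Z := by linarith
      rw [← Real.log_le_log_iff (pow_pos hpos K) (by positivity), Real.log_pow, one_div,
        Real.log_inv]
      rw [one_div, Real.log_inv] at h2
      linarith

-- The delicate point is the order of the constants: c₂ is built from `lmin` alone, while c₁ may use
-- `lam₀`. The hypotheses Ct ≥ 1/2 and lam₀ ≥ lmin keep x = lam₀ Ct above lmin/2, so that 1/x is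
-- bounded uniformly.
set_option maxHeartbeats 1000000 in
theorem exists_parameters (lmin : ℝ) (hlmin : 0 < lmin) :
    ∃ c₂ : ℝ, 1 ≤ c₂ ∧ ∀ lam₀ : ℝ, lmin ≤ lam₀ → ∃ c₁ : ℝ, 0 < c₁ ∧
    ∀ nS nA γ ρ ρν Ct ε δ : ℝ, 1 ≤ nS → 1 ≤ nA → 0 ≤ γ → γ < 1 → 1 ≤ ρ → 1 ≤ ρν → 1 / 2 ≤ Ct →
      0 < ε → ε ≤ 1 → 0 < δ → δ < 1 →
      ∃ (m N K : ℕ) (I : ℕ → ℕ) (D l : ℝ),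
        (∀ t, 0 < I t) ∧ 0 < N ∧ 0 < K ∧
        (∑ t ∈ Finset.range (m + 1), (I t : ℝ)) ≤
          c₁ * (nS * nA * ρ * ρν ^ 2 * Ct / (ε * (1 - γ) ^ 3)) ∧
        (∑ t ∈ Finset.range (m + 1), (I t : ℝ) * N) ≤
          c₂ * (nS ^ 4 * nA ^ 3 * ρ ^ 5 * ρν ^ 6 * (1 + lam₀ * Ct) ^ 3 / (ε ^ 5 * (1 - γ) ^ 7)) *
            Real.log (2 * nS * nA * ρ * ρν * (1 + lam₀ * Ct) / (ε * (1 - γ) * δ)) ∧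
        (K : ℝ) ≤ 1 + Real.log (c₂ * (nS * nA * ρ ^ 2 * ρν ^ 2 * (1 + lam₀ * Ct)) /
          (ε ^ 2 * (1 - γ) ^ 2)) / Real.log (1 / γ) ∧
        3 ≤ D ∧ 2 * (1 + lam₀ * Ct) / (1 - γ) ≤ D * (lam₀ * Ct / (1 - γ)) ∧ 0 < l ∧
        2 * ρ * (lam₀ * Ct / (1 - γ)) ≤ ε * 2 ^ m ∧
        (∀ t, 72 * (4 * (nA * (1 + lam₀ / 2 ^ t * Ct) / (1 - γ) ^ 3)) * D * ρν ^ 2 * nS ≤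
          I t * (lam₀ / 2 ^ t * Ct / (1 - γ))) ∧
        16 * (nA * (1 + lam₀ * Ct) / (1 - γ) ^ 2) ^ 2 * l / N +
            2 * (nS * nA * (2 * γ ^ K * (1 + lam₀ * Ct) / (1 - γ) ^ 2) ^ 2) ≤
          (lam₀ / 2 ^ m * Ct / (1 - γ)) ^ 2 / (72 * ρν ^ 2 * nS) ∧
        nS * nA * l ≤ N ∧
        (∑ t ∈ Finset.range (m + 1), (I t : ℝ)) * (nS * nA * (2 * Real.exp (-l))) ≤ δ := by
  -- Since x ≥ lmin/2, the summand 4/lmin gives D x ≥ 2 + 3x ≥ 2(1 + x), the requirement of epoch 0.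
  set D : ℝ := 3 + 4 / lmin with hD
  have hDpos : 0 < D := by positivity
  -- Here 1152 = 288 · 2 · 2: one doubling pays for rounding up, the other for the geometric sum.
  set a : ℝ := 1152 * D * (1 + 2 / lmin) with ha
  have hapos : 0 < a := by positivity
  -- As X ≥ 2 below, n extra powers of X absorb the constant 4a in the failure probability.
  obtain ⟨n, hn⟩ := pow_unbounded_of_one_lt (4 * a) (one_lt_two : (1 : ℝ) < 2)
  -- Tuned so that the last gap is at least κ ε / ρ: rounding up to a power of two does not
  -- overshoot by more than a constant.
  set κ : ℝ := 1 / (2 / lmin + 4) with hκ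
  have hκpos : 0 < κ := by positivity
  have hκinv : κ * (2 / lmin) + 4 * κ = 1 := by
    rw [hκ]
    field_simp
  have hκle : κ ≤ 1 / 4 := by
    have : 0 ≤ κ * (2 / lmin) := by positivity
    linarith
  -- Here 2304 = 16 · 72 · 2, which lets the sampling error use half of the error budget. In c₂, the
  -- term 34/κ gives the bias the other half, since 34² ≥ 1152.
  set b : ℝ := 2304 * (3 + n) / κ ^ 2 with hb
  have hbpos : 0 < b := by positivity
  set c₂ : ℝ := 8 * a * b + 34 / κ with hc₂
  have hc₂34 : 34 / κ ≤ c₂ := by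
    have : 0 ≤ 8 * a * b := by positivity
    linarith
  have h34 : 34 ≤ c₂ * κ := (div_le_iff₀ hκpos).1 hc₂34
  have hc₂1 : 1 ≤ c₂ := by
    refine le_trans ?_ hc₂34
    rw [le_div_iff₀ hκpos]
    linarith
  refine ⟨c₂, hc₂1, fun lam₀ hlam₀ => ⟨a * (2 + 4 * lam₀), ?_, ?_⟩⟩
  · have := hlmin.trans_le hlam₀
    positivity
  intro nS nA γ ρ ρν Ct ε δ hS hA hγ0 hγ1 hρ hρν hCt hε hε1 hδ hδ1
  have hg : 0 < 1 - γ := sub_pos.2 hγ1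
  have hlam₀pos : 0 < lam₀ := hlmin.trans_le hlam₀
  -- reciprocals, so that all comparisons are between monomials in variables at least one
  obtain ⟨u, hu⟩ : ∃ u, u = 1 / (1 - γ) := ⟨_, rfl⟩
  obtain ⟨w, hw⟩ : ∃ w, w = 1 / ε := ⟨_, rfl⟩
  obtain ⟨d, hd⟩ : ∃ d, d = 1 / δ := ⟨_, rfl⟩
  have hu1 : 1 ≤ u := by rw [hu, le_div_iff₀ hg]; linarith
  have hw1 : 1 ≤ w := by rw [hw, le_div_iff₀ hε]; linarith
  have hd1 : 1 ≤ d := by rw [hd, le_div_iff₀ hδ]; linarith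
  have hgu : 1 - γ = 1 / u := by rw [hu, one_div_one_div]
  have hεw : ε = 1 / w := by rw [hw, one_div_one_div]
  have hδd : δ = 1 / d := by rw [hd, one_div_one_div]
  have hu0 : 0 < u := by linarith
  have hw0 : 0 < w := by linarith
  have hd0 : 0 < d := by linarith
  obtain ⟨x, hx⟩ : ∃ x, x = lam₀ * Ct := ⟨_, rfl⟩
  have hxlmin : lmin / 2 ≤ x := by
    have h := mul_le_mul hlam₀ hCt (by norm_num) hlam₀pos.le
    rw [hx]
    linarith only [h]
  have hx0 : 0 < x := by linarith
  obtain ⟨c, hc⟩ : ∃ c, c = 1 + x := ⟨_, rfl⟩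
  have hc1 : 1 ≤ c := by linarith
  have hxinv : 1 / x ≤ 2 / lmin := by
    rw [div_le_div_iff₀ hx0 hlmin]
    linarith
  have hS0 : 0 < nS := by linarith
  have hA0 : 0 < nA := by linarith
  have hρ0 : 0 < ρ := by linarith
  have hρν0 : 0 < ρν := by linarith
  have hc0 : 0 < c := by linarith
  -- number of epochs
  obtain ⟨m, hm1, hm2⟩ := exists_two_pow_between (2 * ρ * x * u * w)
  rw [max_eq_left (by positivity)] at hm2
  -- iterations
  set q : ℕ → ℝ := fun t => 288 * D * (ρν ^ 2 * nS * nA * u ^ 2) * (1 + 2 ^ t / x) with hq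
  have hmon : 1 ≤ ρν ^ 2 * nS * nA * u ^ 2 := by
    calc (1 : ℝ) = 1 ^ 2 * 1 * 1 * 1 ^ 2 := by norm_num
      _ ≤ _ := by gcongr
  have hq1 : ∀ t, 1 ≤ q t := fun t => by
    have h1 : 1 ≤ 1 + 2 ^ t / x := by
      have : 0 ≤ 2 ^ t / x := by positivity
      linarith
    have h2 : 1 ≤ 288 * D := by
      have : 0 ≤ 4 / lmin := by positivity
      linarith
    exact one_le_mul_of_one_le_of_one_le (one_le_mul_of_one_le_of_one_le h2 hmon) h1
  have hceil : ∀ y : ℝ, 1 ≤ y → (⌈y⌉₊ : ℝ) ≤ 2 * y := fun y hy => by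
    linarith [Nat.ceil_lt_add_one (by linarith : 0 ≤ y)]
  have hqle : ∀ t, (⌈q t⌉₊ : ℝ) ≤ a / 2 * (ρν ^ 2 * nS * nA * u ^ 2) * 2 ^ t := fun t => by
    refine (hceil _ (hq1 t)).trans ?_
    have h1 : (1 : ℝ) ≤ 2 ^ t := one_le_pow₀ one_le_two
    have h2 : 1 + 2 ^ t / x ≤ (1 + 2 / lmin) * 2 ^ t := by
      have := mul_le_mul_of_nonneg_right hxinv (by positivity : (0 : ℝ) ≤ 2 ^ t)
      rw [one_div_mul_eq_div] at this
      linarith only [this, h1]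
    have h3 := mul_le_mul_of_nonneg_left h2
      (by positivity : 0 ≤ 2 * (288 * D * (ρν ^ 2 * nS * nA * u ^ 2)))
    simp only [hq]
    rw [ha]
    linarith only [h3]
  have hgeom : ∑ t ∈ Finset.range (m + 1), (2 : ℝ) ^ t ≤ 2 * 2 ^ m := by
    rw [geom_sum_eq (by norm_num), pow_succ]
    norm_num
    linarith
  have hsumI : ∑ t ∈ Finset.range (m + 1), (⌈q t⌉₊ : ℝ) ≤
      a * (ρν ^ 2 * nS * nA * u ^ 2) * 2 ^ m := by
    refine (Finset.sum_le_sum fun t _ => hqle t).trans ?_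
    rw [← Finset.mul_sum]
    refine (mul_le_mul_of_nonneg_left hgeom (by positivity)).trans_eq ?_
    ring
  have hρuw : 1 ≤ ρ * u * w :=
    one_le_mul_of_one_le_of_one_le (one_le_mul_of_one_le_of_one_le hρ hu1) hw1
  -- Two bounds on the same power: this one is linear in Ct and brings `lam₀` into c₁, whereas the
  -- next uses c = 1 + lam₀ Ct and keeps c₂ free of `lam₀`.
  have hm3 : (2 : ℝ) ^ m ≤ (2 + 4 * lam₀) * (ρ * Ct * u * w) := by
    have h := mul_le_mul hCt hρuw zero_le_one (by linarith only [hCt])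
    rw [hx] at hm2
    linarith only [hm2, h]
  have hm4 : (2 : ℝ) ^ m ≤ 4 * (ρ * c * u * w) := by
    rw [hc]
    linarith only [hm2, hρuw]
  have hsumI₂ : ∑ t ∈ Finset.range (m + 1), (⌈q t⌉₊ : ℝ) ≤
      4 * a * (nS * nA * ρ * ρν ^ 2 * c * u ^ 3 * w) := by
    refine hsumI.trans ((mul_le_mul_of_nonneg_left hm4 (by positivity)).trans_eq ?_)
    ring
  -- confidence level
  obtain ⟨X, hX⟩ : ∃ X, X = 2 * nS * nA * ρ * ρν * c * u * w * d := ⟨_, rfl⟩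
  have hX2 : 2 ≤ X := by
    rw [hX]
    calc (2 : ℝ) = 2 * 1 * 1 * 1 * 1 * 1 * 1 * 1 * 1 := by norm_num
      _ ≤ _ := by gcongr
  have hX0 : 0 < X := by linarith
  have hlogX : 1 / 2 ≤ Real.log X := by
    have h1 := Real.log_le_log two_pos hX2
    linarith [Real.log_two_gt_d9]
  -- Then exp(-l) = X^{-(3+n)}: three powers of X dominate the monomial coming from the union bound
  -- together with 1/δ, and the other n its constant.
  set l : ℝ := (3 + n) * Real.log X with hl
  have hl1 : 1 ≤ l := by
    have : (0 : ℝ) ≤ n := Nat.cast_nonneg n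
    have h := mul_le_mul (by linarith only [this] : (3 : ℝ) ≤ 3 + n) hlogX (by norm_num)
      (by linarith only [this])
    rw [hl]
    linarith only [h]
  have hexp : Real.exp (-l) = 1 / X ^ (3 + n) := by
    rw [Real.exp_neg, hl, one_div]
    congr 1
    rw [mul_comm, Real.exp_mul, Real.exp_log hX0]
    exact_mod_cast Real.rpow_natCast X (3 + n)
  -- sample size
  set n0 : ℝ := b * (nA ^ 2 * c ^ 2 * u ^ 4 * ρ ^ 2 * ρν ^ 2 * nS * w ^ 2) * Real.log X with hn0
  have hn0l : n0 = 2304 / κ ^ 2 * (nA ^ 2 * c ^ 2 * u ^ 4 * ρ ^ 2 * ρν ^ 2 * nS * w ^ 2) * l := by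
    rw [hn0, hb, hl]
    ring
  have hlN : nS * nA * l ≤ n0 := by
    rw [hn0l]
    refine mul_le_mul_of_nonneg_right ?_ (by linarith)
    have h1 : 1 ≤ 2304 / κ ^ 2 := by
      rw [le_div_iff₀ (by positivity)]
      linarith only [pow_le_one₀ (n := 2) hκpos.le (by linarith only [hκle])]
    have h2 : nS * nA ≤ nA ^ 2 * c ^ 2 * u ^ 4 * ρ ^ 2 * ρν ^ 2 * nS * w ^ 2 := by
      calc nS * nA = nA ^ 1 * c ^ 0 * u ^ 0 * ρ ^ 0 * ρν ^ 0 * nS * w ^ 0 := by ring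
        _ ≤ _ := by gcongr <;> norm_num
    exact h2.trans (le_mul_of_one_le_left (by positivity) h1)
  have hn01 : 1 ≤ n0 := by
    refine le_trans ?_ hlN
    exact one_le_mul_of_one_le_of_one_le (one_le_mul_of_one_le_of_one_le hS hA) hl1
  have hNpos : (0 : ℝ) < ⌈n0⌉₊ := Nat.cast_pos.2 (Nat.ceil_pos.2 (by linarith))
  -- truncation
  obtain ⟨Z, hZ⟩ : ∃ Z, Z = c₂ * (nS * nA * ρ ^ 2 * ρν ^ 2 * c * w ^ 2 * u ^ 2) := ⟨_, rfl⟩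
  have hZ1 : 1 ≤ Z := by
    rw [hZ]
    refine one_le_mul_of_one_le_of_one_le hc₂1 ?_
    calc (1 : ℝ) = 1 * 1 * 1 ^ 2 * 1 ^ 2 * 1 * 1 ^ 2 * 1 ^ 2 := by norm_num
      _ ≤ _ := by gcongr
  obtain ⟨K, hK0, hK1, hK2⟩ := exists_truncation_length γ Z hγ0 hγ1 hZ1
  -- the target gap of the last epoch
  have hgap : κ / (w * ρ) ≤ x * u / 2 ^ m := by
    rw [div_le_div_iff₀ (by positivity) (by positivity)]
    have h1 : κ ≤ κ * (2 / lmin) * (x * u * w * ρ) := by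
      have h2 : 1 ≤ 2 / lmin * x := by
        rw [div_mul_eq_mul_div, le_div_iff₀ hlmin]
        linarith
      have h3 : 1 ≤ 2 / lmin * x * (ρ * u * w) := one_le_mul_of_one_le_of_one_le h2 hρuw
      calc κ = κ * 1 := (mul_one κ).symm
        _ ≤ κ * (2 / lmin * x * (ρ * u * w)) := mul_le_mul_of_nonneg_left h3 hκpos.le
        _ = _ := by ring
    have h4 := mul_le_mul_of_nonneg_left hm2 hκpos.le
    have h5 : κ * (2 / lmin) * (x * u * w * ρ) = (1 - 4 * κ) * (x * u * w * ρ) := by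
      rw [← hκinv]
      ring
    linarith only [h1, h4, h5]
  rw [← hx, ← hc, hgu, hεw, hδd]
  have hlamx : ∀ t : ℕ, lam₀ / 2 ^ t * Ct = x / 2 ^ t := fun t => by
    rw [hx]
    ring
  simp_rw [hlamx]
  refine ⟨m, ⌈n0⌉₊, K, fun t => ⌈q t⌉₊, D, l, fun t => Nat.ceil_pos.2 (by linarith [hq1 t]),
    Nat.ceil_pos.2 (by linarith), hK0, ?_, ?_, ?_, ?_, ?_, by linarith, ?_, fun t => ?_, ?_,
    hlN.trans (Nat.le_ceil n0), ?_⟩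
  · refine hsumI.trans ((mul_le_mul_of_nonneg_left hm3 (by positivity)).trans_eq ?_)
    field_simp
  · have hlog : 2 * nS * nA * ρ * ρν * c / (1 / w * (1 / u) * (1 / d)) = X := by
      rw [hX]
      field_simp
    rw [hlog, ← Finset.sum_mul]
    calc (∑ t ∈ Finset.range (m + 1), (⌈q t⌉₊ : ℝ)) * (⌈n0⌉₊ : ℝ)
        ≤ 4 * a * (nS * nA * ρ * ρν ^ 2 * c * u ^ 3 * w) * (2 * n0) :=
          mul_le_mul hsumI₂ (hceil n0 hn01) hNpos.le (by positivity)
      _ = 8 * a * b * (nS ^ 2 * nA ^ 3 * ρ ^ 3 * ρν ^ 4 * c ^ 3 * w ^ 3 * u ^ 7) * Real.log X := by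
          rw [hn0]
          ring
      -- The argument yields the smaller powers |S|², ρ³, ρν⁴ and ε⁻³; they are enlarged here to the
      -- stated ones.
      _ ≤ c₂ * (nS ^ 4 * nA ^ 3 * ρ ^ 5 * ρν ^ 6 * c ^ 3 * w ^ 5 * u ^ 7) * Real.log X := by
          have h1 : 8 * a * b ≤ c₂ := by
            have : 0 ≤ 34 / κ := by positivity
            linarith
          have h2 : nS ^ 2 * nA ^ 3 * ρ ^ 3 * ρν ^ 4 * c ^ 3 * w ^ 3 * u ^ 7 ≤
              nS ^ 4 * nA ^ 3 * ρ ^ 5 * ρν ^ 6 * c ^ 3 * w ^ 5 * u ^ 7 := by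
            gcongr <;> norm_num
          refine mul_le_mul_of_nonneg_right ?_ (by linarith)
          exact mul_le_mul h1 h2 (by positivity) (by linarith)
      _ = _ := by field_simp
  · have h1 : c₂ * (nS * nA * ρ ^ 2 * ρν ^ 2 * c) / ((1 / w) ^ 2 * (1 / u) ^ 2) = Z := by
      rw [hZ]
      field_simp
    rw [h1]
    exact hK1
  · have : 0 ≤ 4 / lmin := by positivity
    linarith
  · have h1 : 2 * c ≤ D * x := by
      have h2 : 4 / lmin * x ≥ 2 := by
        rw [ge_iff_le, div_mul_eq_mul_div, le_div_iff₀ hlmin]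
        linarith
      rw [hc, hD]
      linarith
    rw [← mul_div_assoc]
    exact div_le_div_of_nonneg_right h1 (by positivity)
  · have h1 : 2 * ρ * (x / (1 / u)) = 2 * ρ * x * u * w / w := by field_simp
    rw [h1, one_div_mul_eq_div]
    exact div_le_div_of_nonneg_right hm1 hw0.le
  · have h1 : 72 * (4 * (nA * (1 + x / 2 ^ t) / (1 / u) ^ 3)) * D * ρν ^ 2 * nS =
        q t * (x / 2 ^ t / (1 / u)) := by
      simp only [hq]
      field_simp
      ring
    rw [h1]
    exact mul_le_mul_of_nonneg_right (Nat.le_ceil _) (by positivity)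
  · have h1 : κ ^ 2 / (72 * ρν ^ 2 * nS * w ^ 2 * ρ ^ 2) ≤
        (x / 2 ^ m / (1 / u)) ^ 2 / (72 * ρν ^ 2 * nS) := by
      have h2 : x / 2 ^ m / (1 / u) = x * u / 2 ^ m := by field_simp
      have h3 : κ ^ 2 / (72 * ρν ^ 2 * nS * w ^ 2 * ρ ^ 2) =
          (κ / (w * ρ)) ^ 2 / (72 * ρν ^ 2 * nS) := by field_simp
      rw [h2, h3]
      gcongr
    have h4 : 16 * (nA * c / (1 / u) ^ 2) ^ 2 * l / (⌈n0⌉₊ : ℝ) ≤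
        κ ^ 2 / (72 * ρν ^ 2 * nS * w ^ 2 * ρ ^ 2) / 2 := by
      rw [div_le_iff₀ hNpos]
      refine le_trans (le_of_eq ?_) (mul_le_mul_of_nonneg_left (Nat.le_ceil n0) (by positivity))
      rw [hn0l]
      field_simp
      norm_num
    have h5 : 2 * (nS * nA * (2 * γ ^ K * c / (1 / u) ^ 2) ^ 2) ≤
        κ ^ 2 / (72 * ρν ^ 2 * nS * w ^ 2 * ρ ^ 2) / 2 := by
      have h6 : 2 * γ ^ K * c / (1 / u) ^ 2 ≤ 2 / (c₂ * (nS * nA * ρ ^ 2 * ρν ^ 2 * w ^ 2)) := by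
        have h7 : 2 * γ ^ K * c / (1 / u) ^ 2 = γ ^ K * (2 * c * u ^ 2) := by field_simp
        rw [h7]
        refine (mul_le_mul_of_nonneg_right hK2 (by positivity)).trans_eq ?_
        rw [hZ]
        field_simp
      calc 2 * (nS * nA * (2 * γ ^ K * c / (1 / u) ^ 2) ^ 2)
          ≤ 2 * (nS * nA * (2 / (c₂ * (nS * nA * ρ ^ 2 * ρν ^ 2 * w ^ 2))) ^ 2) := by
            have : 0 ≤ γ ^ K := pow_nonneg hγ0 K
            gcongr
        _ = 8 / (c₂ ^ 2 * (nS * nA * ρ ^ 4 * ρν ^ 4 * w ^ 4)) := by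
            field_simp
            norm_num
        _ ≤ 8 / (c₂ ^ 2 * (nS * ρ ^ 2 * ρν ^ 2 * w ^ 2)) := by
            have h8 : nS * ρ ^ 2 * ρν ^ 2 * w ^ 2 ≤ nS * nA * ρ ^ 4 * ρν ^ 4 * w ^ 4 := by
              calc nS * ρ ^ 2 * ρν ^ 2 * w ^ 2 = nS * 1 * ρ ^ 2 * ρν ^ 2 * w ^ 2 := by ring
                _ ≤ _ := by gcongr <;> norm_num
            gcongr
        _ ≤ _ := by
            rw [div_div, div_le_div_iff₀ (by positivity) (by positivity)]
            have h9 : 1152 ≤ (c₂ * κ) ^ 2 :=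
              le_trans (by norm_num) (pow_le_pow_left₀ (by norm_num : (0 : ℝ) ≤ 34) h34 2)
            have h10 := mul_le_mul_of_nonneg_right h9
              (by positivity : 0 ≤ nS * ρ ^ 2 * ρν ^ 2 * w ^ 2)
            linarith only [h10]
    linarith only [h1, h4, h5]
  · rw [hexp]
    have h1 : 4 * a * (2 * (nS ^ 2 * nA ^ 2 * ρ * ρν ^ 2 * c * u ^ 3 * w)) * d ≤ X ^ (3 + n) := by
      rw [pow_add, mul_comm (X ^ 3)]
      have h2 : 4 * a ≤ X ^ n := hn.le.trans (pow_le_pow_left₀ zero_le_two hX2 n)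
      have h3 : 2 * (nS ^ 2 * nA ^ 2 * ρ * ρν ^ 2 * c * u ^ 3 * w) * d ≤ X ^ 3 := by
        calc 2 * (nS ^ 2 * nA ^ 2 * ρ * ρν ^ 2 * c * u ^ 3 * w) * d
            = 2 * (nS ^ 2 * nA ^ 2 * ρ ^ 1 * ρν ^ 2 * c ^ 1 * u ^ 3 * w ^ 1) * d ^ 1 := by ring
          _ ≤ 8 * (nS ^ 3 * nA ^ 3 * ρ ^ 3 * ρν ^ 3 * c ^ 3 * u ^ 3 * w ^ 3) * d ^ 3 := by
              gcongr <;> norm_num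
          _ = X ^ 3 := by
              rw [hX]
              ring
      rw [mul_assoc]
      exact mul_le_mul h2 h3 (by positivity) (by positivity)
    calc (∑ t ∈ Finset.range (m + 1), (⌈q t⌉₊ : ℝ)) * (nS * nA * (2 * (1 / X ^ (3 + n))))
        ≤ 4 * a * (nS * nA * ρ * ρν ^ 2 * c * u ^ 3 * w) * (nS * nA * (2 * (1 / X ^ (3 + n)))) :=
          mul_le_mul_of_nonneg_right hsumI₂ (by positivity)
      _ = 4 * a * (2 * (nS ^ 2 * nA ^ 2 * ρ * ρν ^ 2 * c * u ^ 3 * w)) * d /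
          X ^ (3 + n) * (1 / d) := by
          field_simp
      _ ≤ 1 * (1 / d) := by
          refine mul_le_mul_of_nonneg_right ((div_le_one (by positivity)).2 h1) (by positivity)
      _ = 1 / d := one_mul _

end Parameters

end RegMDP

end

/-! ### Assembly -/

theorem theorem9 (lmin : ℝ) (hlmin : 0 < lmin) :
    ∃ c₂ : ℝ, 0 < c₂ ∧ ∀ lam₀ : ℝ, lmin ≤ lam₀ → ∃ c₁ : ℝ, 0 < c₁ ∧
    ∀ (S A : Type*) [Fintype S] [DecidableEq S] [Nonempty S] [Fintype A] [Nonempty A]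
      (γ ρ ρν B0 B1 B2 ε δ : ℝ),
      0 ≤ γ → γ < 1 → 1 ≤ ρ → 1 ≤ ρν → 0 ≤ B0 → 0 ≤ B1 → 0 ≤ B2 →
      0 < ε → ε ≤ 1 → 0 < δ → δ < 1 →
      -- numbers of epochs, of iterations per epoch, of trajectories per iteration, and
      -- truncation lengths, chosen from the above constants only
      ∃ (T : ℕ) (I N K : ℕ → ℕ),
        (∀ t, 0 < I t ∧ 0 < N t ∧ 0 < K t) ∧
        -- total number of iterations
        (∑ t ∈ Finset.range T, (I t : ℝ)) ≤
          c₁ * ((Fintype.card S : ℝ) * (Fintype.card A : ℝ) * ρ * ρν ^ 2 * (B0 + B1 + B2) /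
            (ε * (1 - γ) ^ 3)) ∧
        -- total number of trajectories
        (∑ t ∈ Finset.range T, (I t : ℝ) * (N t : ℝ)) ≤
          c₂ * ((Fintype.card S : ℝ) ^ 4 * (Fintype.card A : ℝ) ^ 3 * ρ ^ 5 * ρν ^ 6 *
              (1 + lam₀ * (B0 + B1 + B2)) ^ 3 / (ε ^ 5 * (1 - γ) ^ 7)) *
            Real.log (2 * (Fintype.card S : ℝ) * (Fintype.card A : ℝ) * ρ * ρν *
              (1 + lam₀ * (B0 + B1 + B2)) / (ε * (1 - γ) * δ)) ∧
        -- length of the trajectories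
        (∀ t, (K t : ℝ) ≤ 1 +
          Real.log (c₂ * ((Fintype.card S : ℝ) * (Fintype.card A : ℝ) * ρ ^ 2 * ρν ^ 2 *
              (1 + lam₀ * (B0 + B1 + B2))) / (ε ^ 2 * (1 - γ) ^ 2)) / Real.log (1 / γ)) ∧
        -- the guarantee, for every instance, initial policy and best-iterate selection rule
        ∀ (M : RegMDP.MDP S A γ) (W : (A → ℝ) → ℝ) (G : (A → ℝ) → A → ℝ)
          (μ ν : stdSimplex ℝ S) (π₀ : RegMDP.Policy S A)
          (sel : (t : ℕ) → (Fin (I t + 1) → RegMDP.Policy S A) → Fin (I t)),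
          RegMDP.IsRegularizer W G B0 B1 B2 →
          (∀ s, 0 < ν s) →
          (∀ s, μ s / ν s ≤ ρ) →
          (∀ lam : ℝ, 0 ≤ lam → lam ≤ lam₀ → ∃ πs : RegMDP.Policy S A,
            RegMDP.IsOptimal M W lam πs ∧
            ∀ (π : RegMDP.Policy S A) (s : S),
              RegMDP.visit M ν πs s / RegMDP.visit M ν π s ≤ ρν) →
          (∀ (t : ℕ) (path : Fin (I t + 1) → RegMDP.Policy S A) (k : Fin (I t)),
            RegMDP.J M W ν (path k.succ) (lam₀ / 2 ^ t) ≤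
              RegMDP.J M W ν (path (sel t path).succ) (lam₀ / 2 ^ t)) →
          ENNReal.ofReal (1 - δ) ≤
            (RegMDP.adaptReduce M W G ν lam₀ (B0 + B1 + B2) I N K sel π₀ T).toOuterMeasure
              {π | RegMDP.IsEpsOptimal M W μ ε π} := by
  obtain ⟨c₂, hc₂, hpar⟩ := RegMDP.exists_parameters lmin hlmin
  refine ⟨c₂, by linarith, fun lam₀ hlam₀ => ?_⟩
  obtain ⟨c₁, hc₁, hpar⟩ := hpar lam₀ hlam₀
  refine ⟨c₁, hc₁, ?_⟩
  intro S A _ _ _ _ _ γ ρ ρν B0 B1 B2 ε δ hγ0 hγ1 hρ hρν hB0 hB1 hB2 hε hε1 hδ hδ1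
  have hlam₀pos : 0 < lam₀ := hlmin.trans_le hlam₀
  have hS1 : (1 : ℝ) ≤ Fintype.card S := Nat.one_le_cast.2 Fintype.card_pos
  have hA1 : (1 : ℝ) ≤ Fintype.card A := Nat.one_le_cast.2 Fintype.card_pos
  have hg : 0 < 1 - γ := sub_pos.2 hγ1
  rcases lt_or_ge (B0 + B1 + B2) (1 / 2) with hCt | hCt
  · -- such a regularizer exists for a single action only, and then every policy is optimal
    have hc1 : 1 ≤ 1 + lam₀ * (B0 + B1 + B2) := le_add_of_nonneg_right (by positivity)
    have hden : ∀ j k : ℕ, ε ^ j * (1 - γ) ^ k ≤ 1 := fun j k =>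
      mul_le_one₀ (pow_le_one₀ hε.le hε1) (by positivity) (pow_le_one₀ hg.le (by linarith))
    -- No epoch is run. The parameters are fixed before any regularizer is given, so the three
    -- complexity bounds still have to be checked; each amounts to a nonnegative right-hand side or
    -- logarithm.
    refine ⟨0, fun _ => 1, fun _ => 1, fun _ => 1, fun _ => ⟨one_pos, one_pos, one_pos⟩, ?_, ?_,
      fun _ => ?_, ?_⟩
    · rw [Finset.range_zero, Finset.sum_empty]
      positivity
    · rw [Finset.range_zero, Finset.sum_empty]
      refine mul_nonneg (by positivity) (Real.log_nonneg ?_)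
      have h1 := hden 1 1
      rw [pow_one, pow_one] at h1
      rw [le_div_iff₀ (by positivity), one_mul]
      calc ε * (1 - γ) * δ ≤ 1 := mul_le_one₀ h1 hδ.le hδ1.le
        _ ≤ 2 * 1 * 1 * 1 * 1 * 1 := by norm_num
        _ ≤ _ := by gcongr
    · rw [Nat.cast_one, le_add_iff_nonneg_right]
      refine div_nonneg (Real.log_nonneg ?_) ?_
      · rw [le_div_iff₀ (by positivity), one_mul]
        calc ε ^ 2 * (1 - γ) ^ 2 ≤ 1 := hden 2 2
          _ = 1 * (1 * 1 * 1 ^ 2 * 1 ^ 2 * 1) := by norm_num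
          _ ≤ _ := by gcongr
      · rcases hγ0.eq_or_lt with rfl | h
        · simp
        · exact Real.log_nonneg ((one_le_div h).2 hγ1.le)
    · intro M W G μ ν π₀ sel hW _ _ _ _
      have hsub : Subsingleton A := hW.subsingleton (by linarith)
      have hall : {π | RegMDP.IsEpsOptimal M W μ ε π} = Set.univ := by
        refine Set.eq_univ_of_forall fun π π' => ?_
        have hπ : π' = π := by
          funext s
          refine Subtype.ext (funext fun a => ?_)
          have h1 := (π' s).2.2
          have h2 := (π s).2.2
          rw [Fintype.sum_subsingleton _ a] at h1 h2
          exact h1.trans h2.symm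
        rw [hπ, sub_self]
        exact hε.le
      rw [hall, RegMDP.toOuterMeasure_eq_lexpect, Set.indicator_univ, RegMDP.lexpect_const,
        ENNReal.ofReal_le_one]
      linarith
  · obtain ⟨m, N, K, I, D, l, hI0, hN, hK, hb1, hb2, hb3, hD, hD', hl, hm, hI, herr, hlN, hfail⟩ :=
      hpar (Fintype.card S) (Fintype.card A) γ ρ ρν (B0 + B1 + B2) ε δ hS1 hA1 hγ0 hγ1 hρ hρν hCt
        hε hε1 hδ hδ1
    refine ⟨m + 1, I, fun _ => N, fun _ => K, fun t => ⟨hI0 t, hN, hK⟩, hb1, hb2, fun _ => hb3, ?_⟩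
    intro M W G μ ν π₀ sel hW hν hμ hopt hsel
    exact RegMDP.adaptReduce_guarantee hW hB0 hB1 hB2 rfl (by linarith) hlam₀pos hρ hρν hδ.le hD hD'
      hl hI0 hN hK hm hI herr hlN hfail μ ν π₀ sel hν hμ hopt hsel
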